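/- Let $X$ be an $n$-dimensional ($n\ge 1$) oriented smooth manifold with boundary, and let $Y\subset\partial X$ be a union of connected components of the boundary. A *defining function* of $Y$ is a smooth function $\lambda\colon X\to\mathbb R_{\ge 0}$ such that $\lambda=0$ and $d\lambda\neq 0$ at every point of $Y$, and $\lambda>0$ on $X\smallsetminus Y$. A complex-valued differential $n$-form $\omega$ on $X\smallsetminus Y$ *has a polar singularity of order $M\in\mathbb Z_{\ge0}$ at $Y$* if $\lambda^M\omega$ extends to a smooth form on $X$ for a defining function $\lambda$ (this does not depend on the choice of $\lambda$); it *has compact support* if the closure in $X$ of $\{x\in X\smallsetminus Y:\omega_x\neq0\}$ is compact. **Theorem.** There are quantities $I_{-k}(\lambda,\omega)$ ($k\ge1$), $I_0(\omega)$ and $I_{\mathrm{finite}}(\lambda,\omega)$ in $\mathbb C$, with $I_0(\omega)$ independent of $\lambda$, and functions $\tilde\zeta(s;\lambda,\omega)$ of $s$, meromorphic on $\mathbb C$, such that for every $M\in\mathbb Z_{\ge0}$, every defining function $\lambda$ of $Y$ and every compactly supported $n$-form $\omega$ on $X\smallsetminus Y$ with a polar singularity of order $M$ at $Y$ the following hold.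 1. The integral $\int_X\lambda^s\omega$ converges absolutely and is holomorphic in $s$ for $\operatorname{Re}s>M-1$; $\tilde\zeta(s;\lambda,\omega)$ is its meromorphic continuation to $\mathbb C$. It is holomorphic away from the points $s=M-1,M-2,M-3,\dots$ and has at most simple poles at these points. 2. For every $\epsilon>0$ the integral $\int_{\lambda\ge\epsilon}\omega$ converges absolutely, and as $\epsilon\to0^+$ $$\int_{\lambda\ge\epsilon}\omega=\sum_{k=1}^{M-1}I_{-k}(\lambda,\omega)\,\epsilon^{-k}+I_0(\omega)\log\frac1\epsilon+I_{\mathrm{finite}}(\lambda,\omega)+O(\epsilon).$$ 3. For $k=1,\dots,M-1$, $$I_{-k}(\lambda,\omega)=\frac1k\operatorname{res}_{s=k}\tilde\zeta(s;\lambda,\omega),\qquad I_0(\omega)=\operatorname{res}_{s=0}\tilde\zeta(s;\lambda,\omega),$$ and $$I_{\mathrm{finite}}(\lambda,\omega)=\lim_{s\to0}\Bigl(\tilde\zeta(s;\lambda,\omega)-\frac{I_0(\omega)}s\Bigr).$$ 4. For every real-valued $\varphi\in C^\infty(X)$, $$I_{\mathrm{finite}}(\lambda e^{\varphi},\omega)=I_{\mathrm{finite}}(\lambda,\omega)+I_0(\varphi\,\omega).$$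 -/

import Mathlib

open Set Filter Topology MeasureTheory
open scoped Manifold ContDiff

noncomputable section

namespace BoundaryZeta

/-- A complex-valued differential form of top degree `n` on an `n`-dimensional manifold with boundary
(a pointwise family of alternating forms, without any regularity). -/
abbrev TopForm (n : ℕ) [NeZero n] (X : Type*) [TopologicalSpace X]
    [ChartedSpace (EuclideanHalfSpace n) X] : Type _ :=
  ∀ x : X, TangentSpace (𝓡∂ n) x [⋀^Fin n]→L[ℝ] ℂ

section Defs

variable {n : ℕ} [NeZero n] {X : Type*} [TopologicalSpace X]
  [ChartedSpace (EuclideanHalfSpace n) X]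

/-- The `i`-th coordinate vector field `∂/∂yᵢ` of the chart centred at `p`, at the point of the
manifold whose coordinates in this chart are `y`. -/
def coordVector (p : X) (y : EuclideanSpace ℝ (Fin n)) (i : Fin n) :
    TangentSpace (𝓡∂ n) ((extChartAt (𝓡∂ n) p).symm y) :=
  mfderivWithin 𝓘(ℝ, EuclideanSpace ℝ (Fin n)) (𝓡∂ n) (extChartAt (𝓡∂ n) p).symm
    (range (𝓡∂ n)) y (EuclideanSpace.single i (1 : ℝ))

/-- The coefficient `f` of the pull-back `f dy₁ ∧ ⋯ ∧ dyₙ` of a top-degree form to the chart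
centred at `p`. -/
def coeff (p : X) (w : TopForm n X) (y : EuclideanSpace ℝ (Fin n)) : ℂ :=
  w ((extChartAt (𝓡∂ n) p).symm y) (coordVector p y)

/-- A top-degree form is smooth (up to and including the boundary) if its coefficient is smooth
in every chart. -/
def IsSmoothForm (w : TopForm n X) : Prop :=
  ∀ p : X, ContDiffOn ℝ ∞ (coeff p w) (extChartAt (𝓡∂ n) p).target

/-- For a choice `o` of orientations of the tangent spaces: the sign (`1` or `-1`) telling whether
the coordinate frame of the chart centred at `p` is positively oriented at the point with
coordinates `y`. -/
def orientationSign (o : ∀ x : X, Orientation ℝ (TangentSpace (𝓡∂ n) x) (Fin n))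
    (p : X) (y : EuclideanSpace ℝ (Fin n)) : SignType :=
  SignType.sign ((o ((extChartAt (𝓡∂ n) p).symm y)).someVector (coordVector p y))

variable (n X) in
/-- An orientation of a manifold with boundary: a continuous choice of orientations of the tangent
spaces (the sign of every coordinate frame is locally constant on its chart). -/
structure ManifoldOrientation where
  /-- the orientation of each tangent space -/
  at_pt : ∀ x : X, Orientation ℝ (TangentSpace (𝓡∂ n) x) (Fin n)
  /-- continuity -/
  continuousOn_sign : ∀ p : X,
    ContinuousOn (orientationSign at_pt p) (extChartAt (𝓡∂ n) p).target

section Integral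

variable [IsManifold (𝓡∂ n) ∞ X] [T2Space X] [SigmaCompactSpace X]

variable (n X) in
/-- A smooth partition of unity subordinate to the cover of `X` by the domains of its charts,
fixed once and for all. -/
def chartPartition : SmoothPartitionOfUnity X (𝓡∂ n) X univ :=
  Classical.choose (SmoothPartitionOfUnity.exists_isSubordinate_chartAt_source (𝓡∂ n) X)

theorem chartPartition_isSubordinate :
    (chartPartition n X).IsSubordinate
      (fun x ↦ (chartAt (EuclideanHalfSpace n) x).source) :=
  Classical.choose_spec (SmoothPartitionOfUnity.exists_isSubordinate_chartAt_source (𝓡∂ n) X)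

/-- The density, in the coordinates of the chart centred at `p`, of the form `ρₚ w`, where `ρₚ` is
the `p`-th function of the partition of unity; the sign is that of the chart. -/
def localDensity (o : ManifoldOrientation n X) (w : TopForm n X) (p : X)
    (y : EuclideanSpace ℝ (Fin n)) : ℂ :=
  ((orientationSign o.at_pt p y : ℝ) : ℂ) *
    ((chartPartition n X p ((extChartAt (𝓡∂ n) p).symm y) : ℝ) : ℂ) * coeff p w y

/-- The coordinates, in the chart centred at `p`, of the points of `S`. -/
def chartImage (S : Set X) (p : X) : Set (EuclideanSpace ℝ (Fin n)) :=
  (extChartAt (𝓡∂ n) p).target ∩ (extChartAt (𝓡∂ n) p).symm ⁻¹' S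

/-- Absolute integrability over `S` of a compactly supported top-degree form. -/
def FormIntegrableOn (o : ManifoldOrientation n X) (S : Set X) (w : TopForm n X) : Prop :=
  ∀ p : X, IntegrableOn (localDensity o w p) (chartImage S p)

/-- The integral over `S` of a compactly supported top-degree form on an oriented manifold
with boundary, through the partition of unity (for a form of compact support only finitely
many terms are non-zero). -/
def formIntegral (o : ManifoldOrientation n X) (S : Set X) (w : TopForm n X) : ℂ :=
  ∑ᶠ p : X, ∫ y in chartImage S p, localDensity o w p y

end Integral

/-- `Y` is a union of connected components of the boundary of `X`. -/
def IsUnionOfBoundaryComponents (n : ℕ) [NeZero n] {X : Type*} [TopologicalSpace X]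
    [ChartedSpace (EuclideanHalfSpace n) X] (Y : Set X) : Prop :=
  Y ⊆ (𝓡∂ n).boundary X ∧ ∀ x ∈ Y, connectedComponentIn ((𝓡∂ n).boundary X) x ⊆ Y

/-- A smooth nonnegative function that vanishes exactly on `Y`, and there to first order. -/
structure IsDefiningFunction (n : ℕ) [NeZero n] {X : Type*} [TopologicalSpace X]
    [ChartedSpace (EuclideanHalfSpace n) X] (Y : Set X) (lam : X → ℝ) : Prop where
  smooth : ContMDiff (𝓡∂ n) 𝓘(ℝ, ℝ) ∞ lam
  zero_on : ∀ x ∈ Y, lam x = 0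
  deriv_ne_zero : ∀ x ∈ Y, mfderiv (𝓡∂ n) 𝓘(ℝ, ℝ) lam x ≠ 0
  pos_off : ∀ x ∉ Y, 0 < lam x

/-- The form `w` on `X ∖ Y` has a polar singularity of order `M` at `Y`: for a defining function
`lam` of `Y` the form `lam ^ M w` extends smoothly to `X`. The values of `w` on `Y` play no role. -/
def HasPoleOfOrder (Y : Set X) (M : ℕ) (w : TopForm n X) : Prop :=
  ∃ lam : X → ℝ, IsDefiningFunction n Y lam ∧
    ∃ η : TopForm n X, IsSmoothForm η ∧ ∀ x ∉ Y, η x = (lam x) ^ M • w x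

/-- The form `w` on `X ∖ Y` has compact support in `X`. -/
def HasCompactSupportIn (Y : Set X) (w : TopForm n X) : Prop :=
  IsCompact (closure {x : X | x ∉ Y ∧ w x ≠ 0})

/-- The form `lam ^ s w`, for a complex exponent `s`. -/
def powForm (lam : X → ℝ) (s : ℂ) (w : TopForm n X) : TopForm n X :=
  fun x ↦ ((lam x : ℂ) ^ s) • w x

/-- The form `φ w`. -/
def mulForm (φ : X → ℝ) (w : TopForm n X) : TopForm n X :=
  fun x ↦ φ x • w x

end Defs

/-- `f` has at `a` at most a simple pole, with residue `r` (possibly zero). -/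
def HasSimplePoleWithResidue (f : ℂ → ℂ) (a r : ℂ) : Prop :=
  ∃ g : ℂ → ℂ, AnalyticAt ℂ g a ∧ ∀ᶠ z in 𝓝[≠] a, f z = r / (z - a) + g z

end BoundaryZeta

end

/-!
The integrals of a form with a pole along `Y` are reduced to integrals of one variable, by pushing
forward under the defining function `lam`.

In a chart the form is `lam⁻ᴹ η dy` with `η` smooth and of compact support. Near `Y` the vector
field `∂₀ / ∂₀ lam` is smooth and `lam` grows along it with unit speed. Integration by parts along
this field and the layer-cake formula give `∫ c(lam) η dy = ∫ c(v) G(v) dv`, where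
`G(v) = -∫_{lam ≥ v} L η dy` and `L η = ∂₀ (η / ∂₀ lam)` (`IsCollar.setIntegral_superlevel`). The
derivative of `v ↦ ∫_{lam ≥ v} η dy` is the same integral for `L η`, so that iteration yields the
Taylor expansion `∑ aⱼ vʲ` of `G` at `0` (`IsCollar.levelIntegral_expansion`). Away from `Y` the
function `lam` is bounded below, and the contribution to the zeta function is entire.

Hence the zeta function is the Mellin transform of `G` at `s - M + 1` up to an entire function, and
the integral over `{lam ≥ ε}` is `∫_ε^∞ v⁻ᴹ G(v) dv` up to a constant (`exists_expansion`).
Subtracting Taylor polynomials of `G` continues the former, with residue `aⱼ` at `M - 1 - j`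
(`HasTaylorExpansion.mellinContinuation_hasSimplePole`), and expands the latter with the same
coefficients (`HasTaylorExpansion.cutoff_isBigO`); the constant terms agree as well.

Any two defining functions are related by `lam' = lam exp φ` with `φ` smooth, by Hadamard's lemma
(`IsDefiningFunction.exists_eq_mul_exp`). To compare their zeta functions, integration by parts is
applied to `∫ lam^(s-M) exp(sφ) η`. It shows that `s (s - 1) ⋯ (s - M + 1)` times the zeta function
of `lam exp φ` is holomorphic on `Re s > -1`, that its value at `0` does not depend on `φ`, and that
its derivative at `0` changes with `φ` by the value at `0` of the same function for the form `φ w`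
(`exists_regular_formIntegral`). For `M ≥ 1` the polynomial has a simple zero at `0`, and these
facts are the invariance of the residue and the transformation law of the finite part
(`IsZeta.compare`). The case `M = 0` is covered because the order of the pole may be overestimated.
-/

noncomputable section

set_option linter.unusedSectionVars false

namespace BoundaryZeta

/-! ### Functions of one variable with a Taylor expansion at zero -/

/-- A bounded function `G` on `(0, ∞)`, vanishing near infinity, that has the asymptotic expansion
`∑ aⱼ vʲ` to all orders as `v → 0⁺`. -/
structure HasTaylorExpansion (G : ℝ → ℂ) (a : ℕ → ℂ) : Prop where
  aestronglyMeasurable : AEStronglyMeasurable G (volume.restrict (Ioi 0))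
  bounded : ∃ B : ℝ, ∀ v, 0 < v → ‖G v‖ ≤ B
  eventually_zero : ∃ R : ℝ, ∀ v, R < v → G v = 0
  expansion : ∀ K : ℕ, (fun v : ℝ ↦ G v - ∑ j ∈ Finset.range K, a j * (v : ℂ) ^ j)
    =O[𝓝[>] (0 : ℝ)] (fun v : ℝ ↦ v ^ K)

/-- The function `G` minus the first `K` terms of its expansion, the latter cut off at `v = 1`. -/
def taylorTail (G : ℝ → ℂ) (a : ℕ → ℂ) (K : ℕ) (v : ℝ) : ℂ :=
  G v - ∑ j ∈ Finset.range K, a j * (Ioc (0 : ℝ) 1).indicator (fun t ↦ (t : ℂ) ^ (j : ℂ)) v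

theorem HasTaylorExpansion.zero : HasTaylorExpansion (fun _ ↦ 0) (fun _ ↦ 0) where
  aestronglyMeasurable := aestronglyMeasurable_const
  bounded := ⟨0, by simp⟩
  eventually_zero := ⟨0, by simp⟩
  expansion K := by simpa using! Asymptotics.isBigO_zero _ _

theorem HasTaylorExpansion.add {G G' : ℝ → ℂ} {a a' : ℕ → ℂ} (h : HasTaylorExpansion G a)
    (h' : HasTaylorExpansion G' a') :
    HasTaylorExpansion (fun v ↦ G v + G' v) (fun j ↦ a j + a' j) where
  aestronglyMeasurable := h.aestronglyMeasurable.add h'.aestronglyMeasurable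
  bounded := by
    obtain ⟨B, hB⟩ := h.bounded
    obtain ⟨B', hB'⟩ := h'.bounded
    exact ⟨B + B', fun v hv ↦ (norm_add_le _ _).trans (add_le_add (hB v hv) (hB' v hv))⟩
  eventually_zero := by
    obtain ⟨R, hR⟩ := h.eventually_zero
    obtain ⟨R', hR'⟩ := h'.eventually_zero
    refine ⟨max R R', fun v hv ↦ ?_⟩
    rw [max_lt_iff] at hv
    rw [hR v hv.1, hR' v hv.2, add_zero]
  expansion K := by
    refine ((h.expansion K).add (h'.expansion K)).congr_left fun v ↦ ?_
    simp only [add_mul, Finset.sum_add_distrib]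
    ring

theorem HasTaylorExpansion.sum {ι : Type*} (s : Finset ι) {G : ι → ℝ → ℂ} {a : ι → ℕ → ℂ}
    (h : ∀ i ∈ s, HasTaylorExpansion (G i) (a i)) :
    HasTaylorExpansion (fun v ↦ ∑ i ∈ s, G i v) (fun j ↦ ∑ i ∈ s, a i j) := by
  classical
  induction s using Finset.induction_on with
  | empty => simpa using HasTaylorExpansion.zero
  | insert i s hi ih =>
    simp only [Finset.sum_insert hi]
    exact (h i (by simp)).add (ih fun j hj ↦ h j (by simp [hj]))

section Mellin

variable {G : ℝ → ℂ} {a : ℕ → ℂ}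

theorem HasTaylorExpansion.locallyIntegrableOn (h : HasTaylorExpansion G a) :
    LocallyIntegrableOn G (Ioi 0) := by
  obtain ⟨B, hB⟩ := h.bounded
  rw [locallyIntegrableOn_iff isOpen_Ioi.isLocallyClosed]
  intro k hk hkc
  refine IntegrableOn.of_bound hkc.measure_lt_top ?_ B ?_
  · exact h.aestronglyMeasurable.mono_set hk
  · exact (ae_restrict_mem hkc.measurableSet).mono fun v hv ↦ hB v (hk hv)

theorem HasTaylorExpansion.eventually_eq_zero (h : HasTaylorExpansion G a) :
    ∀ᶠ v in atTop, G v = 0 := by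
  obtain ⟨R, hR⟩ := h.eventually_zero
  exact (eventually_gt_atTop R).mono hR

theorem mellinConvergent_monomial (j : ℕ) {s : ℂ} (hs : -(j : ℝ) < s.re) :
    HasMellin ((Ioc (0 : ℝ) 1).indicator (fun t ↦ (t : ℂ) ^ (j : ℂ))) s (1 / (s + j)) :=
  hasMellin_cpow_Ioc _ (by simp; linarith)

theorem locallyIntegrableOn_monomial (j : ℕ) :
    LocallyIntegrableOn ((Ioc (0 : ℝ) 1).indicator (fun t ↦ (t : ℂ) ^ (j : ℂ))) (Ioi 0) := by
  refine (LocallyIntegrable.indicator ?_ measurableSet_Ioc).locallyIntegrableOn _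
  simp only [Complex.cpow_natCast]
  exact (by fun_prop : Continuous fun t : ℝ ↦ (t : ℂ) ^ j).locallyIntegrable

theorem HasTaylorExpansion.locallyIntegrableOn_tail (h : HasTaylorExpansion G a) (K : ℕ) :
    LocallyIntegrableOn (taylorTail G a K) (Ioi 0) := by
  unfold taylorTail
  refine h.locallyIntegrableOn.sub ?_
  induction K with
  | zero => simpa using (locallyIntegrable_const (0 : ℂ)).locallyIntegrableOn _
  | succ K ih =>
    simp only [Finset.sum_range_succ]
    exact ih.add ((locallyIntegrableOn_monomial K).smul (a K))

theorem HasTaylorExpansion.tail_isBigO_top (h : HasTaylorExpansion G a) (K : ℕ) (A : ℝ) :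
    taylorTail G a K =O[atTop] (fun v : ℝ ↦ v ^ (-A)) := by
  refine Asymptotics.IsBigO.congr' (Asymptotics.isBigO_zero (E' := ℂ) _ _) ?_ EventuallyEq.rfl
  filter_upwards [h.eventually_eq_zero, eventually_gt_atTop 1] with v hv hv1
  have : v ∉ Ioc (0 : ℝ) 1 := fun hh ↦ absurd hh.2 (not_le.2 hv1)
  simp [taylorTail, hv, this]

theorem HasTaylorExpansion.tail_isBigO_zero (h : HasTaylorExpansion G a) (K : ℕ) :
    taylorTail G a K =O[𝓝[>] 0] (fun v : ℝ ↦ v ^ (-(-(K : ℝ)))) := by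
  refine (h.expansion K).congr' ?_ ?_
  · filter_upwards [Ioc_mem_nhdsGT (zero_lt_one' ℝ)] with v hv
    simp [taylorTail, hv]
  · filter_upwards with v
    simp

theorem HasTaylorExpansion.mellinConvergent_tail (h : HasTaylorExpansion G a) (K : ℕ) {s : ℂ}
    (hs : -(K : ℝ) < s.re) : MellinConvergent (taylorTail G a K) s :=
  mellinConvergent_of_isBigO_rpow (h.locallyIntegrableOn_tail K)
    (h.tail_isBigO_top K (s.re + 1)) (by linarith) (h.tail_isBigO_zero K) hs

theorem HasTaylorExpansion.differentiableAt_tail (h : HasTaylorExpansion G a) (K : ℕ) {s : ℂ}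
    (hs : -(K : ℝ) < s.re) : DifferentiableAt ℂ (mellin (taylorTail G a K)) s :=
  mellin_differentiableAt_of_isBigO_rpow (h.locallyIntegrableOn_tail K)
    (h.tail_isBigO_top K (s.re + 1)) (by linarith) (h.tail_isBigO_zero K) hs

theorem HasTaylorExpansion.analyticAt_tail (h : HasTaylorExpansion G a) (K : ℕ) {s : ℂ}
    (hs : -(K : ℝ) < s.re) : AnalyticAt ℂ (mellin (taylorTail G a K)) s := by
  have ho : IsOpen {s : ℂ | -(K : ℝ) < s.re} := isOpen_lt continuous_const Complex.continuous_re
  exact DifferentiableOn.analyticAt (s := {s : ℂ | -(K : ℝ) < s.re})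
    (fun z hz ↦ (h.differentiableAt_tail K hz).differentiableWithinAt) (ho.mem_nhds hs)

theorem HasTaylorExpansion.mellin_tail_succ (h : HasTaylorExpansion G a) (K : ℕ) {s : ℂ}
    (hs : -(K : ℝ) < s.re) :
    mellin (taylorTail G a K) s = a K / (s + K) + mellin (taylorTail G a (K + 1)) s := by
  have h1 := (mellinConvergent_monomial K hs)
  have h2 := hasMellin_const_smul h1.1 (a K)
  have h3 := hasMellin_add h2.1
    (h.mellinConvergent_tail (K + 1) (s := s) (by push_cast; linarith))
  have h4 : taylorTail G a K = fun t ↦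
      a K • (Ioc (0 : ℝ) 1).indicator (fun t ↦ (t : ℂ) ^ (K : ℂ)) t + taylorTail G a (K + 1) t := by
    funext t
    simp only [taylorTail, Finset.sum_range_succ, smul_eq_mul]
    ring
  rw [h4, h3.2, h2.2, h1.2, smul_eq_mul]
  ring

theorem taylorTail_zero : taylorTail G a 0 = G := by
  funext v; simp [taylorTail]

/-- The meromorphic continuation of the Mellin transform of a function with an expansion at `0`:
the first `K` terms of the expansion contribute `aⱼ / (s + j)`, and the Mellin transform of the rest
converges for `Re s > -K`. The definition takes a sufficiently large `K` depending on `s`; by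
`HasTaylorExpansion.mellinContinuation_eq` every such `K` gives the same value. -/
def mellinContinuation (G : ℝ → ℂ) (a : ℕ → ℂ) (s : ℂ) : ℂ :=
  ∑ j ∈ Finset.range (⌈-s.re⌉₊ + 1), a j / (s + j) + mellin (taylorTail G a (⌈-s.re⌉₊ + 1)) s

theorem HasTaylorExpansion.mellin_tail_eq_of_le (h : HasTaylorExpansion G a) {K N : ℕ} (hKN : K ≤ N)
    {s : ℂ} (hs : -(K : ℝ) < s.re) :
    ∑ j ∈ Finset.range K, a j / (s + j) + mellin (taylorTail G a K) s =
      ∑ j ∈ Finset.range N, a j / (s + j) + mellin (taylorTail G a N) s := by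
  induction N, hKN using Nat.le_induction with
  | base => rfl
  | succ N hN ih =>
    rw [ih, Finset.sum_range_succ, h.mellin_tail_succ N]
    · ring
    · have : (K : ℝ) ≤ N := by exact_mod_cast hN
      linarith

theorem HasTaylorExpansion.mellinContinuation_eq (h : HasTaylorExpansion G a) (K : ℕ) {s : ℂ}
    (hs : -(K : ℝ) < s.re) :
    mellinContinuation G a s =
      ∑ j ∈ Finset.range K, a j / (s + j) + mellin (taylorTail G a K) s := by
  have hs' : -((⌈-s.re⌉₊ + 1 : ℕ) : ℝ) < s.re := by
    have := Nat.le_ceil (-s.re)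
    push_cast
    linarith
  unfold mellinContinuation
  rcases le_total K (⌈-s.re⌉₊ + 1) with hK | hK
  · exact (h.mellin_tail_eq_of_le hK hs).symm
  · exact h.mellin_tail_eq_of_le hK hs'

theorem HasTaylorExpansion.mellinContinuation_eq_mellin (h : HasTaylorExpansion G a) {s : ℂ}
    (hs : 0 < s.re) : mellinContinuation G a s = mellin G s := by
  rw [h.mellinContinuation_eq 0 (by simpa using hs), taylorTail_zero]
  simp

theorem HasTaylorExpansion.mellinContinuation_eventuallyEq (h : HasTaylorExpansion G a) (K : ℕ)
    {s : ℂ} (hs : -(K : ℝ) < s.re) :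
    mellinContinuation G a =ᶠ[𝓝 s] fun z ↦
      ∑ j ∈ Finset.range K, a j / (z + j) + mellin (taylorTail G a K) z := by
  have ho : IsOpen {s : ℂ | -(K : ℝ) < s.re} := isOpen_lt continuous_const Complex.continuous_re
  filter_upwards [ho.mem_nhds hs] with z hz using h.mellinContinuation_eq K hz

theorem analyticAt_div_add {c b s : ℂ} (hs : s + b ≠ 0) : AnalyticAt ℂ (fun z ↦ c / (z + b)) s :=
  analyticAt_const.div (analyticAt_id.add analyticAt_const) hs

theorem HasTaylorExpansion.analyticAt_mellinContinuation (h : HasTaylorExpansion G a) {s : ℂ}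
    (hs : ∀ j : ℕ, s ≠ -j) : AnalyticAt ℂ (mellinContinuation G a) s := by
  obtain ⟨K, hK⟩ := exists_nat_gt (-s.re)
  rw [analyticAt_congr (h.mellinContinuation_eventuallyEq K (by linarith))]
  refine AnalyticAt.add (Finset.analyticAt_fun_sum _ fun j _ ↦ analyticAt_div_add ?_)
    (h.analyticAt_tail K (by linarith))
  exact fun h0 ↦ hs j (eq_neg_of_add_eq_zero_left h0)

theorem HasTaylorExpansion.mellinContinuation_hasSimplePole (h : HasTaylorExpansion G a) (j : ℕ) :
    HasSimplePoleWithResidue (mellinContinuation G a) (-j) (a j) := by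
  have hj : -((j + 1 : ℕ) : ℝ) < (-(j : ℂ)).re := by simp
  refine ⟨fun z ↦ ∑ i ∈ Finset.range j, a i / (z + i) + mellin (taylorTail G a (j + 1)) z,
    AnalyticAt.add (Finset.analyticAt_fun_sum _ fun i hi ↦ analyticAt_div_add ?_)
      (h.analyticAt_tail (j + 1) hj), ?_⟩
  · have : i < j := Finset.mem_range.1 hi
    intro h0
    have : (i : ℂ) = j := by linear_combination h0
    have : i = j := by exact_mod_cast this
    omega
  · filter_upwards [(h.mellinContinuation_eventuallyEq (j + 1) hj).filter_mono
      nhdsWithin_le_nhds] with z hz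
    rw [hz, Finset.sum_range_succ]
    ring

end Mellin

theorem HasSimplePoleWithResidue.of_analyticAt {f : ℂ → ℂ} {z : ℂ} (h : AnalyticAt ℂ f z) :
    HasSimplePoleWithResidue f z 0 :=
  ⟨f, h, by simp⟩

theorem HasSimplePoleWithResidue.meromorphicAt {f : ℂ → ℂ} {z r : ℂ}
    (h : HasSimplePoleWithResidue f z r) : MeromorphicAt f z := by
  obtain ⟨g, hg, hfg⟩ := h
  refine MeromorphicAt.congr (f := fun w ↦ r / (w - z) + g w) ?_ (hfg.mono fun w hw ↦ hw.symm)
  exact ((MeromorphicAt.const r z).div ((MeromorphicAt.id z).sub (MeromorphicAt.const z z))).add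
    hg.meromorphicAt

theorem HasSimplePoleWithResidue.comp_add_const {f : ℂ → ℂ} {z r c : ℂ}
    (h : HasSimplePoleWithResidue f (z + c) r) :
    HasSimplePoleWithResidue (fun w ↦ f (w + c)) z r := by
  obtain ⟨g, hg, hfg⟩ := h
  refine ⟨fun w ↦ g (w + c), ?_, ?_⟩
  · exact hg.comp_of_eq (f := fun w ↦ w + c) (analyticAt_id.add analyticAt_const) rfl
  · have ht : Tendsto (fun w : ℂ ↦ w + c) (𝓝[≠] z) (𝓝[≠] (z + c)) := by
      refine tendsto_nhdsWithin_of_tendsto_nhds_of_eventually_within _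
        (((continuous_id.add continuous_const).tendsto z).mono_left nhdsWithin_le_nhds) ?_
      filter_upwards [self_mem_nhdsWithin] with w hw
      simpa using hw
    filter_upwards [ht.eventually hfg] with w hw
    rw [hw]
    congr 2
    ring

theorem HasSimplePoleWithResidue.add_analyticAt {f A : ℂ → ℂ} {z r : ℂ}
    (h : HasSimplePoleWithResidue f z r) (hA : AnalyticAt ℂ A z) :
    HasSimplePoleWithResidue (fun w ↦ f w + A w) z r := by
  obtain ⟨g, hg, hfg⟩ := h
  exact ⟨fun w ↦ g w + A w, hg.add hA, hfg.mono fun w hw ↦ by simp only [hw]; ring⟩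

/-! ### Cut-off integrals of one variable -/

section Cutoff

variable {G : ℝ → ℂ} {a : ℕ → ℂ}

theorem sum_range_eq_sum_Icc {β : Type*} [AddCommMonoid β] (m : ℕ) (F : ℕ → ℕ → β) :
    ∑ j ∈ Finset.range m, F j (m - j) = ∑ k ∈ Finset.Icc 1 m, F (m - k) k := by
  refine Finset.sum_bij' (fun j _ ↦ m - j) (fun k _ ↦ m - k) ?_ ?_ ?_ ?_ ?_
  · intro j hj; simp only [Finset.mem_range] at hj; simp only [Finset.mem_Icc]; omega
  · intro j hj; simp only [Finset.mem_Icc] at hj; simp only [Finset.mem_range]; omega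
  · intro j hj; simp only [Finset.mem_range] at hj; omega
  · intro j hj; simp only [Finset.mem_Icc] at hj; omega
  · intro j hj
    simp only [Finset.mem_range] at hj
    rw [show m - (m - j) = j by omega]

theorem monomial_eqOn {ε : ℝ} (hε : 0 < ε) (M j : ℕ) :
    EqOn (fun v : ℝ ↦ (v : ℂ) ^ (-(M : ℂ)) *
      (Ioc (0 : ℝ) 1).indicator (fun t ↦ (t : ℂ) ^ (j : ℂ)) v)
      ((Ioc ε 1).indicator fun v : ℝ ↦ (v : ℂ) ^ ((j : ℂ) - M)) (Ioi ε) := by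
  intro v hv
  have hv0 : (0 : ℝ) < v := hε.trans hv
  by_cases h1 : v ≤ 1
  · beta_reduce
    rw [indicator_of_mem (show v ∈ Ioc ε 1 from ⟨hv, h1⟩),
      indicator_of_mem (show v ∈ Ioc 0 1 from ⟨hv0, h1⟩), ← Complex.cpow_add _ _
      (by exact_mod_cast hv0.ne')]
    ring_nf
  · have h2 : v ∉ Ioc (0 : ℝ) 1 := fun h ↦ h1 h.2
    have h3 : v ∉ Ioc ε 1 := fun h ↦ h1 h.2
    simp [h2, h3]

theorem integral_monomial {ε : ℝ} (hε : 0 < ε) (hε1 : ε ≤ 1) (M j : ℕ) :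
    ∫ v in Ioi ε, (v : ℂ) ^ (-(M : ℂ)) *
      (Ioc (0 : ℝ) 1).indicator (fun t ↦ (t : ℂ) ^ (j : ℂ)) v =
        ∫ v in ε..1, (v : ℂ) ^ ((j : ℂ) - M) := by
  rw [setIntegral_congr_fun measurableSet_Ioi (monomial_eqOn hε M j),
    setIntegral_indicator measurableSet_Ioc, intervalIntegral.integral_of_le hε1,
    inter_eq_right.2 Ioc_subset_Ioi_self]

theorem integrableOn_monomial {ε : ℝ} (hε : 0 < ε) (hε1 : ε ≤ 1) (M j : ℕ) :
    IntegrableOn (fun v : ℝ ↦ (v : ℂ) ^ (-(M : ℂ)) *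
      (Ioc (0 : ℝ) 1).indicator (fun t ↦ (t : ℂ) ^ (j : ℂ)) v) (Ioi ε) := by
  rw [integrableOn_congr_fun (monomial_eqOn hε M j) measurableSet_Ioi]
  refine Integrable.integrableOn ((integrable_indicator_iff measurableSet_Ioc).2 ?_)
  rw [← intervalIntegrable_iff_integrableOn_Ioc_of_le hε1]
  refine intervalIntegral.intervalIntegrable_cpow (Or.inr ?_)
  rw [uIcc_of_le hε1]
  exact fun h ↦ absurd h.1 (not_le.2 hε)

theorem integral_monomial_eq_log {ε : ℝ} (hε : 0 < ε) (hε1 : ε ≤ 1) (m : ℕ) :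
    ∫ v in Ioi ε, (v : ℂ) ^ (-((m + 1 : ℕ) : ℂ)) *
      (Ioc (0 : ℝ) 1).indicator (fun t ↦ (t : ℂ) ^ (m : ℂ)) v = (Real.log (1 / ε) : ℝ) := by
  rw [integral_monomial hε hε1, ← integral_one_div_of_pos hε one_pos,
    ← intervalIntegral.integral_ofReal]
  refine intervalIntegral.integral_congr fun v _ ↦ ?_
  rw [show ((m : ℂ) - ((m + 1 : ℕ) : ℂ)) = -1 by push_cast; ring, Complex.cpow_neg_one]
  simp

theorem integral_monomial_eq_pow {ε : ℝ} (hε : 0 < ε) (hε1 : ε ≤ 1) {m j : ℕ} (hj : j < m) :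
    ∫ v in Ioi ε, (v : ℂ) ^ (-((m + 1 : ℕ) : ℂ)) *
      (Ioc (0 : ℝ) 1).indicator (fun t ↦ (t : ℂ) ^ (j : ℂ)) v =
        ((((ε ^ (m - j))⁻¹ : ℝ) : ℂ) - 1) / ((m - j : ℕ) : ℂ) := by
  obtain ⟨k, rfl⟩ := Nat.exists_eq_add_of_lt hj
  have hk : ((k : ℂ) + 1) ≠ 0 := by exact_mod_cast Nat.succ_ne_zero k
  have he : (j : ℂ) - ((j + k + 1 + 1 : ℕ) : ℂ) + 1 = -((k + 1 : ℕ) : ℂ) := by push_cast; ring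
  rw [integral_monomial hε hε1, integral_cpow, he, show j + k + 1 - j = k + 1 by omega]
  · rw [Complex.cpow_neg, Complex.cpow_natCast, Complex.cpow_neg, Complex.cpow_natCast,
      Complex.ofReal_one, one_pow, inv_one]
    push_cast
    rw [div_eq_div_iff (neg_ne_zero.2 hk) hk]
    ring
  · right
    constructor
    · intro h
      apply hk
      push_cast at h
      linear_combination -h
    · rw [uIcc_of_le hε1]
      exact fun h ↦ absurd h.1 (not_le.2 hε)

/-- Cutting the divergent integral `∫ v⁻ᴹ G(v) dv` off at `ε`: the coefficients are those of the
expansion of `G`, and the constant term is the regularized Mellin transform at `1 - M`. -/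
theorem HasTaylorExpansion.cutoff_isBigO (h : HasTaylorExpansion G a) (M : ℕ) :
    (fun ε : ℝ ↦ (∫ v in Ioi ε, (v : ℂ) ^ (-(M : ℂ)) * G v) -
      (∑ k ∈ Finset.Icc 1 (M - 1), a (M - 1 - k) / k * (((ε ^ k)⁻¹ : ℝ) : ℂ) +
        (if M = 0 then 0 else a (M - 1)) * ((Real.log (1 / ε) : ℝ) : ℂ) +
        (mellin (taylorTail G a M) (1 - M) - ∑ k ∈ Finset.Icc 1 (M - 1), a (M - 1 - k) / k)))
      =O[𝓝[>] (0 : ℝ)] (fun ε : ℝ ↦ ε) := by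
  have hconv : IntegrableOn (fun v : ℝ ↦ (v : ℂ) ^ (-(M : ℂ)) * taylorTail G a M v) (Ioi 0) := by
    have := h.mellinConvergent_tail M (s := 1 - M) (by simp)
    simpa [MellinConvergent] using this
  have hmel : mellin (taylorTail G a M) (1 - M) =
      ∫ v in Ioi (0 : ℝ), (v : ℂ) ^ (-(M : ℂ)) * taylorTail G a M v := by
    simp [mellin]
  -- the cut-off integral of the tail differs from the full one by `O(ε)`
  have h1 : (fun ε : ℝ ↦ ∫ v in Ioc 0 ε, (v : ℂ) ^ (-(M : ℂ)) * taylorTail G a M v)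
      =O[𝓝[>] (0 : ℝ)] (fun ε : ℝ ↦ ε) := by
    obtain ⟨C, hC⟩ := (h.tail_isBigO_zero M).bound
    obtain ⟨δ, hδ, hδC⟩ := mem_nhdsGT_iff_exists_Ioc_subset.1 hC
    refine Asymptotics.IsBigO.of_bound C ?_
    filter_upwards [Ioc_mem_nhdsGT hδ] with ε hε
    have := norm_setIntegral_le_of_norm_le_const (μ := volume) (s := Ioc 0 ε) (C := C)
      (f := fun v : ℝ ↦ (v : ℂ) ^ (-(M : ℂ)) * taylorTail G a M v) (by simp) ?_
    · simpa [abs_of_pos hε.1, hε.1.le] using this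
    · intro v hv
      have hv' := hδC ⟨hv.1, hv.2.trans hε.2⟩
      simp only [mem_ofPred_eq, neg_neg, Real.rpow_natCast, norm_pow, Real.norm_eq_abs,
        abs_of_pos hv.1] at hv'
      rw [norm_mul, Complex.norm_cpow_eq_rpow_re_of_pos hv.1]
      simp only [Complex.neg_re, Complex.natCast_re, Real.rpow_neg hv.1.le, Real.rpow_natCast]
      calc (v ^ M)⁻¹ * ‖taylorTail G a M v‖ ≤ (v ^ M)⁻¹ * (C * v ^ M) := by
            gcongr
            exact inv_nonneg.2 (pow_nonneg hv.1.le _)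
        _ = C := by
            have := (pow_pos hv.1 M).ne'
            field_simp
  refine h1.neg_left.congr' ?_ EventuallyEq.rfl
  filter_upwards [Ioc_mem_nhdsGT (zero_lt_one' ℝ)] with ε hε
  have hsub : Ioi ε ⊆ Ioi (0 : ℝ) := Ioi_subset_Ioi hε.1.le
  have hsplit : ∫ v in Ioi (0 : ℝ), (v : ℂ) ^ (-(M : ℂ)) * taylorTail G a M v =
      (∫ v in Ioc 0 ε, (v : ℂ) ^ (-(M : ℂ)) * taylorTail G a M v) +
      ∫ v in Ioi ε, (v : ℂ) ^ (-(M : ℂ)) * taylorTail G a M v := by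
    rw [← Ioc_union_Ioi_eq_Ioi hε.1.le]
    exact setIntegral_union (Ioc_disjoint_Ioi le_rfl) measurableSet_Ioi
      (hconv.mono_set Ioc_subset_Ioi_self) (hconv.mono_set hsub)
  have hmono : ∀ j : ℕ, IntegrableOn (fun v : ℝ ↦ (v : ℂ) ^ (-(M : ℂ)) *
      (Ioc (0 : ℝ) 1).indicator (fun t ↦ (t : ℂ) ^ (j : ℂ)) v) (Ioi ε) :=
    fun j ↦ integrableOn_monomial hε.1 hε.2 M j
  have hG : ∫ v in Ioi ε, (v : ℂ) ^ (-(M : ℂ)) * G v =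
      (∫ v in Ioi ε, (v : ℂ) ^ (-(M : ℂ)) * taylorTail G a M v) +
      ∑ j ∈ Finset.range M, a j * ∫ v in Ioi ε, (v : ℂ) ^ (-(M : ℂ)) *
        (Ioc (0 : ℝ) 1).indicator (fun t ↦ (t : ℂ) ^ (j : ℂ)) v := by
    simp only [← integral_const_mul]
    rw [← integral_finsetSum _ fun j _ ↦ (hmono j).const_mul (a j),
      ← integral_add (hconv.mono_set hsub) (integrable_finsetSum _ fun j _ ↦
        (hmono j).const_mul (a j))]
    refine integral_congr_ae (Eventually.of_forall fun v ↦ ?_)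
    simp only [taylorTail, mul_sub, Finset.mul_sum]
    rw [sub_add, sub_eq_self.2]
    rw [sub_eq_zero]
    exact Finset.sum_congr rfl fun j _ ↦ by ring
  rw [hG, hmel, hsplit]
  rcases M with _ | m
  · simp
  · have hs : ∑ j ∈ Finset.range (m + 1), a j * ∫ v in Ioi ε, (v : ℂ) ^ (-((m + 1 : ℕ) : ℂ)) *
        (Ioc (0 : ℝ) 1).indicator (fun t ↦ (t : ℂ) ^ (j : ℂ)) v =
        ∑ k ∈ Finset.Icc 1 m, a (m - k) / k * (((ε ^ k)⁻¹ : ℝ) : ℂ) -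
          ∑ k ∈ Finset.Icc 1 m, a (m - k) / k + a m * ((Real.log (1 / ε) : ℝ) : ℂ) := by
      rw [Finset.sum_range_succ, integral_monomial_eq_log hε.1 hε.2 m, ← Finset.sum_sub_distrib,
        ← sum_range_eq_sum_Icc m fun j k ↦
          a j / (k : ℂ) * (((ε ^ k)⁻¹ : ℝ) : ℂ) - a j / (k : ℂ)]
      congr 1
      refine Finset.sum_congr rfl fun j hj ↦ ?_
      rw [integral_monomial_eq_pow hε.1 hε.2 (Finset.mem_range.1 hj)]
      ring
    rw [hs]
    simp only [Nat.add_sub_cancel, Nat.add_eq_zero_iff, one_ne_zero, and_false, if_false]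
    ring

end Cutoff

/-! ### Test functions and collars in a half-space -/

section Collar

variable {n : ℕ} [NeZero n]

variable (n) in
/-- The closed half-space on which manifolds with boundary are modelled. -/
def halfSpace : Set (EuclideanSpace ℝ (Fin n)) := {y | 0 ≤ y 0}

/-- The set is open relative to the half-space. -/
def IsRelOpen (V : Set (EuclideanSpace ℝ (Fin n))) : Prop :=
  ∃ O : Set (EuclideanSpace ℝ (Fin n)), IsOpen O ∧ V = O ∩ halfSpace n

theorem range_eq_halfSpace : range (𝓡∂ n) = halfSpace n :=
  range_modelWithCornersEuclideanHalfSpace n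

theorem isClosed_halfSpace : IsClosed (halfSpace n) :=
  isClosed_le continuous_const (by fun_prop)

theorem uniqueDiffOn_halfSpace : UniqueDiffOn ℝ (halfSpace n) :=
  range_eq_halfSpace (n := n) ▸ (𝓡∂ n).uniqueDiffOn

theorem IsRelOpen.uniqueDiffOn {V : Set (EuclideanSpace ℝ (Fin n))} (hV : IsRelOpen V) :
    UniqueDiffOn ℝ V := by
  obtain ⟨O, hO, rfl⟩ := hV
  rw [inter_comm]
  exact uniqueDiffOn_halfSpace.inter hO

theorem IsRelOpen.measurableSet {V : Set (EuclideanSpace ℝ (Fin n))} (hV : IsRelOpen V) :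
    MeasurableSet V := by
  obtain ⟨O, hO, rfl⟩ := hV
  exact hO.measurableSet.inter isClosed_halfSpace.measurableSet

theorem IsRelOpen.nonneg {V : Set (EuclideanSpace ℝ (Fin n))} (hV : IsRelOpen V)
    {y : EuclideanSpace ℝ (Fin n)} (hy : y ∈ V) : 0 ≤ y 0 := by
  obtain ⟨O, hO, rfl⟩ := hV
  exact hy.2

theorem IsRelOpen.mem_nhds {V : Set (EuclideanSpace ℝ (Fin n))} (hV : IsRelOpen V)
    {y : EuclideanSpace ℝ (Fin n)} (hy : y ∈ V) (hy0 : 0 < y 0) : V ∈ 𝓝 y := by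
  obtain ⟨O, hO, rfl⟩ := hV
  refine inter_mem (hO.mem_nhds hy.1) ?_
  have : IsOpen {y : EuclideanSpace ℝ (Fin n) | 0 < y 0} :=
    isOpen_lt continuous_const (by fun_prop)
  exact mem_of_superset (this.mem_nhds hy0) fun z (hz : 0 < z 0) ↦ hz.le

/-- A test function on `V`: smooth on `V`, and zero off a compact subset of `V`. -/
structure IsTest (V : Set (EuclideanSpace ℝ (Fin n))) (η : EuclideanSpace ℝ (Fin n) → ℂ) :
    Prop where
  contDiffOn : ContDiffOn ℝ ∞ η V
  exists_compact : ∃ K ⊆ V, IsCompact K ∧ ∀ y ∉ K, η y = 0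

/-- The derivative in the first coordinate, taken within `V`, and zero off `V`. -/
def normalDeriv {F : Type*} [NormedAddCommGroup F] [NormedSpace ℝ F]
    (V : Set (EuclideanSpace ℝ (Fin n))) (f : EuclideanSpace ℝ (Fin n) → F) :
    EuclideanSpace ℝ (Fin n) → F :=
  V.indicator fun y ↦ fderivWithin ℝ f V y (EuclideanSpace.single 0 1)

section NormalDeriv

variable {F : Type*} [NormedAddCommGroup F] [NormedSpace ℝ F]
  {V : Set (EuclideanSpace ℝ (Fin n))}

theorem normalDeriv_of_mem {f : EuclideanSpace ℝ (Fin n) → F} {y : EuclideanSpace ℝ (Fin n)}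
    (hy : y ∈ V) :
    normalDeriv V f y = fderivWithin ℝ f V y (EuclideanSpace.single 0 1) :=
  indicator_of_mem hy _

theorem normalDeriv_of_notMem {f : EuclideanSpace ℝ (Fin n) → F} {y : EuclideanSpace ℝ (Fin n)}
    (hy : y ∉ V) : normalDeriv V f y = 0 :=
  indicator_of_notMem hy _

theorem contDiffOn_normalDeriv (hV : IsRelOpen V) {f : EuclideanSpace ℝ (Fin n) → F}
    (hf : ContDiffOn ℝ ∞ f V) : ContDiffOn ℝ ∞ (normalDeriv V f) V := by
  have h1 : ContDiffOn ℝ ∞ (fderivWithin ℝ f V) V :=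
    hf.fderivWithin hV.uniqueDiffOn (by simp)
  exact (h1.clm_apply contDiffOn_const).congr fun y hy ↦ normalDeriv_of_mem hy

theorem differentiableWithinAt_of_contDiffOn {f : EuclideanSpace ℝ (Fin n) → F}
    (hf : ContDiffOn ℝ ∞ f V) {y : EuclideanSpace ℝ (Fin n)} (hy : y ∈ V) :
    DifferentiableWithinAt ℝ f V y :=
  (hf.differentiableOn (by simp)) y hy

theorem normalDeriv_mul (hV : IsRelOpen V) {f g : EuclideanSpace ℝ (Fin n) → ℂ}
    (hf : ContDiffOn ℝ ∞ f V) (hg : ContDiffOn ℝ ∞ g V) (y : EuclideanSpace ℝ (Fin n)) :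
    normalDeriv V (fun y ↦ f y * g y) y = f y * normalDeriv V g y + normalDeriv V f y * g y := by
  by_cases hy : y ∈ V
  · simp only [normalDeriv_of_mem hy]
    rw [fderivWithin_fun_mul (hV.uniqueDiffOn y hy) (differentiableWithinAt_of_contDiffOn hf hy)
      (differentiableWithinAt_of_contDiffOn hg hy)]
    simp [mul_comm]
  · simp [normalDeriv_of_notMem hy]

theorem hasLineDerivAt_normalDeriv (hV : IsRelOpen V) {f : EuclideanSpace ℝ (Fin n) → F}
    (hf : ContDiffOn ℝ ∞ f V) {y : EuclideanSpace ℝ (Fin n)} (hy : y ∈ V) (hy0 : 0 < y 0) :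
    HasLineDerivAt ℝ f (normalDeriv V f y) y (EuclideanSpace.single 0 1) := by
  have hn := hV.mem_nhds hy hy0
  rw [normalDeriv_of_mem hy, fderivWithin_of_mem_nhds hn]
  exact (((differentiableWithinAt_of_contDiffOn hf hy).differentiableAt hn).hasFDerivAt).hasLineDerivAt
    _

end NormalDeriv

namespace IsTest

variable {V : Set (EuclideanSpace ℝ (Fin n))} {η θ : EuclideanSpace ℝ (Fin n) → ℂ}

theorem eq_zero_of_notMem (h : IsTest V η) {y : EuclideanSpace ℝ (Fin n)} (hy : y ∉ V) :
    η y = 0 := by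
  obtain ⟨K, hK, -, h0⟩ := h.exists_compact
  exact h0 y fun hh ↦ hy (hK hh)

theorem mul_left (h : IsTest V η) {f : EuclideanSpace ℝ (Fin n) → ℂ} (hf : ContDiffOn ℝ ∞ f V) :
    IsTest V fun y ↦ f y * η y where
  contDiffOn := hf.mul h.contDiffOn
  exists_compact := by
    obtain ⟨K, hK, hKc, h0⟩ := h.exists_compact
    exact ⟨K, hK, hKc, fun y hy ↦ by rw [h0 y hy, mul_zero]⟩

theorem normalDeriv (hV : IsRelOpen V) (h : IsTest V η) : IsTest V (normalDeriv V η) where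
  contDiffOn := contDiffOn_normalDeriv hV h.contDiffOn
  exists_compact := by
    obtain ⟨K, hK, hKc, h0⟩ := h.exists_compact
    refine ⟨K, hK, hKc, fun y hy ↦ ?_⟩
    by_cases hyV : y ∈ V
    · rw [normalDeriv_of_mem hyV]
      have : η =ᶠ[𝓝[V] y] fun _ ↦ 0 :=
        mem_nhdsWithin_of_mem_nhds (mem_of_superset (hKc.isClosed.isOpen_compl.mem_nhds hy) h0)
      rw [this.fderivWithin_eq (h0 y hy)]
      simp
    · exact normalDeriv_of_notMem hyV

/-- A continuous function on `V` times a test function is integrable. -/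
theorem integrable_mul (h : IsTest V η) {k : EuclideanSpace ℝ (Fin n) → ℂ}
    (hk : ContinuousOn k V) : Integrable fun y ↦ k y * η y := by
  obtain ⟨K, hK, hKc, h0⟩ := h.exists_compact
  have h1 : IntegrableOn (fun y ↦ k y * η y) K :=
    ((hk.mono hK).mul (h.contDiffOn.continuousOn.mono hK)).integrableOn_compact hKc
  rwa [integrableOn_iff_integrable_of_support_subset] at h1
  intro y hy
  by_contra hyK
  exact hy (by simp [h0 y hyK])

theorem integrable (h : IsTest V η) : Integrable η := by
  simpa using h.integrable_mul (k := fun _ ↦ 1) continuousOn_const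

/-- A continuous function is bounded on the support of a test function. -/
theorem exists_bound (h : IsTest V η) {f : EuclideanSpace ℝ (Fin n) → ℝ}
    (hf : ContinuousOn f V) : ∃ R : ℝ, 0 < R ∧ ∀ y, η y ≠ 0 → |f y| ≤ R := by
  obtain ⟨K, hK, hKc, h0⟩ := h.exists_compact
  obtain ⟨R, hR⟩ := hKc.exists_bound_of_continuousOn (hf.mono hK)
  refine ⟨max R 1, by positivity, fun y hy ↦ (hR y ?_).trans (le_max_left _ _)⟩
  by_contra hyK
  exact hy (h0 y hyK)

end IsTest

/-- A collar: a relatively open subset of the half-space on which the function `lam` is smooth,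
increases in the direction of the first coordinate, and vanishes on the boundary hyperplane. -/
structure IsCollar (V : Set (EuclideanSpace ℝ (Fin n))) (lam : EuclideanSpace ℝ (Fin n) → ℝ) :
    Prop where
  relOpen : IsRelOpen V
  measurable : Measurable lam
  contDiffOn : ContDiffOn ℝ ∞ lam V
  deriv_pos : ∀ y ∈ V, 0 < normalDeriv V lam y
  boundary : ∀ y ∈ V, y 0 = 0 → lam y = 0

theorem contDiffOn_ofReal {V : Set (EuclideanSpace ℝ (Fin n))}
    {f : EuclideanSpace ℝ (Fin n) → ℝ} (hf : ContDiffOn ℝ ∞ f V) :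
    ContDiffOn ℝ ∞ (fun y ↦ (f y : ℂ)) V :=
  Complex.ofRealCLM.contDiff.comp_contDiffOn hf

/-- The inverse of the normal derivative of the defining function. -/
def invSlope (V : Set (EuclideanSpace ℝ (Fin n))) (lam : EuclideanSpace ℝ (Fin n) → ℝ) :
    EuclideanSpace ℝ (Fin n) → ℂ :=
  fun y ↦ (((normalDeriv V lam y)⁻¹ : ℝ) : ℂ)

/-- The operator `η ↦ ∂₀ (η / ∂₀ lam)`: minus the transpose of the vector field `∂₀ / ∂₀ lam`,
along which `lam` grows with unit speed. -/
def flowOp (V : Set (EuclideanSpace ℝ (Fin n))) (lam : EuclideanSpace ℝ (Fin n) → ℝ)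
    (η : EuclideanSpace ℝ (Fin n) → ℂ) : EuclideanSpace ℝ (Fin n) → ℂ :=
  normalDeriv V fun y ↦ invSlope V lam y * η y

namespace IsCollar

variable {V : Set (EuclideanSpace ℝ (Fin n))} {lam : EuclideanSpace ℝ (Fin n) → ℝ}
  {η : EuclideanSpace ℝ (Fin n) → ℂ}

theorem contDiffOn_invSlope (hV : IsCollar V lam) : ContDiffOn ℝ ∞ (invSlope V lam) V :=
  contDiffOn_ofReal ((contDiffOn_normalDeriv hV.relOpen hV.contDiffOn).inv
    fun y hy ↦ (hV.deriv_pos y hy).ne')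

theorem isTest_flowOp (hV : IsCollar V lam) (h : IsTest V η) : IsTest V (flowOp V lam η) :=
  (h.mul_left hV.contDiffOn_invSlope).normalDeriv hV.relOpen

/-- Integration by parts along the vector field `∂₀ / ∂₀ lam`. The function `C ∘ lam` vanishes near
the boundary hyperplane, so that no boundary term appears. -/
theorem integral_comp_mul (hV : IsCollar V lam) (h : IsTest V η) {c C : ℝ → ℂ} {δ : ℝ}
    (hδ : 0 < δ) (hc : Continuous c) (hC : ∀ v, HasDerivAt C (c v) v)
    (hc0 : ∀ v ≤ δ, c v = 0) (hC0 : ∀ v ≤ δ, C v = 0) :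
    ∫ y, c (lam y) * η y = -∫ y, C (lam y) * flowOp V lam η y := by
  have hCc : Continuous C := continuous_iff_continuousAt.2 fun v ↦ (hC v).continuousAt
  have hlam := hV.contDiffOn.continuousOn
  have hq := h.mul_left hV.contDiffOn_invSlope
  have i1 := h.integrable_mul (hc.comp_continuousOn hlam)
  have i2 := (hV.isTest_flowOp h).integrable_mul (hCc.comp_continuousOn hlam)
  have i3 := hq.integrable_mul (hCc.comp_continuousOn hlam)
  simp only [Function.comp_apply] at i1 i2 i3
  set q : EuclideanSpace ℝ (Fin n) → ℂ := fun y ↦ invSlope V lam y * η y with hqdef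
  have key : ∀ y, HasLineDerivAt ℝ (fun y ↦ C (lam y) * q y)
      (c (lam y) * η y + C (lam y) * flowOp V lam η y) y (EuclideanSpace.single 0 1) := by
    intro y
    obtain ⟨K, hK, hKc, h0⟩ := hq.exists_compact
    -- away from the open part of `V` the function vanishes identically near `y`
    have zero_case : (∀ᶠ z in 𝓝 y, C (lam z) * q z = 0) →
        c (lam y) * η y + C (lam y) * flowOp V lam η y = 0 →
        HasLineDerivAt ℝ (fun y ↦ C (lam y) * q y)
          (c (lam y) * η y + C (lam y) * flowOp V lam η y) y (EuclideanSpace.single 0 1) := by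
      intro hev hz
      rw [hz]
      have := ((hasFDerivAt_const (𝕜 := ℝ) (0 : ℂ) y).congr_of_eventuallyEq hev).hasLineDerivAt
        (EuclideanSpace.single 0 1)
      simpa using this
    by_cases hy : y ∈ V
    · rcases (hV.relOpen.nonneg hy).eq_or_lt with hy0 | hy0
      · have hl0 := hV.boundary y hy hy0.symm
        refine zero_case ?_ (by rw [hl0, hc0 0 hδ.le, hC0 0 hδ.le]; ring)
        have h1 : ∀ᶠ z in 𝓝[V] y, lam z < δ := (hlam y hy).eventually (gt_mem_nhds (by rwa [hl0]))
        rw [eventually_nhdsWithin_iff] at h1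
        filter_upwards [h1] with z hz
        by_cases hzV : z ∈ V
        · rw [hC0 _ (hz hzV).le, zero_mul]
        · rw [hq.eq_zero_of_notMem hzV, mul_zero]
      · have d1 := hasLineDerivAt_normalDeriv hV.relOpen hV.contDiffOn hy hy0
        have d2 := hasLineDerivAt_normalDeriv hV.relOpen hq.contDiffOn hy hy0
        have d3 := ((hC (lam y)).scomp_of_eq (0 : ℝ) d1 (by simp)).mul d2
        have hne := (hV.deriv_pos y hy).ne'
        unfold HasLineDerivAt
        refine d3.congr_deriv ?_
        symm
        have : η y = ((normalDeriv V lam y : ℝ) : ℂ) * q y := by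
          have : ((normalDeriv V lam y : ℝ) : ℂ) ≠ 0 := by exact_mod_cast hne
          simp only [hqdef, invSlope]
          push_cast
          field_simp
        rw [this, flowOp]
        simp only [zero_smul, add_zero, Function.comp_apply, Complex.real_smul]
        rw [← hqdef]
        ring
    · refine zero_case ?_ ?_
      · filter_upwards [hKc.isClosed.isOpen_compl.mem_nhds fun hh ↦ hy (hK hh)] with z hz
        rw [h0 z hz, mul_zero]
      · rw [h.eq_zero_of_notMem hy, (hV.isTest_flowOp h).eq_zero_of_notMem hy]
        ring
  have := integral_bilinear_hasLineDerivAt_right_eq_neg_left_of_integrable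
    (μ := (volume : Measure (EuclideanSpace ℝ (Fin n))))
    (f := fun _ ↦ (1 : ℂ)) (f' := fun _ ↦ (0 : ℂ)) (g := fun y ↦ C (lam y) * q y)
    (g' := fun y ↦ c (lam y) * η y + C (lam y) * flowOp V lam η y)
    (v := EuclideanSpace.single 0 1) (B := ContinuousLinearMap.mul ℝ ℂ) (by simp)
    (by simpa using! i1.add i2) (by simpa using i3)
    (fun x _ ↦ by simpa using (hasFDerivAt_const (𝕜 := ℝ) (1 : ℂ) x).hasLineDerivAt _)
    (fun x _ ↦ key x)
  simp only [ContinuousLinearMap.mul_apply', one_mul, zero_mul, integral_zero, neg_zero] at this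
  rw [integral_add i1 i2] at this
  exact eq_neg_of_add_eq_zero_left this

end IsCollar

/-! ### The layer-cake formula -/

/-- The integral of `h` over the superlevel set `{lam ≥ v}`. -/
def levelIntegral (lam : EuclideanSpace ℝ (Fin n) → ℝ) (h : EuclideanSpace ℝ (Fin n) → ℂ)
    (v : ℝ) : ℂ :=
  ∫ y in {y | v ≤ lam y}, h y

section LayerCake

variable {lam : EuclideanSpace ℝ (Fin n) → ℝ} {h : EuclideanSpace ℝ (Fin n) → ℂ}

theorem norm_levelIntegral_le (hh : Integrable h) (v : ℝ) :
    ‖levelIntegral lam h v‖ ≤ ∫ y, ‖h y‖ :=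
  (norm_integral_le_integral_norm _).trans
    (setIntegral_le_integral hh.norm (Eventually.of_forall fun _ ↦ norm_nonneg _))

theorem levelIntegral_eq_zero {R : ℝ} (hR : ∀ y, h y ≠ 0 → lam y ≤ R) {v : ℝ} (hv : R < v) :
    levelIntegral lam h v = 0 := by
  refine setIntegral_eq_zero_of_forall_eq_zero fun y hy ↦ ?_
  by_contra h0
  exact absurd (hR y h0) (not_le.2 (hv.trans_le hy))

theorem measurableSet_superlevel (hlam : Measurable lam) (v : ℝ) : MeasurableSet {y | v ≤ lam y} :=
  measurableSet_le measurable_const hlam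

/-- The integrand of the layer-cake formula on the product of space and levels. -/
def layer (lam : EuclideanSpace ℝ (Fin n) → ℝ) (h : EuclideanSpace ℝ (Fin n) → ℂ) (c : ℝ → ℂ)
    (y : EuclideanSpace ℝ (Fin n)) (v : ℝ) : ℂ :=
  open Classical in if 0 < v ∧ v ≤ lam y then c v * h y else 0

theorem layer_eq_indicator_level (c : ℝ → ℂ) (y : EuclideanSpace ℝ (Fin n)) (v : ℝ) :
    layer lam h c y v = (Ioc 0 (lam y)).indicator c v * h y := by
  by_cases hv : 0 < v ∧ v ≤ lam y
  · rw [layer, if_pos hv, indicator_of_mem (show v ∈ Ioc 0 (lam y) from hv)]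
  · rw [layer, if_neg hv, indicator_of_notMem (show v ∉ Ioc 0 (lam y) from hv), zero_mul]

theorem layer_eq_indicator_space (c : ℝ → ℂ) (y : EuclideanSpace ℝ (Fin n)) {v : ℝ} (hv0 : 0 < v) :
    layer lam h c y v = c v * {y | v ≤ lam y}.indicator h y := by
  by_cases hv : v ≤ lam y
  · rw [layer, if_pos ⟨hv0, hv⟩, indicator_of_mem (show y ∈ {y | v ≤ lam y} from hv)]
  · rw [layer, if_neg fun hh ↦ hv hh.2, indicator_of_notMem (show y ∉ {y | v ≤ lam y} from hv),
      mul_zero]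

theorem layer_of_nonpos (c : ℝ → ℂ) (y : EuclideanSpace ℝ (Fin n)) {v : ℝ} (hv0 : ¬ 0 < v) :
    layer lam h c y v = 0 := by
  rw [layer, if_neg fun hh ↦ hv0 hh.1]

theorem integrable_layer (hlam : Measurable lam) (hh : Integrable h) {R : ℝ}
    (hR : ∀ y, h y ≠ 0 → lam y ≤ R) {c : ℝ → ℂ} (hc : IntegrableOn c (Ioc 0 R)) :
    Integrable (Function.uncurry (layer lam h c)) (volume.prod volume) := by
  have hm : MeasurableSet {p : EuclideanSpace ℝ (Fin n) × ℝ | 0 < p.2 ∧ p.2 ≤ lam p.1} :=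
    (measurableSet_lt measurable_const measurable_snd).inter
      (measurableSet_le measurable_snd (hlam.comp measurable_fst))
  have h1 : Integrable (fun p : EuclideanSpace ℝ (Fin n) × ℝ ↦
      h p.1 * (Ioc 0 R).indicator c p.2) (volume.prod volume) :=
    hh.mul_prod ((integrable_indicator_iff measurableSet_Ioc).2 hc)
  refine (h1.indicator hm).congr (Eventually.of_forall fun ⟨y, v⟩ ↦ ?_)
  by_cases hp : 0 < v ∧ v ≤ lam y
  · rw [indicator_of_mem (show (y, v) ∈ {p : _ × ℝ | 0 < p.2 ∧ p.2 ≤ lam p.1} from hp)]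
    simp only [Function.uncurry_apply_pair]
    rw [layer, if_pos hp]
    by_cases h0 : h y = 0
    · simp [h0]
    · rw [indicator_of_mem (show v ∈ Ioc 0 R from ⟨hp.1, hp.2.trans (hR _ h0)⟩), mul_comm]
  · rw [indicator_of_notMem (show (y, v) ∉ {p : _ × ℝ | 0 < p.2 ∧ p.2 ≤ lam p.1} from hp)]
    simp only [Function.uncurry_apply_pair]
    rw [layer, if_neg hp]

theorem integral_layer_space (hlam : Measurable lam) (c : ℝ → ℂ) (v : ℝ) :
    ∫ y, layer lam h c y v = (Ioi 0).indicator (fun v ↦ c v * levelIntegral lam h v) v := by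
  by_cases hv0 : 0 < v
  · rw [indicator_of_mem (show v ∈ Ioi 0 from hv0)]
    simp only [layer_eq_indicator_space c _ hv0, integral_const_mul,
      integral_indicator (measurableSet_superlevel hlam v), levelIntegral]
  · rw [indicator_of_notMem (show v ∉ Ioi 0 from hv0)]
    simp only [layer_of_nonpos c _ hv0, integral_zero]

/-- The layer-cake formula. -/
theorem integral_primitive_mul (hlam : Measurable lam) (hh : Integrable h) {R : ℝ}
    (hR : ∀ y, h y ≠ 0 → lam y ≤ R) {c : ℝ → ℂ} (hc : IntegrableOn c (Ioc 0 R)) :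
    ∫ y, (∫ v in Ioc 0 (lam y), c v) * h y = ∫ v in Ioi 0, c v * levelIntegral lam h v := by
  have := integral_integral_swap (integrable_layer hlam hh hR hc)
  simp only [integral_layer_space hlam, integral_indicator measurableSet_Ioi] at this
  rw [← this]
  simp only [layer_eq_indicator_level, integral_mul_const, integral_indicator measurableSet_Ioc]

theorem aestronglyMeasurable_levelIntegral (hlam : Measurable lam) (hh : Integrable h) {R : ℝ}
    (hR : ∀ y, h y ≠ 0 → lam y ≤ R) :
    AEStronglyMeasurable (levelIntegral lam h) (volume.restrict (Ioi 0)) := by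
  have := (integrable_layer hlam hh hR (c := fun _ ↦ 1)
    (integrableOn_const (by simp) (by simp))).integral_prod_right.aestronglyMeasurable
  simp only [Function.uncurry_apply_pair, integral_layer_space hlam, one_mul] at this
  exact (aestronglyMeasurable_indicator_iff measurableSet_Ioi).1 this

end LayerCake

end Collar

/-! ### The push-forward density in a collar -/

section Density

variable {n : ℕ} [NeZero n] {V : Set (EuclideanSpace ℝ (Fin n))}
  {lam : EuclideanSpace ℝ (Fin n) → ℝ} {η : EuclideanSpace ℝ (Fin n) → ℂ}

/-- The density, with respect to `dv`, of the push-forward of `η dy` under `lam`. It is defined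
through integration by parts; `IsCollar.setIntegral_superlevel` shows that it is the density. -/
def density (V : Set (EuclideanSpace ℝ (Fin n))) (lam : EuclideanSpace ℝ (Fin n) → ℝ)
    (η : EuclideanSpace ℝ (Fin n) → ℂ) (v : ℝ) : ℂ :=
  -levelIntegral lam (flowOp V lam η) v

/-- A continuous cutoff that equals `1` for `v ≥ ε` and tends to `0` for `v < ε` as `k → ∞`. -/
def ramp (ε : ℝ) (k : ℕ) (v : ℝ) : ℝ := max 0 (min 1 ((k + 2) * (v - ε) / ε + 1))

theorem continuous_ramp (ε : ℝ) (k : ℕ) : Continuous (ramp ε k) := by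
  unfold ramp; fun_prop

theorem ramp_of_le {ε : ℝ} (hε : 0 < ε) (k : ℕ) {v : ℝ} (hv : ε ≤ v) : ramp ε k v = 1 := by
  have : 0 ≤ (k + 2) * (v - ε) / ε := by
    have := sub_nonneg.2 hv
    positivity
  rw [ramp, min_eq_left (by linarith), max_eq_right zero_le_one]

theorem ramp_eq_zero {ε : ℝ} (hε : 0 < ε) {k : ℕ} {v : ℝ} (hv : v ≤ ε * (k + 1) / (k + 2)) :
    ramp ε k v = 0 := by
  have hk : (0 : ℝ) < k + 2 := by positivity
  rw [le_div_iff₀ hk] at hv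
  have : (k + 2) * (v - ε) / ε + 1 ≤ 0 := by
    rw [div_add_one hε.ne', div_le_iff₀ hε]
    nlinarith
  rw [ramp, max_eq_left ((min_le_right _ _).trans this)]

theorem norm_ramp_le (ε : ℝ) (k : ℕ) (v : ℝ) : ‖((ramp ε k v : ℝ) : ℂ)‖ ≤ 1 := by
  rw [Complex.norm_real, Real.norm_eq_abs, abs_of_nonneg (le_max_left _ _)]
  exact max_le zero_le_one (min_le_left _ _)

theorem tendsto_ramp {ε : ℝ} (hε : 0 < ε) (v : ℝ) :
    Tendsto (fun k : ℕ ↦ ramp ε k v) atTop (𝓝 ((Ici ε).indicator 1 v)) := by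
  by_cases hv : ε ≤ v
  · simp only [ramp_of_le hε _ hv, indicator_of_mem (show v ∈ Ici ε from hv), Pi.one_apply]
    exact tendsto_const_nhds
  · rw [indicator_of_notMem (show v ∉ Ici ε from hv)]
    refine tendsto_const_nhds.congr' ?_
    obtain ⟨N, hN⟩ := exists_nat_gt (ε / (ε - v))
    filter_upwards [eventually_ge_atTop N] with k hk
    have hεv : 0 < ε - v := by linarith
    have : ε < k * (ε - v) := by
      rw [div_lt_iff₀ hεv] at hN
      have : (N : ℝ) ≤ k := by exact_mod_cast hk
      nlinarith
    refine (ramp_eq_zero hε ?_).symm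
    rw [le_div_iff₀ (by positivity)]
    nlinarith

theorem IsTest.exists_level_bound (hV : IsCollar V lam) (h : IsTest V η) :
    ∃ R : ℝ, 0 < R ∧ ∀ y, η y ≠ 0 → lam y ≤ R := by
  obtain ⟨R, hR0, hR⟩ := h.exists_bound hV.contDiffOn.continuousOn
  exact ⟨R, hR0, fun y hy ↦ (le_abs_self _).trans (hR y hy)⟩

namespace IsCollar

theorem integral_comp_mul_eq (hV : IsCollar V lam) (h : IsTest V η) {c : ℝ → ℂ} {δ : ℝ}
    (hδ : 0 < δ) (hc : Continuous c) (hc0 : ∀ v ≤ δ, c v = 0) :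
    ∫ y, c (lam y) * η y = ∫ v in Ioi 0, c v * density V lam η v := by
  have hC0 : ∀ v ≤ δ, ∫ u in (0 : ℝ)..v, c u = 0 := by
    intro v hv
    rw [intervalIntegral.integral_congr (g := fun _ ↦ 0), intervalIntegral.integral_zero]
    intro x hx
    refine hc0 x (hx.2.trans ?_)
    exact max_le hδ.le hv
  have hL := hV.isTest_flowOp h
  obtain ⟨R, hR0, hR⟩ := hL.exists_level_bound hV
  rw [hV.integral_comp_mul h hδ hc (C := fun v ↦ ∫ u in (0 : ℝ)..v, c u)
    (fun v ↦ (hc.integral_hasStrictDerivAt 0 v).hasDerivAt) hc0 hC0]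
  have h1 : ∀ y, ∫ u in (0 : ℝ)..(lam y), c u = ∫ u in Ioc 0 (lam y), c u := by
    intro y
    rcases le_total 0 (lam y) with hl | hl
    · exact intervalIntegral.integral_of_le hl
    · rw [hC0 _ (hl.trans hδ.le), Ioc_eq_empty (not_lt.2 hl)]
      simp
  simp only [h1]
  rw [integral_primitive_mul hV.measurable hL.integrable hR
    (hc.integrableOn_Icc.mono_set Ioc_subset_Icc_self), ← integral_neg]
  simp [density]

theorem density_eq_zero {R : ℝ} (hR : ∀ y, flowOp V lam η y ≠ 0 → lam y ≤ R) {v : ℝ} (hv : R < v) :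
    density V lam η v = 0 := by
  rw [density, levelIntegral_eq_zero hR hv, neg_zero]

theorem norm_density_le (hV : IsCollar V lam) (h : IsTest V η) (v : ℝ) :
    ‖density V lam η v‖ ≤ ∫ y, ‖flowOp V lam η y‖ := by
  rw [density, norm_neg]
  exact norm_levelIntegral_le (hV.isTest_flowOp h).integrable v

theorem aestronglyMeasurable_density (hV : IsCollar V lam) (h : IsTest V η) :
    AEStronglyMeasurable (density V lam η) (volume.restrict (Ioi 0)) := by
  have hL := hV.isTest_flowOp h
  obtain ⟨R, hR0, hR⟩ := hL.exists_level_bound hV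
  exact (aestronglyMeasurable_levelIntegral hV.measurable hL.integrable hR).neg

/-- On superlevel sets `density` is the density of the push-forward of `η dy` under `lam`. -/
theorem setIntegral_superlevel (hV : IsCollar V lam) (h : IsTest V η) {c : ℝ → ℂ} {ε : ℝ}
    (hε : 0 < ε) (hc : ContinuousOn c (Ici ε)) :
    ∫ y in {y | ε ≤ lam y}, c (lam y) * η y = ∫ v in Ioi ε, c v * density V lam η v := by
  have hL := hV.isTest_flowOp h
  obtain ⟨R, hR0, hR⟩ := h.exists_level_bound hV
  obtain ⟨R', hR0', hR'⟩ := hL.exists_level_bound hV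
  obtain ⟨B, hB⟩ := (isCompact_Icc (a := ε) (b := max ε (max R R'))).exists_bound_of_continuousOn
    (hc.mono Icc_subset_Ici_self)
  have hcm : Continuous fun v : ℝ ↦ c (max ε v) :=
    hc.comp_continuous (by fun_prop) fun v ↦ mem_Ici.2 (le_max_left _ _)
  have hck : ∀ k, Continuous fun v : ℝ ↦ c (max ε v) * ((ramp ε k v : ℝ) : ℂ) := fun k ↦
    hcm.mul (Complex.continuous_ofReal.comp (continuous_ramp ε k))
  have hbd : ∀ k v, v ≤ max R R' → ‖c (max ε v) * ((ramp ε k v : ℝ) : ℂ)‖ ≤ B := by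
    intro k v hv
    rw [norm_mul]
    exact (mul_le_of_le_one_right (norm_nonneg _) (norm_ramp_le ε k v)).trans
      (hB _ ⟨le_max_left _ _, max_le_max_left _ hv⟩)
  have hlim : ∀ v, Tendsto (fun k : ℕ ↦ c (max ε v) * ((ramp ε k v : ℝ) : ℂ)) atTop
      (𝓝 ((Ici ε).indicator c v)) := by
    intro v
    have := ((Complex.continuous_ofReal.tendsto _).comp (tendsto_ramp hε v)).const_mul (c (max ε v))
    have e : (Ici ε).indicator c v = c (max ε v) * (((Ici ε).indicator 1 v : ℝ) : ℂ) := by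
      by_cases hv : v ∈ Ici ε
      · rw [indicator_of_mem hv, indicator_of_mem hv, max_eq_right (mem_Ici.1 hv)]
        simp
      · rw [indicator_of_notMem hv, indicator_of_notMem hv]
        simp
    rw [e]
    exact this
  have hI : ∀ k, ∫ y, (c (max ε (lam y)) * ((ramp ε k (lam y) : ℝ) : ℂ)) * η y =
      ∫ v in Ioi 0, (c (max ε v) * ((ramp ε k v : ℝ) : ℂ)) * density V lam η v := fun k ↦
    hV.integral_comp_mul_eq h (δ := ε * (k + 1) / (k + 2)) (by positivity) (hck k)
      fun v hv ↦ by rw [ramp_eq_zero hε hv, Complex.ofReal_zero, mul_zero]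
  have t1 : Tendsto (fun k : ℕ ↦ ∫ y, (c (max ε (lam y)) * ((ramp ε k (lam y) : ℝ) : ℂ)) * η y)
      atTop (𝓝 (∫ y, (Ici ε).indicator c (lam y) * η y)) := by
    refine tendsto_integral_of_dominated_convergence (fun y ↦ B * ‖η y‖) (fun k ↦ ?_)
      (h.integrable.norm.const_mul B) (fun k ↦ Eventually.of_forall fun y ↦ ?_)
      (Eventually.of_forall fun y ↦ (hlim (lam y)).mul_const _)
    · exact (h.integrable_mul
        ((hck k).comp_continuousOn hV.contDiffOn.continuousOn)).aestronglyMeasurable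
    · by_cases h0 : η y = 0
      · simp [h0]
      · rw [norm_mul]
        exact mul_le_mul_of_nonneg_right (hbd k _ ((hR y h0).trans (le_max_left _ _)))
          (norm_nonneg _)
  have t2 : Tendsto (fun k : ℕ ↦ ∫ v in Ioi 0,
      (c (max ε v) * ((ramp ε k v : ℝ) : ℂ)) * density V lam η v)
      atTop (𝓝 (∫ v in Ioi 0, (Ici ε).indicator c v * density V lam η v)) := by
    refine tendsto_integral_of_dominated_convergence
      ((Ioc 0 R').indicator fun _ ↦ B * ∫ y, ‖flowOp V lam η y‖) (fun k ↦ ?_) ?_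
      (fun k ↦ ?_) (Eventually.of_forall fun v ↦ (hlim v).mul_const _)
    · exact (hck k).aestronglyMeasurable.mul (hV.aestronglyMeasurable_density h)
    · exact ((integrable_indicator_iff measurableSet_Ioc).2
        (integrableOn_const (by simp) enorm_ne_top)).integrableOn
    · filter_upwards [ae_restrict_mem measurableSet_Ioi] with v hv
      by_cases hvR : v ≤ R'
      · rw [indicator_of_mem (show v ∈ Ioc 0 R' from ⟨hv, hvR⟩), norm_mul]
        exact mul_le_mul (hbd k v (hvR.trans (le_max_right _ _))) (hV.norm_density_le h v)
          (norm_nonneg _) ((norm_nonneg _).trans (hbd k v (hvR.trans (le_max_right _ _))))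
      · rw [density_eq_zero hR' (not_le.1 hvR), mul_zero, norm_zero,
          indicator_of_notMem (fun hh ↦ hvR hh.2)]
  have := tendsto_nhds_unique t1 ((funext hI) ▸ t2)
  rw [← integral_indicator (measurableSet_superlevel hV.measurable ε)]
  convert this using 1
  · refine integral_congr_ae (Eventually.of_forall fun y ↦ ?_)
    by_cases hy : ε ≤ lam y
    · simp only [indicator_of_mem (show y ∈ {y | ε ≤ lam y} from hy),
        indicator_of_mem (show lam y ∈ Ici ε from hy)]
    · simp only [indicator_of_notMem (show y ∉ {y | ε ≤ lam y} from hy),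
        indicator_of_notMem (show lam y ∉ Ici ε from hy), zero_mul]
  · simp only [← indicator_mul_left]
    rw [setIntegral_indicator measurableSet_Ici,
        inter_eq_right.2 (show Ici ε ⊆ Ioi 0 from fun v hv ↦ hε.trans_le hv),
      integral_Ici_eq_integral_Ioi]

theorem levelIntegral_eq (hV : IsCollar V lam) (h : IsTest V η) {ε : ℝ} (hε : 0 < ε) :
    levelIntegral lam η ε = ∫ v in Ioi ε, density V lam η v := by
  simpa [levelIntegral] using hV.setIntegral_superlevel h hε (c := fun _ ↦ 1) continuousOn_const

theorem integrableOn_density (hV : IsCollar V lam) (h : IsTest V η) :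
    IntegrableOn (density V lam η) (Ioi 0) := by
  have hL := hV.isTest_flowOp h
  obtain ⟨R, hR0, hR⟩ := hL.exists_level_bound hV
  have : IntegrableOn ((Ioc 0 R).indicator fun _ ↦ ∫ y, ‖flowOp V lam η y‖) (Ioi 0) :=
    ((integrable_indicator_iff measurableSet_Ioc).2
        (integrableOn_const (by simp) enorm_ne_top)).integrableOn
  refine Integrable.mono' this (hV.aestronglyMeasurable_density h) ?_
  filter_upwards [ae_restrict_mem measurableSet_Ioi] with v hv
  by_cases hvR : v ≤ R
  · rw [indicator_of_mem (show v ∈ Ioc 0 R from ⟨hv, hvR⟩)]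
    exact hV.norm_density_le h v
  · rw [density_eq_zero hR (not_le.1 hvR), norm_zero, indicator_of_notMem (fun hh ↦ hvR hh.2)]

end IsCollar

/-- The Taylor coefficients at `0⁺` of `levelIntegral lam η`. -/
def levelCoeff (V : Set (EuclideanSpace ℝ (Fin n))) (lam : EuclideanSpace ℝ (Fin n) → ℝ) :
    ℕ → (EuclideanSpace ℝ (Fin n) → ℂ) → ℂ
  | 0, η => ∫ v in Ioi 0, density V lam η v
  | j + 1, η => levelCoeff V lam j (flowOp V lam η) / (j + 1)

namespace IsCollar

/-- Since `d/dv levelIntegral η = levelIntegral (flowOp η)`, the Taylor expansion of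
`levelIntegral η` follows from that of `levelIntegral (flowOp η)` by integration. -/
theorem levelIntegral_expansion (hV : IsCollar V lam) (h : IsTest V η) (K : ℕ) :
    (fun v : ℝ ↦ levelIntegral lam η v -
      ∑ j ∈ Finset.range K, levelCoeff V lam j η * (v : ℂ) ^ j)
      =O[𝓝[>] (0 : ℝ)] (fun v : ℝ ↦ v ^ K) := by
  induction K generalizing η with
  | zero =>
    simp only [Finset.range_zero, Finset.sum_empty, sub_zero, pow_zero]
    exact Asymptotics.isBigO_of_le' (c := ∫ y, ‖η y‖) _ fun v ↦ by
      simpa using norm_levelIntegral_le h.integrable v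
  | succ K ih =>
    have hL := hV.isTest_flowOp h
    obtain ⟨C, hC⟩ := (ih hL).bound
    obtain ⟨δ, hδ, hδC⟩ := mem_nhdsGT_iff_exists_Ioc_subset.1 hC
    refine Asymptotics.IsBigO.of_bound C ?_
    filter_upwards [Ioc_mem_nhdsGT hδ] with v hv
    have hd := hV.integrableOn_density h
    have e1 : levelIntegral lam η v = levelCoeff V lam 0 η +
        ∫ u in Ioc 0 v, levelIntegral lam (flowOp V lam η) u := by
      rw [hV.levelIntegral_eq h hv.1, levelCoeff, ← Ioc_union_Ioi_eq_Ioi hv.1.le,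
        setIntegral_union (Ioc_disjoint_Ioi le_rfl) measurableSet_Ioi
          (hd.mono_set Ioc_subset_Ioi_self) (hd.mono_set (Ioi_subset_Ioi hv.1.le))]
      simp only [density, integral_neg]
      ring
    have i1 : IntegrableOn (levelIntegral lam (flowOp V lam η)) (Ioc 0 v) := by
      have : IntegrableOn (fun u ↦ -density V lam η u) (Ioc 0 v) :=
        (hd.mono_set Ioc_subset_Ioi_self).neg
      simpa only [density, neg_neg] using this
    have i2 : ∀ j : ℕ, IntegrableOn (fun u : ℝ ↦ levelCoeff V lam j (flowOp V lam η) *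
        (u : ℂ) ^ j) (Ioc 0 v) := fun j ↦
      ((by fun_prop : Continuous fun u : ℝ ↦ levelCoeff V lam j (flowOp V lam η) *
        (u : ℂ) ^ j).integrableOn_Icc (a := 0) (b := v)).mono_set Ioc_subset_Icc_self
    have e2 : ∀ j : ℕ, ∫ u in Ioc 0 v, levelCoeff V lam j (flowOp V lam η) * (u : ℂ) ^ j =
        levelCoeff V lam (j + 1) η * (v : ℂ) ^ (j + 1) := by
      intro j
      rw [integral_const_mul, ← intervalIntegral.integral_of_le hv.1.le, levelCoeff]
      have : ∫ u in (0 : ℝ)..v, (u : ℂ) ^ j = (((v ^ (j + 1) / (j + 1) : ℝ)) : ℂ) := by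
        have := integral_pow (a := 0) (b := v) j
        simp only [ne_eq, Nat.add_eq_zero_iff, one_ne_zero, and_false, not_false_eq_true,
          zero_pow, sub_zero] at this
        rw [← this, ← intervalIntegral.integral_ofReal]
        simp
      rw [this]
      push_cast
      ring
    have e3 : levelIntegral lam η v -
        ∑ j ∈ Finset.range (K + 1), levelCoeff V lam j η * (v : ℂ) ^ j =
        ∫ u in Ioc 0 v, (levelIntegral lam (flowOp V lam η) u -
          ∑ j ∈ Finset.range K, levelCoeff V lam j (flowOp V lam η) * (u : ℂ) ^ j) := by
      rw [integral_sub i1 (integrable_finsetSum _ fun j _ ↦ i2 j),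
        integral_finsetSum _ fun j _ ↦ i2 j, Finset.sum_range_succ', e1]
      simp only [e2]
      ring
    rw [e3]
    have := norm_setIntegral_le_of_norm_le_const (μ := volume) (s := Ioc 0 v) (C := C * v ^ K)
      (f := fun u : ℝ ↦ levelIntegral lam (flowOp V lam η) u -
          ∑ j ∈ Finset.range K, levelCoeff V lam j (flowOp V lam η) * (u : ℂ) ^ j) (by simp) ?_
    · refine this.trans_eq ?_
      simp only [Real.volume_real_Ioc, sub_zero, max_eq_left hv.1.le, Real.norm_eq_abs, abs_pow,
        abs_of_pos hv.1]
      ring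
    · intro u hu
      have hu' := hδC ⟨hu.1, hu.2.trans hv.2⟩
      simp only [mem_ofPred_eq, norm_pow, Real.norm_eq_abs, abs_of_pos hu.1] at hu'
      have hC0 : 0 ≤ C := by
        have := (norm_nonneg _).trans hu'
        exact nonneg_of_mul_nonneg_left this (pow_pos hu.1 K)
      refine hu'.trans ?_
      have := hu.1.le
      have := hu.2
      gcongr

theorem hasTaylorExpansion_density (hV : IsCollar V lam) (h : IsTest V η) :
    HasTaylorExpansion (density V lam η) fun j ↦ -levelCoeff V lam j (flowOp V lam η) where
  aestronglyMeasurable := hV.aestronglyMeasurable_density h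
  bounded := ⟨_, fun v _ ↦ hV.norm_density_le h v⟩
  eventually_zero := by
    obtain ⟨R, hR0, hR⟩ := (hV.isTest_flowOp h).exists_level_bound hV
    exact ⟨R, fun v hv ↦ density_eq_zero hR hv⟩
  expansion K := by
    refine (hV.levelIntegral_expansion (hV.isTest_flowOp h) K).neg_left.congr_left fun v ↦ ?_
    simp only [density, neg_mul, Finset.sum_neg_distrib]
    ring

end IsCollar

end Density

/-! ### Complex powers of a defining function -/

/-- Differentiation under the integral sign for `s ↦ ∫ exp(sψ) h`, where `ψ` may be unbounded: the
integrability for slightly larger and slightly smaller real exponents dominates the factor `ψ`. -/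
theorem hasDerivAt_integral_cexp_mul {α : Type*} [MeasurableSpace α] {μ : Measure α} {ψ : α → ℝ}
    {h : α → ℂ} (hψ : AEStronglyMeasurable ψ μ) (hh : AEStronglyMeasurable h μ) {a : ℝ}
    (hint : ∀ x : ℝ, a < x → Integrable (fun y ↦ Complex.exp (x * ψ y) * h y) μ) {s : ℂ}
    (hs : a < s.re) :
    Integrable (fun y ↦ ψ y * (Complex.exp (s * ψ y) * h y)) μ ∧
      HasDerivAt (fun z : ℂ ↦ ∫ y, Complex.exp (z * ψ y) * h y ∂μ)
        (∫ y, ψ y * (Complex.exp (s * ψ y) * h y) ∂μ) s := by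
  set r : ℝ := (s.re - a) / 4 with hr
  have hr0 : 0 < r := by rw [hr]; linarith
  have hψc : AEStronglyMeasurable (fun y ↦ (ψ y : ℂ)) μ :=
    Complex.continuous_ofReal.comp_aestronglyMeasurable hψ
  have hF : ∀ z : ℂ, AEStronglyMeasurable (fun y ↦ Complex.exp (z * ψ y) * h y) μ := fun z ↦
    (Complex.continuous_exp.comp_aestronglyMeasurable (hψc.const_mul z)).mul hh
  have hnorm : ∀ (z : ℂ) y, ‖Complex.exp (z * ψ y) * h y‖ = Real.exp (z.re * ψ y) * ‖h y‖ := by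
    intro z y
    rw [norm_mul, Complex.norm_exp]
    simp
  have hi : Integrable (fun y ↦ Complex.exp (s * ψ y) * h y) μ := by
    refine (hint s.re hs).congr' (hF s) (Eventually.of_forall fun y ↦ ?_)
    rw [hnorm, hnorm, Complex.ofReal_re]
  refine hasDerivAt_integral_of_dominated_loc_of_deriv_le
    (F := fun (z : ℂ) y ↦ Complex.exp (z * ψ y) * h y)
    (F' := fun (z : ℂ) y ↦ ψ y * (Complex.exp (z * ψ y) * h y))
    (bound := fun y ↦ 1 / r * (‖Complex.exp ((s.re + 2 * r : ℝ) * ψ y) * h y‖ +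
      ‖Complex.exp ((s.re - 2 * r : ℝ) * ψ y) * h y‖))
    (Metric.ball_mem_nhds s hr0) (Eventually.of_forall hF) hi (hψc.mul (hF s)) ?_ ?_ ?_
  · refine Eventually.of_forall fun y z hz ↦ ?_
    have hre : |z.re - s.re| ≤ r := by
      have := (Complex.abs_re_le_norm (z - s)).trans (mem_ball_iff_norm.1 hz).le
      simpa using this
    rw [norm_mul, hnorm, hnorm, hnorm, Complex.norm_real, Real.norm_eq_abs, Complex.ofReal_re,
      Complex.ofReal_re, ← add_mul, ← mul_assoc, ← mul_assoc]
    refine mul_le_mul_of_nonneg_right ?_ (norm_nonneg _)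
    have e1 : |ψ y| ≤ 1 / r * Real.exp (r * |ψ y|) := by
      have := Real.add_one_le_exp (r * |ψ y|)
      rw [div_mul_eq_mul_div, one_mul, le_div_iff₀ hr0]
      linarith
    have e2 : Real.exp (z.re * ψ y) ≤ Real.exp (s.re * ψ y + r * |ψ y|) := by
      refine Real.exp_le_exp.2 ?_
      have : (z.re - s.re) * ψ y ≤ r * |ψ y| := by
        refine (le_abs_self _).trans ?_
        rw [abs_mul]
        gcongr
      linarith
    have e3 : Real.exp (s.re * ψ y + 2 * r * |ψ y|) ≤
        Real.exp ((s.re + 2 * r) * ψ y) + Real.exp ((s.re - 2 * r) * ψ y) := by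
      rcases abs_cases (ψ y) with ⟨hc, -⟩ | ⟨hc, -⟩
      · refine le_add_of_le_of_nonneg (le_of_eq ?_) (Real.exp_pos _).le
        rw [hc]; ring_nf
      · refine le_add_of_nonneg_of_le (Real.exp_pos _).le (le_of_eq ?_)
        rw [hc]; ring_nf
    calc |ψ y| * Real.exp (z.re * ψ y)
        ≤ (1 / r * Real.exp (r * |ψ y|)) * Real.exp (s.re * ψ y + r * |ψ y|) := by gcongr
      _ = 1 / r * Real.exp (s.re * ψ y + 2 * r * |ψ y|) := by
          rw [mul_assoc, ← Real.exp_add]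
          ring_nf
      _ ≤ _ := by gcongr
  · exact ((hint _ (by rw [hr]; linarith)).norm.add (hint _ (by rw [hr]; linarith)).norm).const_mul _
  · refine Eventually.of_forall fun y z _ ↦ ?_
    have h1 : HasDerivAt (fun z : ℂ ↦ z * ψ y) (ψ y : ℂ) z := by
      simpa using (hasDerivAt_id z).mul_const (ψ y : ℂ)
    have := (h1.cexp.mul_const (h y))
    refine this.congr_deriv ?_
    ring

section Powers

variable {n : ℕ} [NeZero n] {V : Set (EuclideanSpace ℝ (Fin n))}
  {lam : EuclideanSpace ℝ (Fin n) → ℝ} {η : EuclideanSpace ℝ (Fin n) → ℂ}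

/-- A smooth function that is `1` near `K` and whose restriction to the half-space is supported in a
compact subset of `V`. -/
theorem exists_cutoff (hV : IsRelOpen V) {K : Set (EuclideanSpace ℝ (Fin n))} (hK : K ⊆ V)
    (hKc : IsCompact K) :
    ∃ f : EuclideanSpace ℝ (Fin n) → ℝ, ContDiff ℝ ∞ f ∧ (∀ y, f y ∈ Icc (0 : ℝ) 1) ∧
      (∃ U, IsOpen U ∧ K ⊆ U ∧ ∀ y ∈ U, f y = 1) ∧
      ∃ K' ⊆ V, IsCompact K' ∧ ∀ y ∈ halfSpace n, y ∉ K' → f y = 0 := by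
  obtain ⟨O, hO, rfl⟩ := hV
  obtain ⟨O', hO', hKO', hO'O, hO'c⟩ := exists_open_between_and_isCompact_closure hKc hO
    (hK.trans inter_subset_left)
  obtain ⟨f, hf0, hf1, hf⟩ := exists_contMDiffMap_zero_one_nhds_of_isClosed (n := (⊤ : ℕ∞))
    𝓘(ℝ, EuclideanSpace ℝ (Fin n)) hO'.isClosed_compl hKc.isClosed
    (disjoint_compl_left_iff_subset.2 hKO')
  obtain ⟨U, hU, hKU, hU1⟩ := eventually_nhdsSet_iff_exists.1 hf1
  refine ⟨f, f.contMDiff.contDiff, hf, ⟨U, hU, hKU, hU1⟩, closure O' ∩ halfSpace n,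
    inter_subset_inter_left _ hO'O, hO'c.inter_right isClosed_halfSpace, fun y hy hy' ↦ ?_⟩
  refine hf0.self_of_nhdsSet y fun hh ↦ hy' ⟨subset_closure hh, hy⟩

/-- A nonnegative test function dominates `η`. For it, integrability can be read off from bounded
integrals. -/
theorem IsTest.exists_majorant (hV : IsRelOpen V) (h : IsTest V η) :
    ∃ χ : EuclideanSpace ℝ (Fin n) → ℝ, IsTest V (fun y ↦ (χ y : ℂ)) ∧ ∀ y, ‖η y‖ ≤ χ y := by
  obtain ⟨K, hK, hKc, h0⟩ := h.exists_compact
  obtain ⟨f, hf, hf01, ⟨U, -, hKU, hU1⟩, K', hK', hKc', hf0⟩ := exists_cutoff hV hK hKc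
  obtain ⟨b, hb⟩ := hKc.exists_bound_of_continuousOn (h.contDiffOn.continuousOn.mono hK)
  refine ⟨V.indicator fun y ↦ |b| * f y, ⟨?_, K', hK', hKc', fun y hy ↦ ?_⟩, fun y ↦ ?_⟩
  · have : ContDiffOn ℝ ∞ (fun y ↦ ((|b| * f y : ℝ) : ℂ)) V :=
      contDiffOn_ofReal (contDiffOn_const.mul hf.contDiffOn)
    exact this.congr fun y hy ↦ by rw [indicator_of_mem hy]
  · by_cases hyV : y ∈ V
    · rw [indicator_of_mem hyV, hf0 y (hV.nonneg hyV) hy, mul_zero, Complex.ofReal_zero]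
    · rw [indicator_of_notMem hyV, Complex.ofReal_zero]
  · by_cases hyK : y ∈ K
    · rw [indicator_of_mem (hK hyK), hU1 y (hKU hyK), mul_one]
      exact (hb y hyK).trans (le_abs_self b)
    · rw [h0 y hyK, norm_zero]
      exact indicator_nonneg (fun y _ ↦ mul_nonneg (abs_nonneg b) (hf01 y).1) y

theorem continuousOn_cpow_Ici (σ : ℂ) {ε : ℝ} (hε : 0 < ε) :
    ContinuousOn (fun v : ℝ ↦ (v : ℂ) ^ σ) (Ici ε) := fun v hv ↦
  (Complex.continuousAt_ofReal_cpow_const v σ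
    (Or.inr (hε.trans_le hv).ne')).continuousWithinAt

theorem IsTest.integrableOn_superlevel (h : IsTest V η) (hlam : ContinuousOn lam V)
    (hm : Measurable lam) {c : ℝ → ℂ} {ε : ℝ} (hc : ContinuousOn c (Ici ε)) :
    IntegrableOn (fun y ↦ c (lam y) * η y) {y | ε ≤ lam y} := by
  have hcm : Continuous fun v : ℝ ↦ c (max ε v) :=
    hc.comp_continuous (by fun_prop) fun v ↦ mem_Ici.2 (le_max_left _ _)
  refine (h.integrable_mul (hcm.comp_continuousOn hlam)).integrableOn.congr_fun
    (fun y hy ↦ ?_) (measurableSet_superlevel hm ε)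
  simp [max_eq_right (show ε ≤ lam y from hy)]

namespace IsCollar

theorem integrableOn_superlevel (hV : IsCollar V lam) (h : IsTest V η) {c : ℝ → ℂ} {ε : ℝ}
    (hc : ContinuousOn c (Ici ε)) :
    IntegrableOn (fun y ↦ c (lam y) * η y) {y | ε ≤ lam y} :=
  h.integrableOn_superlevel hV.contDiffOn.continuousOn hV.measurable hc

theorem measurableSet_pos (hV : IsCollar V lam) : MeasurableSet {y | 0 < lam y} :=
  measurableSet_lt measurable_const hV.measurable

theorem integrableOn_cpow_density (hV : IsCollar V lam) (h : IsTest V η) {σ : ℂ} (hσ : -1 < σ.re) :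
    IntegrableOn (fun v : ℝ ↦ (v : ℂ) ^ σ * density V lam η v) (Ioi 0) := by
  have := (hV.hasTaylorExpansion_density h).mellinConvergent_tail 0 (s := σ + 1)
    (by simp; linarith)
  simpa [taylorTail_zero, MellinConvergent] using this

theorem aecover_superlevel (hV : IsCollar V lam) :
    AECover (volume.restrict {y | 0 < lam y}) atTop fun k : ℕ ↦ {y | 1 / ((k : ℝ) + 1) ≤ lam y} where
  ae_eventually_mem := by
    filter_upwards [ae_restrict_mem hV.measurableSet_pos] with y hy
    exact (tendsto_one_div_add_atTop_nhds_zero_nat.eventually (gt_mem_nhds hy)).mono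
      fun k hk ↦ hk.le
  measurableSet k := measurableSet_superlevel hV.measurable _

theorem restrict_superlevel {ε : ℝ} (hε : 0 < ε) :
    (volume.restrict {y | 0 < lam y}).restrict {y | ε ≤ lam y} = volume.restrict {y | ε ≤ lam y} :=
  Measure.restrict_restrict_of_subset fun _ hy ↦ hε.trans_le hy

/-- Integrability of `lam ^ σ` up to the boundary for `Re σ > -1`. -/
theorem integrableOn_cpow (hV : IsCollar V lam) (h : IsTest V η) {σ : ℂ} (hσ : -1 < σ.re) :
    IntegrableOn (fun y ↦ (lam y : ℂ) ^ σ * η y) {y | 0 < lam y} := by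
  obtain ⟨χ, hχ, hle⟩ := h.exists_majorant hV.relOpen
  refine hV.aecover_superlevel.integrable_of_integral_norm_bounded
    (∫ v in Ioi (0 : ℝ), ‖(v : ℂ) ^ (σ.re : ℂ) * density V lam (fun y ↦ (χ y : ℂ)) v‖) ?_
    (Eventually.of_forall ?_)
  · intro k
    rw [IntegrableOn, restrict_superlevel (by positivity)]
    exact hV.integrableOn_superlevel h (continuousOn_cpow_Ici σ (by positivity))
  · intro k
    have hk : (0 : ℝ) < 1 / ((k : ℝ) + 1) := by positivity
    set ε : ℝ := 1 / ((k : ℝ) + 1)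
    rw [restrict_superlevel hk]
    have i1 := hV.integrableOn_superlevel h (continuousOn_cpow_Ici σ hk)
    have i2 := hV.integrableOn_superlevel hχ (continuousOn_cpow_Ici σ.re hk)
    have e1 : ∫ y in {y | ε ≤ lam y}, ‖(lam y : ℂ) ^ σ * η y‖ ≤
        ∫ y in {y | ε ≤ lam y}, ‖(lam y : ℂ) ^ (σ.re : ℂ) * (χ y : ℂ)‖ := by
      refine setIntegral_mono_on i1.norm i2.norm (measurableSet_superlevel hV.measurable ε)
        fun y hy ↦ ?_
      have hy0 : 0 < lam y := hk.trans_le hy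
      rw [norm_mul, norm_mul, Complex.norm_cpow_eq_rpow_re_of_pos hy0,
        Complex.norm_cpow_eq_rpow_re_of_pos hy0, Complex.ofReal_re, Complex.norm_real]
      exact mul_le_mul_of_nonneg_left ((hle y).trans (le_abs_self _)) (by positivity)
    -- the majorant is nonnegative, so its integral is computed by the push-forward density
    have e2 : ∫ y in {y | ε ≤ lam y}, ‖(lam y : ℂ) ^ (σ.re : ℂ) * (χ y : ℂ)‖ =
        ‖∫ y in {y | ε ≤ lam y}, (lam y : ℂ) ^ (σ.re : ℂ) * (χ y : ℂ)‖ := by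
      have : ∀ y ∈ {y | ε ≤ lam y}, (lam y : ℂ) ^ (σ.re : ℂ) * (χ y : ℂ) =
          ((‖(lam y : ℂ) ^ (σ.re : ℂ) * (χ y : ℂ)‖ : ℝ) : ℂ) := by
        intro y hy
        have hy0 : 0 < lam y := hk.trans_le hy
        have hχ0 : 0 ≤ χ y := (norm_nonneg _).trans (hle y)
        rw [← Complex.ofReal_cpow hy0.le, ← Complex.ofReal_mul, Complex.norm_real,
          Real.norm_of_nonneg (by positivity)]
      rw [setIntegral_congr_fun (measurableSet_superlevel hV.measurable ε) this,
        integral_complex_ofReal, Complex.norm_real,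
        Real.norm_of_nonneg (integral_nonneg fun y ↦ norm_nonneg _)]
    rw [e2, hV.setIntegral_superlevel hχ hk (continuousOn_cpow_Ici σ.re hk)] at e1
    refine (e1.trans (norm_integral_le_integral_norm _)).trans ?_
    exact setIntegral_mono_set (hV.integrableOn_cpow_density hχ (by simpa using hσ)).norm
      (Eventually.of_forall fun _ ↦ norm_nonneg _) (Ioi_subset_Ioi hk.le).eventuallyLE

theorem setIntegral_cpow_eq_mellin (hV : IsCollar V lam) (h : IsTest V η) {σ : ℂ}
    (hσ : -1 < σ.re) :
    ∫ y in {y | 0 < lam y}, (lam y : ℂ) ^ σ * η y = mellin (density V lam η) (σ + 1) := by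
  have t1 := hV.aecover_superlevel.integral_tendsto_of_countably_generated
    (hV.integrableOn_cpow h hσ)
  have t2 := (aecover_Ioi_of_Ioi (μ := volume)
    tendsto_one_div_add_atTop_nhds_zero_nat).integral_tendsto_of_countably_generated
    (hV.integrableOn_cpow_density h hσ)
  have : mellin (density V lam η) (σ + 1) =
      ∫ v in Ioi (0 : ℝ), (v : ℂ) ^ σ * density V lam η v := by
    simp [mellin]
  rw [this]
  refine tendsto_nhds_unique t1 (t2.congr fun k ↦ ?_)
  have hk : (0 : ℝ) < 1 / ((k : ℝ) + 1) := by positivity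
  rw [restrict_superlevel hk, Measure.restrict_restrict_of_subset (Ioi_subset_Ioi hk.le),
    hV.setIntegral_superlevel h hk (continuousOn_cpow_Ici σ hk)]

/-- Integration by parts: it improves the exponent by one at the price of a factor `σ + 1`. -/
theorem setIntegral_cpow_recursion (hV : IsCollar V lam) (h : IsTest V η) {σ : ℂ}
    (hσ : -1 < σ.re) :
    (σ + 1) * ∫ y in {y | 0 < lam y}, (lam y : ℂ) ^ σ * η y =
      -∫ y in {y | 0 < lam y}, (lam y : ℂ) ^ (σ + 1) * flowOp V lam η y := by
  have hL := hV.isTest_flowOp h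
  obtain ⟨R, hR0, hR⟩ := hL.exists_level_bound hV
  have hσ0 : σ + 1 ≠ 0 := by
    intro h0
    have := congrArg Complex.re h0
    simp only [Complex.add_re, Complex.one_re, Complex.zero_re] at this
    linarith
  have hc : IntegrableOn (fun v : ℝ ↦ (v : ℂ) ^ σ) (Ioc 0 R) := by
    rw [← intervalIntegrable_iff_integrableOn_Ioc_of_le hR0.le]
    exact intervalIntegral.intervalIntegrable_cpow' hσ
  have key := integral_primitive_mul hV.measurable hL.integrable hR hc
  have e1 : ∀ y, (∫ v in Ioc 0 (lam y), (v : ℂ) ^ σ) * flowOp V lam η y =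
      {y | 0 < lam y}.indicator
        (fun y ↦ (σ + 1)⁻¹ * ((lam y : ℂ) ^ (σ + 1) * flowOp V lam η y)) y := by
    intro y
    by_cases hy : 0 < lam y
    · rw [indicator_of_mem (show y ∈ {y | 0 < lam y} from hy),
        ← intervalIntegral.integral_of_le hy.le, integral_cpow (Or.inl hσ), Complex.ofReal_zero,
        Complex.zero_cpow hσ0, sub_zero]
      ring
    · rw [indicator_of_notMem (show y ∉ {y | 0 < lam y} from hy), Ioc_eq_empty hy]
      simp
  have e2 : ∫ v in Ioi (0 : ℝ), (v : ℂ) ^ σ * levelIntegral lam (flowOp V lam η) v =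
      -mellin (density V lam η) (σ + 1) := by
    rw [mellin, ← integral_neg]
    simp [density]
  simp only [e1] at key
  rw [integral_indicator hV.measurableSet_pos, integral_const_mul, e2,
    ← hV.setIntegral_cpow_eq_mellin h hσ] at key
  rw [neg_eq_iff_eq_neg.1 key.symm]
  field_simp

end IsCollar

end Powers

/-! ### Twisting by an exponential -/

section Twist

variable {n : ℕ} [NeZero n] {V : Set (EuclideanSpace ℝ (Fin n))}
  {lam φ : EuclideanSpace ℝ (Fin n) → ℝ} {η θ : EuclideanSpace ℝ (Fin n) → ℂ}

/-- The derivative of `φ` along the vector field `∂₀ / ∂₀ lam`. -/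
def slope (V : Set (EuclideanSpace ℝ (Fin n))) (lam φ : EuclideanSpace ℝ (Fin n) → ℝ) :
    EuclideanSpace ℝ (Fin n) → ℂ :=
  fun y ↦ invSlope V lam y * ((normalDeriv V φ y : ℝ) : ℂ)

theorem IsCollar.contDiffOn_slope (hV : IsCollar V lam) (hφ : ContDiffOn ℝ ∞ φ V) :
    ContDiffOn ℝ ∞ (slope V lam φ) V :=
  hV.contDiffOn_invSlope.mul (contDiffOn_ofReal (contDiffOn_normalDeriv hV.relOpen hφ))

theorem contDiffOn_cexp_mul (hφ : ContDiffOn ℝ ∞ φ V) (s : ℂ) :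
    ContDiffOn ℝ ∞ (fun y ↦ Complex.exp (s * φ y)) V :=
  (contDiffOn_const.mul (contDiffOn_ofReal hφ)).cexp

theorem normalDeriv_comp (hV : IsRelOpen V) (hφ : ContDiffOn ℝ ∞ φ V) {f : ℝ → ℂ}
    {f' : ℂ} {y : EuclideanSpace ℝ (Fin n)} (hf : HasDerivAt f f' (φ y)) (hy : y ∈ V) :
    normalDeriv V (fun y ↦ f (φ y)) y = f' * ((normalDeriv V φ y : ℝ) : ℂ) := by
  have h1 := (differentiableWithinAt_of_contDiffOn hφ hy).hasFDerivWithinAt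
  have h2 := hf.hasFDerivAt.comp_hasFDerivWithinAt y h1
  have h3 := h2.fderivWithin (hV.uniqueDiffOn y hy)
  rw [normalDeriv_of_mem hy, normalDeriv_of_mem hy]
  change fderivWithin ℝ (f ∘ φ) V y _ = _
  rw [h3]
  simp [mul_comm]

/-- Conjugation of `flowOp` by the exponential `exp(sφ)`. -/
theorem IsCollar.flowOp_cexp_mul (hV : IsCollar V lam) (hφ : ContDiffOn ℝ ∞ φ V) (h : IsTest V η)
    (s : ℂ) (y : EuclideanSpace ℝ (Fin n)) :
    flowOp V lam (fun y ↦ Complex.exp (s * φ y) * η y) y =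
      Complex.exp (s * φ y) * flowOp V lam η y +
        s * (Complex.exp (s * φ y) * (slope V lam φ y * η y)) := by
  have hq := h.mul_left hV.contDiffOn_invSlope
  by_cases hy : y ∈ V
  · have e1 : (fun y ↦ invSlope V lam y * (Complex.exp (s * φ y) * η y)) =
        fun y ↦ Complex.exp (s * φ y) * (invSlope V lam y * η y) := by
      funext y; ring
    have hd : HasDerivAt (fun t : ℝ ↦ Complex.exp (s * t)) (Complex.exp (s * φ y) * s) (φ y) := by
      have : HasDerivAt (fun z : ℂ ↦ s * z) s (φ y : ℂ) := by
        simpa using (hasDerivAt_id (φ y : ℂ)).const_mul s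
      exact this.cexp.comp_ofReal
    rw [flowOp, e1, normalDeriv_mul hV.relOpen (contDiffOn_cexp_mul hφ s) hq.contDiffOn,
      normalDeriv_comp hV.relOpen hφ hd hy, flowOp, slope]
    ring
  · simp [flowOp, normalDeriv_of_notMem hy, h.eq_zero_of_notMem hy]

theorem IsCollar.flowOp_mul (hV : IsCollar V lam) (hφ : ContDiffOn ℝ ∞ φ V) (h : IsTest V η) :
    flowOp V lam (fun y ↦ (φ y : ℂ) * η y) =
      fun y ↦ (φ y : ℂ) * flowOp V lam η y + slope V lam φ y * η y := by
  funext y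
  have hq := h.mul_left hV.contDiffOn_invSlope
  by_cases hy : y ∈ V
  · have e1 : (fun y ↦ invSlope V lam y * ((φ y : ℂ) * η y)) =
        fun y ↦ (φ y : ℂ) * (invSlope V lam y * η y) := by
      funext y; ring
    have hd : HasDerivAt (fun t : ℝ ↦ (t : ℂ)) 1 (φ y) := (hasDerivAt_id (φ y)).ofReal_comp
    rw [flowOp, e1, normalDeriv_mul hV.relOpen (contDiffOn_ofReal hφ) hq.contDiffOn,
      normalDeriv_comp hV.relOpen hφ hd hy, flowOp, slope]
    ring
  · simp [flowOp, normalDeriv_of_notMem hy, h.eq_zero_of_notMem hy]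

theorem IsCollar.flowOp_add (hV : IsCollar V lam) (h : IsTest V η) (h' : IsTest V θ) :
    flowOp V lam (fun y ↦ η y + θ y) = fun y ↦ flowOp V lam η y + flowOp V lam θ y := by
  funext y
  have hq := h.mul_left hV.contDiffOn_invSlope
  have hq' := h'.mul_left hV.contDiffOn_invSlope
  by_cases hy : y ∈ V
  · simp only [flowOp, normalDeriv_of_mem hy, mul_add]
    rw [fderivWithin_fun_add (hV.relOpen.uniqueDiffOn y hy)
      (differentiableWithinAt_of_contDiffOn hq.contDiffOn hy)
      (differentiableWithinAt_of_contDiffOn hq'.contDiffOn hy)]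
    rfl
  · simp [flowOp, normalDeriv_of_notMem hy]

theorem slope_zero : slope V lam (fun _ ↦ 0) = fun _ ↦ 0 := by
  funext y
  by_cases hy : y ∈ V
  · simp [slope, normalDeriv_of_mem hy]
  · simp [slope, normalDeriv_of_notMem hy]

/-- The integral `∫ (lam exp φ)ˢ lam⁻ʲ η` over `{lam > 0}`. -/
def twistedIntegral (lam φ : EuclideanSpace ℝ (Fin n) → ℝ) (j : ℕ)
    (η : EuclideanSpace ℝ (Fin n) → ℂ) (s : ℂ) : ℂ :=
  ∫ y in {y | 0 < lam y}, (lam y : ℂ) ^ (s - j) * (Complex.exp (s * φ y) * η y)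

/-- The continuation to `Re s > -1` of `s (s - 1) ⋯ (s - j + 1)` times `twistedIntegral`, defined
through integration by parts. -/
def twistedRegular (V : Set (EuclideanSpace ℝ (Fin n))) (lam φ : EuclideanSpace ℝ (Fin n) → ℝ) :
    ℕ → (EuclideanSpace ℝ (Fin n) → ℂ) → ℂ → ℂ
  | 0, η, s => twistedIntegral lam φ 0 η s
  | j + 1, η, s => -(twistedRegular V lam φ j (flowOp V lam η) s +
      s * twistedRegular V lam φ j (fun y ↦ slope V lam φ y * η y) s)

/-- On `{lam > 0}` the integrand is `exp(s (log lam + φ)) η`. -/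
theorem hasDerivAt_twistedIntegral (hV : IsRelOpen V) (hlam : Measurable lam)
    (hφ : ContDiffOn ℝ ∞ φ V) (hη : AEStronglyMeasurable η volume) (h0 : ∀ y ∉ V, η y = 0) {a : ℝ}
    (hint : ∀ x : ℝ, a < x → IntegrableOn
      (fun y ↦ (lam y : ℂ) ^ (x : ℂ) * (Complex.exp (x * φ y) * η y)) {y | 0 < lam y})
    {s : ℂ} (hs : a < s.re) :
    IntegrableOn (fun y ↦ ((Real.log (lam y) + V.indicator φ y : ℝ) : ℂ) *
      ((lam y : ℂ) ^ s * (Complex.exp (s * φ y) * η y))) {y | 0 < lam y} ∧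
    HasDerivAt (twistedIntegral lam φ 0 η)
      (∫ y in {y | 0 < lam y}, ((Real.log (lam y) + V.indicator φ y : ℝ) : ℂ) *
        ((lam y : ℂ) ^ s * (Complex.exp (s * φ y) * η y))) s := by
  have hm : Measurable (V.indicator φ) := by
    classical
    have := hφ.continuousOn.measurable_piecewise (g := fun _ ↦ (0 : ℝ)) continuousOn_const
      hV.measurableSet
    simpa [← piecewise_eq_indicator] using! this
  have hpos : MeasurableSet {y | 0 < lam y} := measurableSet_lt measurable_const hlam
  have heq : ∀ z : ℂ, ∀ y ∈ {y | 0 < lam y},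
      Complex.exp (z * ((Real.log (lam y) + V.indicator φ y : ℝ) : ℂ)) * η y =
        (lam y : ℂ) ^ z * (Complex.exp (z * φ y) * η y) := by
    intro z y hy
    by_cases hyV : y ∈ V
    · rw [indicator_of_mem hyV, Complex.cpow_def_of_ne_zero
        (by exact_mod_cast (ne_of_gt hy : lam y ≠ 0)), ← Complex.ofReal_log (le_of_lt hy),
        ← mul_assoc, ← Complex.exp_add]
      push_cast
      ring_nf
    · rw [h0 y hyV]; ring
  have hint' : ∀ x : ℝ, a < x → Integrable (fun y ↦ Complex.exp (x *
      ((Real.log (lam y) + V.indicator φ y : ℝ) : ℂ)) * η y)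
      (volume.restrict {y | 0 < lam y}) := by
    intro x hx
    refine IntegrableOn.congr_fun (hint x hx) (fun y hy ↦ ?_) hpos
    rw [heq x y hy]
  have key := hasDerivAt_integral_cexp_mul (μ := volume.restrict {y | 0 < lam y})
    (ψ := fun y ↦ Real.log (lam y) + V.indicator φ y) (h := η)
    ((Real.measurable_log.comp hlam).add hm).aestronglyMeasurable
    hη.restrict hint' hs
  have hfun : twistedIntegral lam φ 0 η = fun z : ℂ ↦ ∫ y in {y | 0 < lam y},
      Complex.exp (z * ((Real.log (lam y) + V.indicator φ y : ℝ) : ℂ)) * η y := by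
    funext z
    refine (setIntegral_congr_fun hpos fun y hy ↦ ?_).symm
    rw [heq z y hy]
    simp
  have hval : EqOn (fun y ↦ ((Real.log (lam y) + V.indicator φ y : ℝ) : ℂ) *
      (Complex.exp (s * ((Real.log (lam y) + V.indicator φ y : ℝ) : ℂ)) * η y))
      (fun y ↦ ((Real.log (lam y) + V.indicator φ y : ℝ) : ℂ) *
      ((lam y : ℂ) ^ s * (Complex.exp (s * φ y) * η y))) {y | 0 < lam y} := by
    intro y hy
    beta_reduce
    rw [heq s y hy]
  refine ⟨IntegrableOn.congr_fun key.1 hval hpos, ?_⟩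
  rw [hfun, ← setIntegral_congr_fun hpos hval]
  exact key.2

/-- The polynomial `s (s - 1) ⋯ (s - j + 1)`. -/
def fallingPoly (j : ℕ) (s : ℂ) : ℂ := ∏ i ∈ Finset.range j, (s - i)

theorem differentiable_fallingPoly (j : ℕ) : Differentiable ℂ (fallingPoly j) := by
  unfold fallingPoly
  fun_prop

theorem fallingPoly_zero {j : ℕ} (hj : j ≠ 0) : fallingPoly j 0 = 0 :=
  Finset.prod_eq_zero (Finset.mem_range.2 (Nat.pos_of_ne_zero hj)) (by simp)

namespace IsCollar

theorem integrableOn_twisted (hV : IsCollar V lam) (hφ : ContDiffOn ℝ ∞ φ V) (h : IsTest V η)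
    {j : ℕ} {s : ℂ} (hs : (j : ℝ) - 1 < s.re) :
    IntegrableOn (fun y ↦ (lam y : ℂ) ^ (s - j) * (Complex.exp (s * φ y) * η y))
      {y | 0 < lam y} :=
  hV.integrableOn_cpow (h.mul_left (contDiffOn_cexp_mul hφ s)) (by simp; linarith)

/-- Integrating by parts `j` times removes the factor `lam⁻ʲ`; each step costs one factor of the
polynomial, and produces a second term from the derivative of `exp(sφ)`. -/
theorem fallingPoly_mul_twistedIntegral (hV : IsCollar V lam) (hφ : ContDiffOn ℝ ∞ φ V)
    (h : IsTest V η) (j : ℕ) {s : ℂ} (hs : (j : ℝ) - 1 < s.re) :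
    fallingPoly j s * twistedIntegral lam φ j η s = twistedRegular V lam φ j η s := by
  induction j generalizing η with
  | zero => simp [fallingPoly, twistedRegular]
  | succ j ih =>
    have hs' : (j : ℝ) < s.re := by push_cast at hs; linarith
    have h1 := hV.setIntegral_cpow_recursion (h.mul_left (contDiffOn_cexp_mul hφ s))
      (σ := s - (j + 1 : ℕ)) (by simp; linarith)
    have hκ := h.mul_left (hV.contDiffOn_slope hφ)
    have e : s - ((j + 1 : ℕ) : ℂ) + 1 = s - j := by push_cast; ring
    have h2 : ∫ y in {y | 0 < lam y}, (lam y : ℂ) ^ (s - j) *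
        flowOp V lam (fun y ↦ Complex.exp (s * φ y) * η y) y =
        twistedIntegral lam φ j (flowOp V lam η) s +
          s * twistedIntegral lam φ j (fun y ↦ slope V lam φ y * η y) s := by
      rw [twistedIntegral, twistedIntegral, ← integral_const_mul, ← integral_add
        (hV.integrableOn_twisted hφ (hV.isTest_flowOp h) (by linarith))
        ((hV.integrableOn_twisted hφ hκ (by linarith)).const_mul s)]
      refine integral_congr_ae (Eventually.of_forall fun y ↦ ?_)
      simp only [hV.flowOp_cexp_mul hφ h]
      ring
    rw [e, h2] at h1
    rw [twistedRegular, ← ih (hV.isTest_flowOp h) (by linarith), ← ih hκ (by linarith), fallingPoly,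
      Finset.prod_range_succ, ← fallingPoly, mul_assoc, twistedIntegral, h1]
    ring

theorem hasDerivAt_twistedIntegral_zero (hV : IsCollar V lam) (hφ : ContDiffOn ℝ ∞ φ V)
    (h : IsTest V η) {s : ℂ} (hs : -1 < s.re) :
    IntegrableOn (fun y ↦ ((Real.log (lam y) + V.indicator φ y : ℝ) : ℂ) *
      ((lam y : ℂ) ^ s * (Complex.exp (s * φ y) * η y))) {y | 0 < lam y} ∧
    HasDerivAt (twistedIntegral lam φ 0 η)
      (∫ y in {y | 0 < lam y}, ((Real.log (lam y) + V.indicator φ y : ℝ) : ℂ) *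
        ((lam y : ℂ) ^ s * (Complex.exp (s * φ y) * η y))) s := by
  refine hasDerivAt_twistedIntegral hV.relOpen hV.measurable hφ
    h.integrable.aestronglyMeasurable (fun y ↦ h.eq_zero_of_notMem) (fun x hx ↦ ?_) hs
  simpa using hV.integrableOn_twisted hφ h (j := 0) (s := x) (by simpa using hx)

theorem differentiableAt_twistedRegular (hV : IsCollar V lam) (hφ : ContDiffOn ℝ ∞ φ V)
    (h : IsTest V η) (j : ℕ) {s : ℂ} (hs : -1 < s.re) :
    DifferentiableAt ℂ (twistedRegular V lam φ j η) s := by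
  induction j generalizing η with
  | zero => exact (hV.hasDerivAt_twistedIntegral_zero hφ h hs).2.differentiableAt
  | succ j ih =>
    exact ((ih (hV.isTest_flowOp h)).add
      (differentiableAt_id.mul (ih (h.mul_left (hV.contDiffOn_slope hφ))))).neg

/-- At `s = 0` the twist `exp(sφ)` is trivial, and so are the terms that come from its
derivative. -/
theorem twistedRegular_at_zero_indep (j : ℕ) (η : EuclideanSpace ℝ (Fin n) → ℂ) :
    twistedRegular V lam φ j η 0 = twistedRegular V lam (fun _ ↦ 0) j η 0 := by
  induction j generalizing η with
  | zero => simp [twistedRegular, twistedIntegral]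
  | succ j ih => simp [twistedRegular, ih]

theorem twistedRegular_at_zero_add (hV : IsCollar V lam) (h : IsTest V η) (h' : IsTest V θ)
    (j : ℕ) :
    twistedRegular V lam φ j (fun y ↦ η y + θ y) 0 =
      twistedRegular V lam φ j η 0 + twistedRegular V lam φ j θ 0 := by
  induction j generalizing η θ with
  | zero =>
    simp only [twistedRegular, twistedIntegral, zero_mul, Complex.exp_zero, one_mul,
      Nat.cast_zero, sub_zero, Complex.cpow_zero]
    exact integral_add h.integrable.integrableOn h'.integrable.integrableOn
  | succ j ih =>
    simp only [twistedRegular, zero_mul, add_zero, hV.flowOp_add h h',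
      ih (hV.isTest_flowOp h) (hV.isTest_flowOp h')]
    ring

/-- The first-order effect at `s = 0` of the twist by `exp(sφ)` is multiplication by `φ`. -/
theorem hasDerivAt_twistedRegular_sub (hV : IsCollar V lam) (hφ : ContDiffOn ℝ ∞ φ V)
    (h : IsTest V η) (j : ℕ) :
    HasDerivAt (fun s ↦ twistedRegular V lam φ j η s - twistedRegular V lam (fun _ ↦ 0) j η s)
      (twistedRegular V lam (fun _ ↦ 0) j (fun y ↦ φ y * η y) 0) 0 := by
  have h0 : ContDiffOn ℝ ∞ (fun _ : EuclideanSpace ℝ (Fin n) ↦ (0 : ℝ)) V := contDiffOn_const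
  induction j generalizing η with
  | zero =>
    have h1 := hV.hasDerivAt_twistedIntegral_zero hφ h (s := 0) (by simp)
    have h2 := hV.hasDerivAt_twistedIntegral_zero h0 h (s := 0) (by simp)
    refine (h1.2.sub h2.2).congr_deriv ?_
    rw [← integral_sub h1.1 h2.1, twistedRegular, twistedIntegral]
    refine integral_congr_ae (Eventually.of_forall fun y ↦ ?_)
    by_cases hy : y ∈ V
    · simp [hy]
      ring
    · simp [hy, h.eq_zero_of_notMem hy]
  | succ j ih =>
    have hκ := h.mul_left (hV.contDiffOn_slope hφ)
    have hL := hV.isTest_flowOp h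
    have d1 := ih hL
    have d2 := (hasDerivAt_id (0 : ℂ)).mul
      (hV.differentiableAt_twistedRegular hφ hκ j (s := 0) (by simp)).hasDerivAt
    have d3 := (hasDerivAt_id (0 : ℂ)).mul
      (hV.differentiableAt_twistedRegular h0 (h.mul_left (hV.contDiffOn_slope h0)) j
        (s := 0) (by simp)).hasDerivAt
    have hz : twistedRegular V lam (fun _ ↦ 0) j
        (fun y ↦ slope V lam (fun _ ↦ 0) y * η y) 0 = 0 := by
      have ht := h.mul_left (hV.contDiffOn_slope h0)
      have := hV.twistedRegular_at_zero_add (φ := fun _ ↦ 0) ht ht j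
      simp only [slope_zero, zero_mul, add_zero] at this ⊢
      simpa using this
    have := ((d1.add d2).sub d3).neg
    refine (this.congr_deriv ?_).congr_of_eventuallyEq (Eventually.of_forall fun s ↦ ?_)
    · simp only [twistedRegular, hV.flowOp_mul hφ h, zero_mul, add_zero, id_eq, one_mul, hz,
        hV.twistedRegular_at_zero_add (φ := fun _ ↦ 0) (hL.mul_left (contDiffOn_ofReal hφ)) hκ,
        twistedRegular_at_zero_indep (φ := φ)]
      ring
    · simp only [twistedRegular, Pi.add_apply, Pi.sub_apply, Pi.neg_apply, Pi.mul_apply, id_eq]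
      ring

end IsCollar

end Twist

/-! ### Boundary charts -/

section BoundaryChart

variable {n : ℕ} [NeZero n] {U : Set (EuclideanSpace ℝ (Fin n))}
  {lam φ : EuclideanSpace ℝ (Fin n) → ℝ} {η : EuclideanSpace ℝ (Fin n) → ℂ}

theorem isRelOpen_of_mem_nhdsWithin {S : Set (EuclideanSpace ℝ (Fin n))} (hS : S ⊆ halfSpace n)
    (h : ∀ y ∈ S, S ∈ 𝓝[halfSpace n] y) : IsRelOpen S := by
  refine ⟨interior (S ∪ (halfSpace n)ᶜ), isOpen_interior, ?_⟩
  ext y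
  constructor
  · intro hy
    refine ⟨mem_interior_iff_mem_nhds.2 ?_, hS hy⟩
    obtain ⟨u, hu, huS⟩ := mem_nhdsWithin_iff_exists_mem_nhds_inter.1 (h y hy)
    refine mem_of_superset hu fun z hz ↦ ?_
    by_cases hzH : z ∈ halfSpace n
    · exact Or.inl (huS ⟨hz, hzH⟩)
    · exact Or.inr hzH
  · rintro ⟨h1, h2⟩
    exact (interior_subset h1).resolve_right fun h3 ↦ h3 h2

theorem IsRelOpen.mem_nhdsWithin (hU : IsRelOpen U) {y : EuclideanSpace ℝ (Fin n)} (hy : y ∈ U) :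
    U ∈ 𝓝[halfSpace n] y := by
  obtain ⟨O, hO, rfl⟩ := hU
  rw [inter_comm]
  exact inter_mem_nhdsWithin _ (hO.mem_nhds hy.1)

theorem IsRelOpen.nhdsWithin_eq (hU : IsRelOpen U) {y : EuclideanSpace ℝ (Fin n)} (hy : y ∈ U) :
    𝓝[U] y = 𝓝[halfSpace n] y := by
  refine le_antisymm (nhdsWithin_mono _ fun z hz ↦ hU.nonneg hz) ?_
  rw [nhdsWithin]
  exact le_inf nhdsWithin_le_nhds (le_principal_iff.2 (hU.mem_nhdsWithin hy))

theorem IsTest.mono {V : Set (EuclideanSpace ℝ (Fin n))} (h : IsTest U η)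
    {K : Set (EuclideanSpace ℝ (Fin n))} (hV : V ⊆ U) (hK : K ⊆ V) (hKc : IsCompact K)
    (h0 : ∀ y ∉ K, η y = 0) : IsTest V η :=
  ⟨h.contDiffOn.mono hV, K, hK, hKc, h0⟩

/-- A defining function `lam` seen in a boundary chart: `lam ≥ 0` on the relatively open set `U`, and
near its zeros `lam` has positive normal derivative and vanishes on the boundary hyperplane. -/
structure IsBoundaryChart (U : Set (EuclideanSpace ℝ (Fin n)))
    (lam : EuclideanSpace ℝ (Fin n) → ℝ) : Prop where
  relOpen : IsRelOpen U
  measurable : Measurable lam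
  contDiffOn : ContDiffOn ℝ ∞ lam U
  nonneg : ∀ y ∈ U, 0 ≤ lam y
  of_zero : ∀ y ∈ U, lam y = 0 →
    0 < normalDeriv U lam y ∧ ∀ᶠ z in 𝓝[U] y, z 0 = 0 → lam z = 0

/-- The largest collar contained in a boundary chart. -/
def collarSet (U : Set (EuclideanSpace ℝ (Fin n))) (lam : EuclideanSpace ℝ (Fin n) → ℝ) :
    Set (EuclideanSpace ℝ (Fin n)) :=
  {y | y ∈ U ∧ 0 < normalDeriv U lam y ∧ (y 0 = 0 → lam y = 0)}

theorem collarSet_subset : collarSet U lam ⊆ U := fun _ hy ↦ hy.1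

namespace IsBoundaryChart

theorem isRelOpen_collarSet (hU : IsBoundaryChart U lam) : IsRelOpen (collarSet U lam) := by
  refine isRelOpen_of_mem_nhdsWithin (fun y hy ↦ hU.relOpen.nonneg hy.1) fun y hy ↦ ?_
  rw [← hU.relOpen.nhdsWithin_eq hy.1]
  have h1 : ∀ᶠ z in 𝓝[U] y, 0 < normalDeriv U lam z :=
    ((contDiffOn_normalDeriv hU.relOpen hU.contDiffOn).continuousOn y hy.1).eventually
      (lt_mem_nhds hy.2.1)
  have h2 : ∀ᶠ z in 𝓝[U] y, z 0 = 0 → lam z = 0 := by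
    rcases (hU.relOpen.nonneg hy.1).eq_or_lt with h0 | h0
    · exact (hU.of_zero y hy.1 (hy.2.2 h0.symm)).2
    · have : IsOpen {y : EuclideanSpace ℝ (Fin n) | 0 < y 0} :=
        isOpen_lt continuous_const (by fun_prop)
      filter_upwards [mem_nhdsWithin_of_mem_nhds (this.mem_nhds h0)] with z hz hz0
      exact absurd hz0 (ne_of_gt hz)
  filter_upwards [h1, h2, self_mem_nhdsWithin] with z a b c using ⟨c, a, b⟩

theorem isCollar (hU : IsBoundaryChart U lam) : IsCollar (collarSet U lam) lam where
  relOpen := hU.isRelOpen_collarSet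
  measurable := hU.measurable
  contDiffOn := hU.contDiffOn.mono collarSet_subset
  deriv_pos y hy := by
    rw [normalDeriv_of_mem hy, fderivWithin_subset collarSet_subset
      (hU.isRelOpen_collarSet.uniqueDiffOn y hy)
      (differentiableWithinAt_of_contDiffOn hU.contDiffOn hy.1), ← normalDeriv_of_mem hy.1]
    exact hy.2.1
  boundary y hy := hy.2.2

/-- A test function is the sum of one on the collar and one supported where `lam ≥ δ > 0`. -/
theorem exists_split (hU : IsBoundaryChart U lam) (h : IsTest U η) :
    ∃ χ : EuclideanSpace ℝ (Fin n) → ℝ, ContDiff ℝ ∞ χ ∧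
      IsTest (collarSet U lam) (fun y ↦ (χ y : ℂ) * η y) ∧
      IsTest U (fun y ↦ ((1 - χ y : ℝ) : ℂ) * η y) ∧
      ∃ δ : ℝ, 0 < δ ∧ ∀ y, ((1 - χ y : ℝ) : ℂ) * η y ≠ 0 → δ ≤ lam y := by
  obtain ⟨K, hK, hKc, h0⟩ := h.exists_compact
  have hlamK : ContinuousOn lam K := hU.contDiffOn.continuousOn.mono hK
  have hK0c : IsCompact (K ∩ lam ⁻¹' {0}) :=
    hKc.of_isClosed_subset (hlamK.preimage_isClosed_of_isClosed hKc.isClosed isClosed_singleton)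
      inter_subset_left
  obtain ⟨χ, hχ, -, ⟨O, hO, hKO, hχ1⟩, K', hK', hKc', hχ0⟩ :=
    exists_cutoff hU.isRelOpen_collarSet
      (fun y hy ↦ ⟨hK hy.1, (hU.of_zero y (hK hy.1) hy.2).1, fun _ ↦ hy.2⟩) hK0c
  refine ⟨χ, hχ, ?_, ?_, ?_⟩
  · refine (h.mul_left (contDiffOn_ofReal hχ.contDiffOn)).mono collarSet_subset hK' hKc'
      fun y hy ↦ ?_
    by_cases hyU : y ∈ U
    · rw [hχ0 y (hU.relOpen.nonneg hyU) hy, Complex.ofReal_zero, zero_mul]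
    · rw [h.eq_zero_of_notMem hyU, mul_zero]
  · exact h.mul_left (contDiffOn_ofReal (contDiff_const.sub hχ).contDiffOn)
  · have hpos : ∀ y ∈ K \ O, 0 < lam y := fun y hy ↦
      (hU.nonneg y (hK hy.1)).lt_of_ne fun hz ↦ hy.2 (hKO ⟨hy.1, hz.symm⟩)
    obtain ⟨δ, hδ, hδle⟩ := (hKc.diff hO).exists_forall_le' (hlamK.mono sdiff_subset) hpos
    refine ⟨δ, hδ, fun y hy ↦ hδle y ⟨?_, fun hyO ↦ hy ?_⟩⟩
    · by_contra hyK
      exact hy (by rw [h0 y hyK, mul_zero])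
    · rw [hχ1 y hyO, sub_self, Complex.ofReal_zero, zero_mul]

section Away

variable {δ : ℝ}

theorem measurableSet_pos (hU : IsBoundaryChart U lam) : MeasurableSet {y | 0 < lam y} :=
  measurableSet_lt measurable_const hU.measurable

theorem integrableOn_superlevel (hU : IsBoundaryChart U lam) (h : IsTest U η) (σ : ℂ) {ε : ℝ}
    (hε : 0 < ε) : IntegrableOn (fun y ↦ (lam y : ℂ) ^ σ * η y) {y | ε ≤ lam y} :=
  h.integrableOn_superlevel hU.contDiffOn.continuousOn hU.measurable (continuousOn_cpow_Ici σ hε)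

theorem integrableOn_of_away (hU : IsBoundaryChart U lam) (h : IsTest U η) (hδ : 0 < δ)
    (hηδ : ∀ y, η y ≠ 0 → δ ≤ lam y) (σ : ℂ) :
    IntegrableOn (fun y ↦ (lam y : ℂ) ^ σ * η y) {y | 0 < lam y} := by
  refine (hU.integrableOn_superlevel h σ hδ).of_forall_sdiff_eq_zero hU.measurableSet_pos
    fun y hy ↦ ?_
  have : η y = 0 := by
    by_contra h0
    exact hy.2 (hηδ y h0)
  rw [this, mul_zero]

theorem setIntegral_superlevel_of_away (hU : IsBoundaryChart U lam)
    (hηδ : ∀ y, η y ≠ 0 → δ ≤ lam y) (σ : ℂ) {ε : ℝ} (hε : 0 < ε) (hεδ : ε ≤ δ) :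
    ∫ y in {y | ε ≤ lam y}, (lam y : ℂ) ^ σ * η y =
      ∫ y in {y | 0 < lam y}, (lam y : ℂ) ^ σ * η y := by
  refine (setIntegral_eq_of_subset_of_forall_sdiff_eq_zero hU.measurableSet_pos
    (fun y (hy : ε ≤ lam y) ↦ hε.trans_le hy) fun y hy ↦ ?_).symm
  have : η y = 0 := by
    by_contra h0
    exact hy.2 (hεδ.trans (hηδ y h0))
  rw [this, mul_zero]

theorem differentiable_twistedIntegral_of_away (hU : IsBoundaryChart U lam)
    (hφ : ContDiffOn ℝ ∞ φ U) (h : IsTest U η) (hδ : 0 < δ)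
    (hηδ : ∀ y, η y ≠ 0 → δ ≤ lam y) (j : ℕ) :
    Differentiable ℂ (twistedIntegral lam φ j η) := by
  have heq : ∀ z : ℂ, ∀ y ∈ {y | 0 < lam y},
      (lam y : ℂ) ^ (z - j) * (Complex.exp (z * φ y) * η y) =
      (lam y : ℂ) ^ z * (Complex.exp (z * φ y) * ((lam y : ℂ) ^ (-(j : ℂ)) * η y)) := by
    intro z y hy
    rw [sub_eq_add_neg, Complex.cpow_add _ _ (by exact_mod_cast (ne_of_gt hy : lam y ≠ 0))]
    ring
  -- the factor `lam⁻ʲ` is absorbed into the function that is integrated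
  have hη : AEStronglyMeasurable (fun y ↦ (lam y : ℂ) ^ (-(j : ℂ)) * η y) volume :=
    ((Complex.measurable_ofReal.comp hU.measurable).pow_const _).aestronglyMeasurable.mul
      h.integrable.aestronglyMeasurable
  have hfun : twistedIntegral lam φ j η =
      twistedIntegral lam φ 0 fun y ↦ (lam y : ℂ) ^ (-(j : ℂ)) * η y := by
    funext z
    refine setIntegral_congr_fun hU.measurableSet_pos fun y hy ↦ ?_
    beta_reduce
    rw [heq z y hy, Nat.cast_zero, sub_zero]
  intro s
  rw [hfun]
  refine (hasDerivAt_twistedIntegral (a := s.re - 1) hU.relOpen hU.measurable hφ hη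
    (fun y hy ↦ by rw [h.eq_zero_of_notMem hy, mul_zero]) (fun x _ ↦ ?_)
    (by linarith)).2.differentiableAt
  refine IntegrableOn.congr_fun (hU.integrableOn_of_away
    (h.mul_left (contDiffOn_cexp_mul hφ x)) hδ (fun y hy ↦ hηδ y (right_ne_zero_of_mul hy))
    (x - j)) (fun y hy ↦ ?_) hU.measurableSet_pos
  exact heq x y hy

end Away

/-- The push-forward of a test density in a boundary chart: a function with a Taylor expansion,
up to a contribution from a region where `lam` is bounded below. -/
theorem exists_density (hU : IsBoundaryChart U lam) (h : IsTest U η) :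
    ∃ (G : ℝ → ℂ) (a : ℕ → ℂ) (A : ℂ → ℂ) (δ : ℝ), HasTaylorExpansion G a ∧ Differentiable ℂ A ∧
      0 < δ ∧
      (∀ σ : ℂ, -1 < σ.re → IntegrableOn (fun y ↦ (lam y : ℂ) ^ σ * η y) {y | 0 < lam y} ∧
        ∫ y in {y | 0 < lam y}, (lam y : ℂ) ^ σ * η y = mellin G (σ + 1) + A σ) ∧
      ∀ ε : ℝ, 0 < ε → ε < δ → ∀ σ : ℂ, ∫ y in {y | ε ≤ lam y}, (lam y : ℂ) ^ σ * η y =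
        (∫ v in Ioi ε, (v : ℂ) ^ σ * G v) + A σ := by
  obtain ⟨χ, hχ, h1, h2, δ, hδ, hδle⟩ := hU.exists_split h
  have hC := hU.isCollar
  have hsplit : ∀ σ : ℂ, (fun y ↦ (lam y : ℂ) ^ σ * η y) = fun y ↦
      (lam y : ℂ) ^ σ * (χ y * η y) + (lam y : ℂ) ^ σ * (((1 - χ y : ℝ) : ℂ) * η y) := by
    intro σ
    funext y
    push_cast
    ring
  refine ⟨density (collarSet U lam) lam (fun y ↦ (χ y : ℂ) * η y), _,
    fun σ ↦ ∫ y in {y | 0 < lam y}, (lam y : ℂ) ^ σ * (((1 - χ y : ℝ) : ℂ) * η y), δ,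
    hC.hasTaylorExpansion_density h1, ?_, hδ, fun σ hσ ↦ ?_, fun ε hε hεδ σ ↦ ?_⟩
  · have := hU.differentiable_twistedIntegral_of_away (φ := fun _ ↦ 0) contDiffOn_const h2 hδ hδle 0
    have e : (twistedIntegral lam (fun _ ↦ 0) 0 fun y ↦ ((1 - χ y : ℝ) : ℂ) * η y) =
        fun σ ↦ ∫ y in {y | 0 < lam y}, (lam y : ℂ) ^ σ * (((1 - χ y : ℝ) : ℂ) * η y) := by
      funext σ
      simp [twistedIntegral]
    rwa [e] at this
  · have i1 := hC.integrableOn_cpow h1 hσ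
    have i2 := hU.integrableOn_of_away h2 hδ hδle σ
    rw [hsplit σ]
    refine ⟨i1.add i2, ?_⟩
    rw [integral_add i1 i2, hC.setIntegral_cpow_eq_mellin h1 hσ]
  · have i1 := hC.integrableOn_superlevel h1 (continuousOn_cpow_Ici σ hε)
    have i2 := hU.integrableOn_superlevel h2 σ hε
    rw [hsplit σ, integral_add i1 i2, hU.setIntegral_superlevel_of_away hδle σ hε hεδ.le,
      hC.setIntegral_superlevel h1 hε (continuousOn_cpow_Ici σ hε)]

/-- The part of the integral away from the zeros of `lam` needs no integration by parts. -/
theorem exists_regular_aux (hU : IsBoundaryChart U lam) (hφ : ContDiffOn ℝ ∞ φ U)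
    {χ : EuclideanSpace ℝ (Fin n) → ℝ}
    (h1 : IsTest (collarSet U lam) (fun y ↦ (χ y : ℂ) * η y))
    (h2 : IsTest U (fun y ↦ ((1 - χ y : ℝ) : ℂ) * η y)) {δ : ℝ} (hδ : 0 < δ)
    (hδle : ∀ y, ((1 - χ y : ℝ) : ℂ) * η y ≠ 0 → δ ≤ lam y) (M : ℕ) {s : ℂ}
    (hs : (M : ℝ) - 1 < s.re) :
    fallingPoly M s * twistedIntegral lam φ M η s =
      twistedRegular (collarSet U lam) lam φ M (fun y ↦ (χ y : ℂ) * η y) s +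
      fallingPoly M s * twistedIntegral lam φ M (fun y ↦ ((1 - χ y : ℝ) : ℂ) * η y) s := by
  have hC := hU.isCollar
  have hφC := hφ.mono (collarSet_subset (lam := lam))
  rw [← hC.fallingPoly_mul_twistedIntegral hφC h1 M hs, ← mul_add]
  congr 1
  rw [twistedIntegral, twistedIntegral, twistedIntegral, ← integral_add
    (hC.integrableOn_twisted hφC h1 hs)
    (hU.integrableOn_of_away (h2.mul_left (contDiffOn_cexp_mul hφ s)) hδ
      (fun y hy ↦ hδle y (right_ne_zero_of_mul hy)) (s - M))]
  refine integral_congr_ae (Eventually.of_forall fun y ↦ ?_)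
  push_cast
  ring

/-- After multiplication by `s (s - 1) ⋯ (s - M + 1)` the zeta integrals of `lam⁻ᴹ η`, of its twist
by `exp(sφ)` and of `lam⁻ᴹ φ η` extend to functions `B₀`, `Bφ`, `Bm` holomorphic on `Re s > -1`. The
value of `Bφ` at `0` does not depend on `φ`, and its first-order change is the value of `Bm`. -/
theorem exists_regular (hU : IsBoundaryChart U lam) (hφ : ContDiffOn ℝ ∞ φ U) (h : IsTest U η)
    {M : ℕ} (hM : M ≠ 0) :
    ∃ B₀ Bφ Bm : ℂ → ℂ,
      (∀ s : ℂ, -1 < s.re → DifferentiableAt ℂ B₀ s ∧ DifferentiableAt ℂ Bφ s ∧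
        DifferentiableAt ℂ Bm s) ∧
      (∀ s : ℂ, (M : ℝ) - 1 < s.re →
        fallingPoly M s * twistedIntegral lam (fun _ ↦ 0) M η s = B₀ s ∧
        fallingPoly M s * twistedIntegral lam φ M η s = Bφ s ∧
        fallingPoly M s * twistedIntegral lam (fun _ ↦ 0) M (fun y ↦ (φ y : ℂ) * η y) s = Bm s) ∧
      Bφ 0 = B₀ 0 ∧ HasDerivAt (fun s ↦ Bφ s - B₀ s) (Bm 0) 0 := by
  obtain ⟨χ, hχ, h1, h2, δ, hδ, hδle⟩ := hU.exists_split h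
  have hC := hU.isCollar
  have hφC := hφ.mono (collarSet_subset (lam := lam))
  have hz : ContDiffOn ℝ ∞ (fun _ : EuclideanSpace ℝ (Fin n) ↦ (0 : ℝ)) U := contDiffOn_const
  have hzC := hz.mono (collarSet_subset (lam := lam))
  have ec : ∀ (ψ : EuclideanSpace ℝ (Fin n) → ℝ),
      (fun y ↦ (ψ y : ℂ) * ((φ y : ℂ) * η y)) = fun y ↦ (φ y : ℂ) * ((ψ y : ℂ) * η y) :=
    fun ψ ↦ funext fun y ↦ by ring
  have m1 : IsTest (collarSet U lam) (fun y ↦ (χ y : ℂ) * ((φ y : ℂ) * η y)) := by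
    rw [ec]; exact h1.mul_left (contDiffOn_ofReal hφC)
  have m2 : IsTest U (fun y ↦ ((1 - χ y : ℝ) : ℂ) * ((φ y : ℂ) * η y)) := by
    rw [ec fun y ↦ 1 - χ y]; exact h2.mul_left (contDiffOn_ofReal hφ)
  have m3 : ∀ y, ((1 - χ y : ℝ) : ℂ) * ((φ y : ℂ) * η y) ≠ 0 → δ ≤ lam y := fun y hy ↦
    hδle y (by rw [mul_left_comm] at hy; exact right_ne_zero_of_mul hy)
  have t0 := hU.differentiable_twistedIntegral_of_away hz h2 hδ hδle M
  have tφ := hU.differentiable_twistedIntegral_of_away hφ h2 hδ hδle M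
  have tm := hU.differentiable_twistedIntegral_of_away hz m2 hδ m3 M
  have hp := differentiable_fallingPoly M
  refine ⟨_, _, _, fun s hs ↦ ⟨?_, ?_, ?_⟩, fun s hs ↦
    ⟨hU.exists_regular_aux hz h1 h2 hδ hδle M hs, hU.exists_regular_aux hφ h1 h2 hδ hδle M hs,
      hU.exists_regular_aux hz m1 m2 hδ m3 M hs⟩, ?_, ?_⟩
  · exact (hC.differentiableAt_twistedRegular hzC h1 M hs).add ((hp s).mul (t0 s))
  · exact (hC.differentiableAt_twistedRegular hφC h1 M hs).add ((hp s).mul (tφ s))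
  · exact (hC.differentiableAt_twistedRegular hzC m1 M hs).add ((hp s).mul (tm s))
  · rw [fallingPoly_zero hM, zero_mul, zero_mul, IsCollar.twistedRegular_at_zero_indep]
  · have d1 := hC.hasDerivAt_twistedRegular_sub hφC h1 M
    have d2 := (hp 0).hasDerivAt.mul ((tφ 0).hasDerivAt.sub (t0 0).hasDerivAt)
    refine ((d1.add d2).congr_deriv ?_).congr_of_eventuallyEq (Eventually.of_forall fun s ↦ ?_)
    · have : twistedIntegral lam φ M (fun y ↦ ((1 - χ y : ℝ) : ℂ) * η y) 0 =
          twistedIntegral lam (fun _ ↦ 0) M (fun y ↦ ((1 - χ y : ℝ) : ℂ) * η y) 0 := by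
        simp [twistedIntegral]
      simp only [Pi.sub_apply, this, sub_self, mul_zero, fallingPoly_zero hM, zero_mul, add_zero,
        ec]
    · simp only [Pi.add_apply, Pi.mul_apply, Pi.sub_apply]
      ring

end IsBoundaryChart

end BoundaryChart

/-! ### Hadamard's lemma -/

section ParametricIntegral

variable {E : Type*} [NormedAddCommGroup E] [NormedSpace ℝ E]

/-- Differentiation under the integral sign within a convex set, up to its boundary. -/
theorem hasFDerivWithinAt_parametric_integral {G : Type*} [NormedAddCommGroup G] [NormedSpace ℝ G]
    [CompleteSpace G] {S : Set E} (hS : Convex ℝ S) {F : ℝ → E → G} {F' : ℝ → E → E →L[ℝ] G}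
    (hF : ContinuousOn (Function.uncurry F) (Icc 0 1 ×ˢ S))
    (hF' : ContinuousOn (Function.uncurry F') (Icc 0 1 ×ˢ S))
    (hd : ∀ t ∈ Icc (0 : ℝ) 1, ∀ y ∈ S, HasFDerivWithinAt (F t) (F' t y) S y) {y : E}
    (hy : y ∈ S) :
    HasFDerivWithinAt (fun z ↦ ∫ t in (0 : ℝ)..1, F t z) (∫ t in (0 : ℝ)..1, F' t y) S y := by
  have hFi : ∀ z ∈ S, IntervalIntegrable (fun t ↦ F t z) volume 0 1 := fun z hz ↦ by
    refine ContinuousOn.intervalIntegrable ?_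
    rw [uIcc_of_le zero_le_one]
    exact hF.comp (f := fun t ↦ (t, z)) (by fun_prop) fun t ht ↦ ⟨ht, hz⟩
  have hFi' : IntervalIntegrable (fun t ↦ F' t y) volume 0 1 := by
    refine ContinuousOn.intervalIntegrable ?_
    rw [uIcc_of_le zero_le_one]
    exact hF'.comp (f := fun t ↦ (t, y)) (by fun_prop) fun t ht ↦ ⟨ht, hy⟩
  rw [hasFDerivWithinAt_iff_isLittleO, Asymptotics.isLittleO_iff]
  intro ε hε
  -- by compactness of `[0, 1]` the derivatives are uniformly close to those at `y`
  have huni : ∀ᶠ z in 𝓝 y, ∀ t ∈ Icc (0 : ℝ) 1, z ∈ S → ‖F' t z - F' t y‖ ≤ ε := by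
    have : ∀ᶠ z in 𝓝 y, ∀ t ∈ Icc (0 : ℝ) 1,
        t ∈ Icc (0 : ℝ) 1 → z ∈ S → ‖F' t z - F' t y‖ ≤ ε := by
      refine isCompact_Icc.eventually_forall_of_forall_eventually fun t ht ↦ ?_
      have hc := hF' (t, y) ⟨ht, hy⟩
      have hb := hc.eventually (Metric.ball_mem_nhds _ (half_pos hε))
      rw [eventually_nhdsWithin_iff] at hb
      have hb1 : ∀ᶠ p : E × ℝ in 𝓝 (y, t), (p.2, p.1) ∈ Icc (0 : ℝ) 1 ×ˢ S →
          F' p.2 p.1 ∈ Metric.ball (F' t y) (ε / 2) :=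
        ((continuous_swap.tendsto (y, t)).eventually hb)
      have hb2 : ∀ᶠ p : E × ℝ in 𝓝 (y, t), (p.2, y) ∈ Icc (0 : ℝ) 1 ×ˢ S →
          F' p.2 y ∈ Metric.ball (F' t y) (ε / 2) :=
        (((by fun_prop : Continuous fun p : E × ℝ ↦ (p.2, y)).tendsto (y, t)).eventually hb)
      filter_upwards [hb1, hb2] with p h1 h2 ht' hz
      have h1' := mem_ball_iff_norm.1 (h1 ⟨ht', hz⟩)
      have h2' := mem_ball_iff_norm.1 (h2 ⟨ht', hy⟩)
      calc ‖F' p.2 p.1 - F' p.2 y‖ = ‖(F' p.2 p.1 - F' t y) - (F' p.2 y - F' t y)‖ := by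
            congr 1; abel
        _ ≤ ‖F' p.2 p.1 - F' t y‖ + ‖F' p.2 y - F' t y‖ := norm_sub_le _ _
        _ ≤ ε := by linarith
    filter_upwards [this] with z hz t ht using hz t ht ht
  obtain ⟨r, hr, hball⟩ := Metric.eventually_nhds_iff_ball.1 huni
  filter_upwards [self_mem_nhdsWithin, mem_nhdsWithin_of_mem_nhds (Metric.ball_mem_nhds y hr)]
    with z hzS hzr
  have hpt : ∀ t ∈ Icc (0 : ℝ) 1, ‖F t z - F t y - F' t y (z - y)‖ ≤ ε * ‖z - y‖ := fun t ht ↦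
    (hS.inter (convex_ball y r)).norm_image_sub_le_of_norm_hasFDerivWithin_le'
      (f := F t) (f' := F' t) (φ := F' t y)
      (fun x hx ↦ (hd t ht x hx.1).mono inter_subset_left)
      (fun x hx ↦ hball x hx.2 t ht hx.1) ⟨hy, Metric.mem_ball_self hr⟩ ⟨hzS, hzr⟩
  have happ : (∫ t in (0 : ℝ)..1, F' t y) (z - y) = ∫ t in (0 : ℝ)..1, F' t y (z - y) :=
    ContinuousLinearMap.intervalIntegral_apply hFi' (z - y)
  have hia : IntervalIntegrable (fun t ↦ F' t y (z - y)) volume 0 1 :=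
    ⟨hFi'.1.apply_continuousLinearMap _, hFi'.2.apply_continuousLinearMap _⟩
  rw [happ, ← intervalIntegral.integral_sub (hFi z hzS) (hFi y hy),
    ← intervalIntegral.integral_sub ((hFi z hzS).sub (hFi y hy)) hia]
  have := intervalIntegral.norm_integral_le_of_norm_le_const (a := 0) (b := 1)
    (C := ε * ‖z - y‖) (f := fun t ↦ F t z - F t y - F' t y (z - y)) fun t ht ↦ by
      rw [uIoc_of_le zero_le_one] at ht
      exact hpt t ⟨ht.1.le, ht.2⟩
  simpa using this

theorem contDiffOn_parametric_fderiv {G : Type*} [NormedAddCommGroup G] [NormedSpace ℝ G]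
    {S : Set E} (hSu : UniqueDiffOn ℝ S) {F : ℝ × E → G}
    (hF : ContDiffOn ℝ ∞ F (Icc (0 : ℝ) 1 ×ˢ S)) :
    ContDiffOn ℝ ∞ (fun p ↦ (fderivWithin ℝ F (Icc (0 : ℝ) 1 ×ˢ S) p).comp
      (ContinuousLinearMap.inr ℝ ℝ E)) (Icc (0 : ℝ) 1 ×ˢ S) :=
  (hF.fderivWithin ((uniqueDiffOn_Icc zero_lt_one).prod hSu) (by simp)).clm_comp contDiffOn_const

theorem hasFDerivWithinAt_integral_of_contDiffOn {G : Type*} [NormedAddCommGroup G]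
    [NormedSpace ℝ G] [CompleteSpace G] {S : Set E} (hS : Convex ℝ S) (hSu : UniqueDiffOn ℝ S)
    {F : ℝ × E → G} (hF : ContDiffOn ℝ ∞ F (Icc (0 : ℝ) 1 ×ˢ S)) {y : E} (hy : y ∈ S) :
    HasFDerivWithinAt (fun z ↦ ∫ t in (0 : ℝ)..1, F (t, z))
      (∫ t in (0 : ℝ)..1, (fderivWithin ℝ F (Icc (0 : ℝ) 1 ×ˢ S) (t, y)).comp
        (ContinuousLinearMap.inr ℝ ℝ E)) S y := by
  refine hasFDerivWithinAt_parametric_integral hS (F := fun t z ↦ F (t, z))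
    (F' := fun t z ↦ (fderivWithin ℝ F (Icc (0 : ℝ) 1 ×ˢ S) (t, z)).comp
      (ContinuousLinearMap.inr ℝ ℝ E)) hF.continuousOn
    (contDiffOn_parametric_fderiv hSu hF).continuousOn (fun t ht z hz ↦ ?_) hy
  have h1 : HasFDerivWithinAt (fun z : E ↦ (t, z)) (ContinuousLinearMap.inr ℝ ℝ E) S z :=
    (hasFDerivAt_prodMk_right t z).hasFDerivWithinAt
  have h2 := ((hF.differentiableOn (by simp)) (t, z) ⟨ht, hz⟩).hasFDerivWithinAt
  exact h2.comp z h1 fun x hx ↦ ⟨ht, hx⟩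

/-- Integrating a jointly smooth function over the parameter `t ∈ [0, 1]` gives a smooth function,
up to the boundary of a convex set. The universes of `E` and `G` agree because the induction on the
order of differentiability passes from `G` to `E →L[ℝ] G`. -/
theorem contDiffOn_parametric_integral.{u} {E : Type u} [NormedAddCommGroup E] [NormedSpace ℝ E]
    {S : Set E} (hS : Convex ℝ S) (hSu : UniqueDiffOn ℝ S) {G : Type u} [NormedAddCommGroup G]
    [NormedSpace ℝ G] [CompleteSpace G] {F : ℝ × E → G}
    (hF : ContDiffOn ℝ ∞ F (Icc (0 : ℝ) 1 ×ˢ S)) :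
    ContDiffOn ℝ ∞ (fun y ↦ ∫ t in (0 : ℝ)..1, F (t, y)) S := by
  rw [contDiffOn_infty]
  intro k
  induction k generalizing G with
  | zero =>
    exact contDiffOn_zero.2 fun y hy ↦
      (hasFDerivWithinAt_integral_of_contDiffOn hS hSu hF hy).continuousWithinAt
  | succ k ih =>
    have key : ContDiffOn ℝ ((k : ℕ∞ω) + 1) (fun y ↦ ∫ t in (0 : ℝ)..1, F (t, y)) S := by
      rw [contDiffOn_succ_iff_fderivWithin hSu]
      refine ⟨fun y hy ↦
        (hasFDerivWithinAt_integral_of_contDiffOn hS hSu hF hy).differentiableWithinAt,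
        by simp, ?_⟩
      refine (ih (contDiffOn_parametric_fderiv hSu hF)).congr fun y hy ↦ ?_
      exact (hasFDerivWithinAt_integral_of_contDiffOn hS hSu hF hy).fderivWithin (hSu y hy)
    exact_mod_cast key

end ParametricIntegral

section Hadamard

variable {n : ℕ} [NeZero n]

/-- The points `y` with the first coordinate multiplied by `t`. -/
def scaleFirst (t : ℝ) (y : EuclideanSpace ℝ (Fin n)) : EuclideanSpace ℝ (Fin n) :=
  y + ((t - 1) * y 0) • EuclideanSpace.single 0 1

theorem scaleFirst_zero_coord (t : ℝ) (y : EuclideanSpace ℝ (Fin n)) :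
    scaleFirst t y 0 = t * y 0 := by
  simp [scaleFirst]; ring

theorem scaleFirst_one (y : EuclideanSpace ℝ (Fin n)) : scaleFirst 1 y = y := by
  simp [scaleFirst]

theorem contDiff_scaleFirst :
    ContDiff ℝ ∞ fun p : ℝ × EuclideanSpace ℝ (Fin n) ↦ scaleFirst p.1 p.2 := by
  unfold scaleFirst
  have : ContDiff ℝ ∞ fun p : ℝ × EuclideanSpace ℝ (Fin n) ↦ p.2 0 :=
    (contDiff_euclidean.1 contDiff_snd) 0
  exact contDiff_snd.add (((contDiff_fst.sub contDiff_const).mul this).smul contDiff_const)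

variable {c : EuclideanSpace ℝ (Fin n)} {r : ℝ}

theorem scaleFirst_mem (hc : c 0 = 0) {t : ℝ} (ht : t ∈ Icc (0 : ℝ) 1)
    {y : EuclideanSpace ℝ (Fin n)} (hy : y ∈ Metric.ball c r ∩ halfSpace n) :
    scaleFirst t y ∈ Metric.ball c r ∩ halfSpace n := by
  refine ⟨?_, ?_⟩
  · refine mem_ball_iff_norm.2 (lt_of_le_of_lt ?_ (mem_ball_iff_norm.1 hy.1))
    rw [EuclideanSpace.norm_eq, EuclideanSpace.norm_eq]
    refine Real.sqrt_le_sqrt (Finset.sum_le_sum fun i _ ↦ ?_)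
    rw [sq_le_sq₀ (norm_nonneg _) (norm_nonneg _)]
    by_cases hi : i = 0
    · subst hi
      simp only [PiLp.sub_apply, scaleFirst_zero_coord, hc, sub_zero, norm_mul]
      refine mul_le_of_le_one_left (norm_nonneg _) ?_
      rw [Real.norm_of_nonneg ht.1]
      exact ht.2
    · simp [scaleFirst, hi]
  · change 0 ≤ scaleFirst t y 0
    rw [scaleFirst_zero_coord]
    exact mul_nonneg ht.1 hy.2

/-- **Hadamard's lemma** on a half-ball: a smooth function vanishing on the boundary hyperplane is
the product of the first coordinate and a smooth function. -/
theorem exists_eq_coord_mul (hc : c 0 = 0) {f : EuclideanSpace ℝ (Fin n) → ℝ}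
    (hf : ContDiffOn ℝ ∞ f (Metric.ball c r ∩ halfSpace n))
    (h0 : ∀ y ∈ Metric.ball c r ∩ halfSpace n, y 0 = 0 → f y = 0) :
    ∃ a : EuclideanSpace ℝ (Fin n) → ℝ, ContDiffOn ℝ ∞ a (Metric.ball c r ∩ halfSpace n) ∧
      (∀ y ∈ Metric.ball c r ∩ halfSpace n, f y = y 0 * a y) ∧
      ∀ y ∈ Metric.ball c r ∩ halfSpace n, y 0 = 0 →
        a y = normalDeriv (Metric.ball c r ∩ halfSpace n) f y := by
  set S := Metric.ball c r ∩ halfSpace n with hS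
  have hrel : IsRelOpen S := ⟨_, Metric.isOpen_ball, rfl⟩
  have hconv : Convex ℝ S := by
    refine (convex_ball c r).inter ?_
    intro x hx y hy p q hp hq _
    change 0 ≤ (p • x + q • y) 0
    simp only [PiLp.add_apply, PiLp.smul_apply, smul_eq_mul]
    exact add_nonneg (mul_nonneg hp hx) (mul_nonneg hq hy)
  have hD := contDiffOn_normalDeriv hrel hf
  have hjoint : ContDiffOn ℝ ∞ (fun p : ℝ × EuclideanSpace ℝ (Fin n) ↦
      normalDeriv S f (scaleFirst p.1 p.2)) (Icc (0 : ℝ) 1 ×ˢ S) :=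
    hD.comp contDiff_scaleFirst.contDiffOn fun p hp ↦ scaleFirst_mem hc hp.1 hp.2
  refine ⟨fun y ↦ ∫ t in (0 : ℝ)..1, normalDeriv S f (scaleFirst t y),
    contDiffOn_parametric_integral hconv hrel.uniqueDiffOn hjoint, fun y hy ↦ ?_,
    fun y hy hy0 ↦ ?_⟩
  · rcases (hrel.nonneg hy).eq_or_lt with hy0 | hy0
    · rw [h0 y hy hy0.symm, ← hy0, zero_mul]
    · have hcont : ContinuousOn (fun t : ℝ ↦ f (scaleFirst t y)) (Icc 0 1) :=
        hf.continuousOn.comp (contDiff_scaleFirst.continuous.comp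
          (by fun_prop : Continuous fun t : ℝ ↦ (t, y))).continuousOn
          fun t ht ↦ scaleFirst_mem hc ht hy
      have hcont' : ContinuousOn (fun t : ℝ ↦ y 0 * normalDeriv S f (scaleFirst t y))
          (Icc 0 1) :=
        continuousOn_const.mul (hD.continuousOn.comp (contDiff_scaleFirst.continuous.comp
          (by fun_prop : Continuous fun t : ℝ ↦ (t, y))).continuousOn
          fun t ht ↦ scaleFirst_mem hc ht hy)
      have hder : ∀ t ∈ Ioo (0 : ℝ) 1, HasDerivAt (fun t : ℝ ↦ f (scaleFirst t y))
          (y 0 * normalDeriv S f (scaleFirst t y)) t := by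
        intro t ht
        have hm := scaleFirst_mem hc ⟨ht.1.le, ht.2.le⟩ hy
        have h1 := hasLineDerivAt_normalDeriv hrel hf hm (by
          rw [scaleFirst_zero_coord]; exact mul_pos ht.1 hy0)
        have h2 : HasDerivAt (fun u : ℝ ↦ (u - t) * y 0) (y 0) t := by
          simpa using ((hasDerivAt_id t).sub_const t).mul_const (y 0)
        have h3 := h1.scomp_of_eq t h2 (by simp)
        refine h3.congr_of_eventuallyEq (Eventually.of_forall fun u ↦ ?_)
        simp only [Function.comp_apply, scaleFirst, add_assoc, ← add_smul]
        congr 3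
        ring
      have := intervalIntegral.integral_eq_sub_of_hasDerivAt_of_le zero_le_one hcont hder
        (by rw [← uIcc_of_le (zero_le_one' ℝ)] at hcont'; exact hcont'.intervalIntegrable)
      rw [intervalIntegral.integral_const_mul, scaleFirst_one, h0 (scaleFirst 0 y)
        (scaleFirst_mem hc ⟨le_rfl, zero_le_one⟩ hy) (by simp [scaleFirst_zero_coord]),
        sub_zero] at this
      exact this.symm
  · have : ∀ t : ℝ, scaleFirst t y = y := fun t ↦ by simp [scaleFirst, hy0]
    simp [this]

end Hadamard

/-! ### Charts of a manifold with boundary -/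

section Charts

/-- At a boundary point where a nonnegative function vanishes, its derivatives along the boundary
vanish; if the differential is nonzero then the function grows in the normal direction. -/
theorem normalDeriv_pos_of_isMin {n : ℕ} [NeZero n] {V : Set (EuclideanSpace ℝ (Fin n))}
    (hV : IsRelOpen V) {f : EuclideanSpace ℝ (Fin n) → ℝ} (hf : ∀ z ∈ V, 0 ≤ f z)
    {y : EuclideanSpace ℝ (Fin n)} (hy : y ∈ V) (hfy : f y = 0) (hy0 : y 0 = 0)
    (hd : fderivWithin ℝ f V y ≠ 0) : 0 < normalDeriv V f y := by
  rw [normalDeriv_of_mem hy]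
  have hmin : IsLocalMinOn f V y :=
    eventually_of_mem self_mem_nhdsWithin fun z hz ↦ hfy.symm ▸ hf z hz
  have hcone : ∀ v : EuclideanSpace ℝ (Fin n), 0 ≤ v 0 → v ∈ posTangentConeAt V y := by
    intro v hv
    refine mem_posTangentConeAt_of_frequently_mem (Eventually.frequently ?_)
    obtain ⟨O, hO, rfl⟩ := hV
    have hc : ∀ᶠ t : ℝ in 𝓝[>] 0, y + t • v ∈ O :=
      ((by fun_prop : Continuous fun t : ℝ ↦ y + t • v).continuousWithinAt.tendsto).eventually
        (hO.mem_nhds (by simpa using hy.1))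
    filter_upwards [hc, self_mem_nhdsWithin] with t ht (ht0 : 0 < t)
    refine ⟨ht, ?_⟩
    change 0 ≤ (y + t • v) 0
    simp only [PiLp.add_apply, PiLp.smul_apply, smul_eq_mul, hy0, zero_add]
    positivity
  refine lt_of_le_of_ne (hmin.fderivWithin_nonneg (hcone _ (by simp))) fun h0 ↦ hd ?_
  ext v
  have h1 : v = v 0 • EuclideanSpace.single 0 1 + (v - v 0 • EuclideanSpace.single 0 1) := by
    abel
  have h2 := hmin.fderivWithin_eq_zero (y := v - v 0 • EuclideanSpace.single 0 1)
    (hcone _ (by simp)) (hcone _ (by simp))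
  rw [h1, map_add, h2, map_smul, ← h0]
  simp

variable {n : ℕ} [NeZero n] {X : Type*} [TopologicalSpace X]
  [ChartedSpace (EuclideanHalfSpace n) X]

theorem isRelOpen_target (p : X) : IsRelOpen (extChartAt (𝓡∂ n) p).target := by
  refine ⟨(𝓡∂ n).symm ⁻¹' (chartAt (EuclideanHalfSpace n) p).target,
    (chartAt (EuclideanHalfSpace n) p).open_target.preimage (𝓡∂ n).continuous_symm, ?_⟩
  rw [extChartAt_target, range_eq_halfSpace]

variable [IsManifold (𝓡∂ n) ∞ X]

theorem contDiffOn_comp_symm {f : X → ℝ} (hf : ContMDiff (𝓡∂ n) 𝓘(ℝ, ℝ) ∞ f) (p : X) :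
    ContDiffOn ℝ ∞ (fun y ↦ f ((extChartAt (𝓡∂ n) p).symm y)) (extChartAt (𝓡∂ n) p).target :=
  contMDiffOn_iff_contDiffOn.1 (hf.comp_contMDiffOn (contMDiffOn_extChartAt_symm p))

theorem isInteriorPoint_symm_iff (p : X) {y : EuclideanSpace ℝ (Fin n)}
    (hy : y ∈ (extChartAt (𝓡∂ n) p).target) :
    (𝓡∂ n).IsInteriorPoint ((extChartAt (𝓡∂ n) p).symm y) ↔ 0 < y 0 := by
  have h1 := (𝓡∂ n).isInteriorPoint_iff_of_mem_atlas (n := ∞) (by simp)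
    (chart_mem_atlas (EuclideanHalfSpace n) p)
    (x := (extChartAt (𝓡∂ n) p).symm y)
    (by rw [← extChartAt_source (𝓡∂ n)]; exact (extChartAt (𝓡∂ n) p).map_target hy)
  rw [← extChartAt, (extChartAt (𝓡∂ n) p).right_inv hy] at h1
  rw [h1]
  constructor
  · intro h
    have h2 : y ∈ interior (range (𝓡∂ n)) :=
      interior_mono (by rw [extChartAt_target]; exact inter_subset_right) h
    rwa [interior_range_modelWithCornersEuclideanHalfSpace] at h2
  · exact fun h ↦ mem_interior_iff_mem_nhds.2 ((isRelOpen_target p).mem_nhds hy h)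

theorem isBoundaryPoint_symm_iff (p : X) {y : EuclideanSpace ℝ (Fin n)}
    (hy : y ∈ (extChartAt (𝓡∂ n) p).target) :
    (𝓡∂ n).IsBoundaryPoint ((extChartAt (𝓡∂ n) p).symm y) ↔ y 0 = 0 := by
  rw [(𝓡∂ n).isBoundaryPoint_iff_not_isInteriorPoint, isInteriorPoint_symm_iff p hy, not_lt]
  exact ⟨fun h ↦ le_antisymm h ((isRelOpen_target p).nonneg hy), fun h ↦ h.le⟩

/-- The function `lam` in the coordinates of the chart centred at `p`. It is zero off the chart, so
that the sets `{0 < chartFun p lam}` and `{ε ≤ chartFun p lam}` lie in the chart. -/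
def chartFun (p : X) (lam : X → ℝ) : EuclideanSpace ℝ (Fin n) → ℝ :=
  (extChartAt (𝓡∂ n) p).target.indicator fun y ↦ lam ((extChartAt (𝓡∂ n) p).symm y)

theorem chartFun_of_mem {p : X} {lam : X → ℝ} {y : EuclideanSpace ℝ (Fin n)}
    (hy : y ∈ (extChartAt (𝓡∂ n) p).target) :
    chartFun p lam y = lam ((extChartAt (𝓡∂ n) p).symm y) :=
  indicator_of_mem hy _

theorem chartFun_of_notMem {p : X} {lam : X → ℝ} {y : EuclideanSpace ℝ (Fin n)}
    (hy : y ∉ (extChartAt (𝓡∂ n) p).target) : chartFun p lam y = 0 :=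
  indicator_of_notMem hy _

theorem contDiffOn_chartFun {lam : X → ℝ} (hl : ContMDiff (𝓡∂ n) 𝓘(ℝ, ℝ) ∞ lam) (p : X) :
    ContDiffOn ℝ ∞ (chartFun p lam) (extChartAt (𝓡∂ n) p).target :=
  (contDiffOn_comp_symm hl p).congr fun _ hy ↦ chartFun_of_mem hy

theorem measurable_chartFun {lam : X → ℝ} (hl : ContMDiff (𝓡∂ n) 𝓘(ℝ, ℝ) ∞ lam) (p : X) :
    Measurable (chartFun (n := n) p lam) := by
  classical
  have hm := (isRelOpen_target (n := n) p).measurableSet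
  have := (contDiffOn_comp_symm hl p).continuousOn.measurable_piecewise
    (continuousOn_const (c := (0 : ℝ))) hm
  convert this using 1
  exact (piecewise_eq_indicator (s := (extChartAt (𝓡∂ n) p).target)).symm

/-- A nonzero differential on the manifold is nonzero in the coordinates of a chart, where the
derivative is taken within the target of the chart. -/
theorem fderivWithin_comp_symm_ne_zero {lam : X → ℝ} (hl : ContMDiff (𝓡∂ n) 𝓘(ℝ, ℝ) ∞ lam) (p : X)
    {y : EuclideanSpace ℝ (Fin n)} (hy : y ∈ (extChartAt (𝓡∂ n) p).target)
    (hd : mfderiv (𝓡∂ n) 𝓘(ℝ, ℝ) lam ((extChartAt (𝓡∂ n) p).symm y) ≠ 0) :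
    fderivWithin ℝ (chartFun p lam) (extChartAt (𝓡∂ n) p).target y ≠ 0 := by
  intro h0
  apply hd
  have hsrc := (extChartAt (𝓡∂ n) p).map_target hy
  have h1 : HasFDerivWithinAt (chartFun p lam) (0 : EuclideanSpace ℝ (Fin n) →L[ℝ] ℝ)
      (extChartAt (𝓡∂ n) p).target (extChartAt (𝓡∂ n) p ((extChartAt (𝓡∂ n) p).symm y)) := by
    rw [(extChartAt (𝓡∂ n) p).right_inv hy, ← h0]
    exact (differentiableWithinAt_of_contDiffOn (contDiffOn_chartFun hl p) hy).hasFDerivWithinAt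
  have h2 := (mdifferentiableAt_extChartAt (I := 𝓡∂ n)
    (by rwa [← extChartAt_source (𝓡∂ n)])).hasMFDerivAt.hasMFDerivWithinAt
    (s := (extChartAt (𝓡∂ n) p).source)
  have h3 := h1.hasMFDerivWithinAt.comp _ h2 fun z hz ↦ (extChartAt (𝓡∂ n) p).map_source hz
  have h4 := h3.hasMFDerivAt ((isOpen_extChartAt_source (I := 𝓡∂ n) p).mem_nhds hsrc)
  have h5 := h4.congr_of_eventuallyEq (f₁ := lam) (by
    filter_upwards [(isOpen_extChartAt_source (I := 𝓡∂ n) p).mem_nhds hsrc] with z hz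
    rw [Function.comp_apply, chartFun_of_mem ((extChartAt (𝓡∂ n) p).map_source hz),
      (extChartAt (𝓡∂ n) p).left_inv hz])
  rw [h5.mfderiv]
  exact ContinuousLinearMap.zero_comp _

theorem IsDefiningFunction.nonneg {Y : Set X} {lam : X → ℝ} (hl : IsDefiningFunction n Y lam)
    (x : X) : 0 ≤ lam x := by
  by_cases hx : x ∈ Y
  · exact (hl.zero_on x hx).ge
  · exact (hl.pos_off x hx).le

theorem IsDefiningFunction.pos_iff {Y : Set X} {lam : X → ℝ} (hl : IsDefiningFunction n Y lam)
    {x : X} : 0 < lam x ↔ x ∉ Y :=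
  ⟨fun h hx ↦ h.ne' (hl.zero_on x hx), hl.pos_off x⟩

theorem IsDefiningFunction.eq_zero_iff {Y : Set X} {lam : X → ℝ} (hl : IsDefiningFunction n Y lam)
    {x : X} : lam x = 0 ↔ x ∈ Y :=
  ⟨fun h ↦ by_contra fun hx ↦ (hl.pos_off x hx).ne' h, hl.zero_on x⟩

/-- A union of boundary components contains, with each of its points, all nearby points of the
boundary. -/
theorem IsUnionOfBoundaryComponents.eventually_mem {Y : Set X}
    (hY : IsUnionOfBoundaryComponents n Y) (p : X) {y : EuclideanSpace ℝ (Fin n)}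
    (hy : y ∈ (extChartAt (𝓡∂ n) p).target) (hyY : (extChartAt (𝓡∂ n) p).symm y ∈ Y) :
    ∀ᶠ z in 𝓝[(extChartAt (𝓡∂ n) p).target] y, z 0 = 0 → (extChartAt (𝓡∂ n) p).symm z ∈ Y := by
  obtain ⟨O, hO, hOt⟩ := isRelOpen_target (n := n) p
  have hy0 : y 0 = 0 := (isBoundaryPoint_symm_iff p hy).1 (hY.1 hyY)
  obtain ⟨r, hr, hball⟩ := Metric.isOpen_iff.1 hO y (hOt ▸ hy).1
  -- the disc `D` in the boundary hyperplane is connected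
  set D : Set (EuclideanSpace ℝ (Fin n)) := Metric.ball y r ∩ {z | z 0 = 0} with hD
  have hDt : D ⊆ (extChartAt (𝓡∂ n) p).target := by
    rw [hOt]
    exact fun z hz ↦ ⟨hball hz.1, (hz.2 : z 0 = 0).ge⟩
  have hconv : Convex ℝ D := by
    refine (convex_ball y r).inter ?_
    intro a ha b hb s t _ _ _
    change (s • a + t • b) 0 = 0
    rw [PiLp.add_apply, PiLp.smul_apply, PiLp.smul_apply, (ha : a 0 = 0), (hb : b 0 = 0)]
    simp
  have hpre := hconv.isPreconnected.image _ ((continuousOn_extChartAt_symm (I := 𝓡∂ n) p).mono hDt)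
  have hsub := hpre.subset_connectedComponentIn (F := (𝓡∂ n).boundary X)
    (mem_image_of_mem _ ⟨Metric.mem_ball_self hr, hy0⟩) (by
      rintro _ ⟨z, hz, rfl⟩
      exact (isBoundaryPoint_symm_iff p (hDt hz)).2 hz.2)
  filter_upwards [mem_nhdsWithin_of_mem_nhds (Metric.ball_mem_nhds y hr)] with z hz hz0
  exact hY.2 _ hyY (hsub (mem_image_of_mem _ ⟨hz, hz0⟩))

theorem isBoundaryChart_chartFun {Y : Set X} (hY : IsUnionOfBoundaryComponents n Y) {lam : X → ℝ}
    (hl : IsDefiningFunction n Y lam) (p : X) :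
    IsBoundaryChart (extChartAt (𝓡∂ n) p).target (chartFun p lam) where
  relOpen := isRelOpen_target p
  measurable := measurable_chartFun hl.smooth p
  contDiffOn := contDiffOn_chartFun hl.smooth p
  nonneg y hy := by
    rw [chartFun_of_mem hy]
    exact hl.nonneg _
  of_zero y hy h0 := by
    have hyY : (extChartAt (𝓡∂ n) p).symm y ∈ Y := by
      rw [chartFun_of_mem hy] at h0
      exact hl.eq_zero_iff.1 h0
    refine ⟨normalDeriv_pos_of_isMin (isRelOpen_target p) (fun z hz ↦ ?_) hy h0
      ((isBoundaryPoint_symm_iff p hy).1 (hY.1 hyY))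
      (fderivWithin_comp_symm_ne_zero hl.smooth p hy (hl.deriv_ne_zero _ hyY)), ?_⟩
    · rw [chartFun_of_mem hz]
      exact hl.nonneg _
    · filter_upwards [hY.eventually_mem p hy hyY, self_mem_nhdsWithin] with z hz hzt hz0
      rw [chartFun_of_mem hzt, hl.zero_on _ (hz hz0)]

theorem setOf_pos_chartFun {Y : Set X} {lam : X → ℝ} (hl : IsDefiningFunction n Y lam) (p : X) :
    {y | 0 < chartFun p lam y} = chartImage (n := n) Yᶜ p := by
  ext y
  by_cases hy : y ∈ (extChartAt (𝓡∂ n) p).target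
  · simp only [mem_ofPred_eq, chartFun_of_mem hy, hl.pos_iff, chartImage, mem_inter_iff, hy,
      true_and, mem_preimage, mem_compl_iff]
  · simp only [mem_ofPred_eq, chartFun_of_notMem hy, lt_irrefl, chartImage, mem_inter_iff, hy,
      false_and]

theorem setOf_le_chartFun (lam : X → ℝ) (p : X) {ε : ℝ} (hε : 0 < ε) :
    {y | ε ≤ chartFun p lam y} = chartImage (n := n) {x | ε ≤ lam x} p := by
  ext y
  by_cases hy : y ∈ (extChartAt (𝓡∂ n) p).target
  · simp only [mem_ofPred_eq, chartFun_of_mem hy, chartImage, mem_inter_iff, hy,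
      true_and, mem_preimage]
  · simp only [mem_ofPred_eq, chartFun_of_notMem hy, hε.not_ge, chartImage, mem_inter_iff, hy,
      false_and]

end Charts

/-! ### Comparison of defining functions -/

section DefiningFunctions

variable {n : ℕ} [NeZero n]

/-- Every point of a relatively open set is approached from the interior of the half-space. -/
theorem IsRelOpen.tendsto_add_smul {V : Set (EuclideanSpace ℝ (Fin n))} (hV : IsRelOpen V)
    {y : EuclideanSpace ℝ (Fin n)} (hy : y ∈ V) :
    Tendsto (fun t : ℝ ↦ y + t • EuclideanSpace.single 0 1) (𝓝[>] 0) (𝓝[V ∩ {z | 0 < z 0}] y) := by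
  have h1 : Tendsto (fun t : ℝ ↦ y + t • (EuclideanSpace.single 0 1 : EuclideanSpace ℝ (Fin n)))
      (𝓝[>] 0) (𝓝 y) := by
    have : Tendsto (fun t : ℝ ↦ y + t • (EuclideanSpace.single 0 1 : EuclideanSpace ℝ (Fin n)))
      (𝓝 0) (𝓝 (y + (0 : ℝ) • EuclideanSpace.single 0 1)) := Continuous.tendsto (by fun_prop) _
    rw [zero_smul, add_zero] at this
    exact this.mono_left nhdsWithin_le_nhds
  refine tendsto_nhdsWithin_iff.2 ⟨h1, ?_⟩
  have hy0 := hV.nonneg hy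
  obtain ⟨O, hO, rfl⟩ := hV
  filter_upwards [h1.eventually (hO.mem_nhds hy.1), self_mem_nhdsWithin] with t ht (ht0 : 0 < t)
  have : 0 < (y + t • (EuclideanSpace.single 0 1 : EuclideanSpace ℝ (Fin n))) 0 := by
    simp only [PiLp.add_apply, PiLp.smul_apply, smul_eq_mul, PiLp.single_apply, if_true, mul_one]
    positivity
  exact ⟨⟨ht, this.le⟩, this⟩

variable {X : Type*} [TopologicalSpace X]
  [ChartedSpace (EuclideanHalfSpace n) X] [IsManifold (𝓡∂ n) ∞ X] {Y : Set X}
  {lam lam' : X → ℝ}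

theorem IsUnionOfBoundaryComponents.symm_notMem (hY : IsUnionOfBoundaryComponents n Y) {p : X}
    {y : EuclideanSpace ℝ (Fin n)} (hy : y ∈ (extChartAt (𝓡∂ n) p).target) (hy0 : 0 < y 0) :
    (extChartAt (𝓡∂ n) p).symm y ∉ Y := fun h ↦
  hy0.ne' ((isBoundaryPoint_symm_iff p hy).1 (hY.1 h))

theorem IsUnionOfBoundaryComponents.dense_compl (hY : IsUnionOfBoundaryComponents n Y) :
    Dense Yᶜ := by
  intro x
  have hx : extChartAt (𝓡∂ n) x x ∈ (extChartAt (𝓡∂ n) x).target := mem_extChartAt_target x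
  have h1 := (isRelOpen_target x).tendsto_add_smul hx
  have h2 := ((continuousOn_extChartAt_symm (I := 𝓡∂ n) x) _ hx).tendsto
  have h3 := h2.comp (h1.mono_right (nhdsWithin_mono _ inter_subset_left))
  rw [extChartAt_to_inv] at h3
  refine mem_closure_of_tendsto h3 ?_
  filter_upwards [(tendsto_nhdsWithin_iff.1 h1).2] with t ht
  exact hY.symm_notMem ht.1 ht.2

theorem IsDefiningFunction.isOpen_compl (hl : IsDefiningFunction n Y lam) : IsOpen Yᶜ := by
  have : Yᶜ = lam ⁻¹' Ioi 0 := by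
    ext x
    exact hl.pos_iff.symm
  rw [this]
  exact isOpen_Ioi.preimage hl.smooth.continuous

/-- In a half-ball around a point of `Y`, a defining function is the product of the first
coordinate and a positive smooth function. -/
theorem IsDefiningFunction.exists_factor (hY : IsUnionOfBoundaryComponents n Y)
    (hl : IsDefiningFunction n Y lam) {p : X} {c : EuclideanSpace ℝ (Fin n)} {r : ℝ} (hc : c 0 = 0)
    (hS : Metric.ball c r ∩ halfSpace n ⊆ (extChartAt (𝓡∂ n) p).target)
    (hSY : ∀ y ∈ Metric.ball c r ∩ halfSpace n, y 0 = 0 → (extChartAt (𝓡∂ n) p).symm y ∈ Y) :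
    ∃ a : EuclideanSpace ℝ (Fin n) → ℝ, ContDiffOn ℝ ∞ a (Metric.ball c r ∩ halfSpace n) ∧
      ∀ y ∈ Metric.ball c r ∩ halfSpace n,
        lam ((extChartAt (𝓡∂ n) p).symm y) = y 0 * a y ∧ 0 < a y := by
  have hrel : IsRelOpen (Metric.ball c r ∩ halfSpace n) := ⟨_, Metric.isOpen_ball, rfl⟩
  have hb := isBoundaryChart_chartFun hY hl p
  obtain ⟨a, ha, hf, h0⟩ := exists_eq_coord_mul hc (hb.contDiffOn.mono hS) fun y hy hy0 ↦ by
    rw [chartFun_of_mem (hS hy), hl.zero_on _ (hSY y hy hy0)]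
  refine ⟨a, ha, fun y hy ↦ ⟨by rw [← hf y hy, chartFun_of_mem (hS hy)], ?_⟩⟩
  rcases (hrel.nonneg hy).eq_or_lt with hy0 | hy0
  · have hz : chartFun p lam y = 0 := by rw [hf y hy, ← hy0, zero_mul]
    have := (hb.of_zero y (hS hy) hz).1
    rw [normalDeriv_of_mem (hS hy)] at this
    rwa [h0 y hy hy0.symm, normalDeriv_of_mem hy, fderivWithin_subset hS (hrel.uniqueDiffOn y hy)
      (differentiableWithinAt_of_contDiffOn hb.contDiffOn (hS hy))]
  · have := hl.pos_iff.2 (hY.symm_notMem (hS hy) hy0)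
    rw [← chartFun_of_mem (lam := lam) (hS hy), hf y hy] at this
    exact pos_of_mul_pos_right this hy0.le

/-- Two defining functions differ by the exponential of a smooth function. Off `Y` this function
is the logarithm of the quotient, which extends smoothly by Hadamard's lemma. -/
theorem IsDefiningFunction.exists_eq_mul_exp (hY : IsUnionOfBoundaryComponents n Y)
    (hl : IsDefiningFunction n Y lam) (hl' : IsDefiningFunction n Y lam') :
    ∃ φ : X → ℝ, ContMDiff (𝓡∂ n) 𝓘(ℝ, ℝ) ∞ φ ∧ ∀ x, lam' x = lam x * Real.exp (φ x) := by
  have hopen := hl.isOpen_compl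
  set f : X → ℝ := fun x ↦ Real.log (lam' x / lam x) with hf
  have hsm : ∀ x ∉ Y, ContMDiffAt (𝓡∂ n) 𝓘(ℝ, ℝ) ∞ f x := by
    intro x hx
    have h1 := (hl'.pos_off x hx).ne'
    have h2 := (hl.pos_off x hx).ne'
    have h3 : ContDiffAt ℝ ∞ (fun q : ℝ × ℝ ↦ Real.log (q.1 / q.2)) (lam' x, lam x) :=
      (contDiffAt_fst.div contDiffAt_snd h2).log (div_ne_zero h1 h2)
    exact h3.contMDiffAt.comp x ((hl'.smooth x).prodMk_space (hl.smooth x))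
  have hext : ∀ x ∉ Y, extendFrom Yᶜ f x = f x := fun x hx ↦
    extendFrom_eq (subset_closure hx) ((hsm x hx).continuousAt.continuousWithinAt)
  refine ⟨extendFrom Yᶜ f, fun x ↦ ?_, fun x ↦ ?_⟩
  · by_cases hx : x ∈ Y
    · have hct : extChartAt (𝓡∂ n) x x ∈ (extChartAt (𝓡∂ n) x).target := mem_extChartAt_target x
      set c := extChartAt (𝓡∂ n) x x with hcdef
      have hcx : (extChartAt (𝓡∂ n) x).symm c = x := extChartAt_to_inv x
      have hc0 : c 0 = 0 := (isBoundaryPoint_symm_iff x hct).1 (hcx.symm ▸ hY.1 hx)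
      have hnear := hY.eventually_mem x hct (hcx.symm ▸ hx)
      obtain ⟨r, hr, hball⟩ : ∃ r > 0, ∀ y ∈ Metric.ball c r ∩ halfSpace n,
          y ∈ (extChartAt (𝓡∂ n) x).target ∧ (y 0 = 0 → (extChartAt (𝓡∂ n) x).symm y ∈ Y) := by
        have h2 : ∀ᶠ y in 𝓝[halfSpace n] c, y ∈ (extChartAt (𝓡∂ n) x).target :=
          (isRelOpen_target x).mem_nhdsWithin hct
        rw [(isRelOpen_target x).nhdsWithin_eq hct] at hnear
        obtain ⟨r, hr, hsub⟩ := Metric.mem_nhdsWithin_iff.1 (h2.and hnear)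
        exact ⟨r, hr, fun y hy ↦ hsub hy⟩
      obtain ⟨a, ha, haf⟩ := hl.exists_factor hY (p := x) hc0 (fun y hy ↦ (hball y hy).1)
        fun y hy ↦ (hball y hy).2
      obtain ⟨a', ha', haf'⟩ := hl'.exists_factor hY (p := x) hc0 (fun y hy ↦ (hball y hy).1)
        fun y hy ↦ (hball y hy).2
      set S := Metric.ball c r ∩ halfSpace n with hS
      have hψ : ContDiffOn ℝ ∞ (fun y ↦ Real.log (a' y / a y)) S :=
        (ha'.div ha fun y hy ↦ (haf y hy).2.ne').log
          fun y hy ↦ (div_pos (haf' y hy).2 (haf y hy).2).ne'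
      have hcS : c ∈ S := ⟨Metric.mem_ball_self hr, hc0.ge⟩
      -- the chart domain of the half-ball
      set N := (extChartAt (𝓡∂ n) x).source ∩ extChartAt (𝓡∂ n) x ⁻¹' S with hN
      have hNopen : IsOpen N := by
        have : N = (extChartAt (𝓡∂ n) x).source ∩ extChartAt (𝓡∂ n) x ⁻¹' Metric.ball c r := by
          ext z
          refine ⟨fun hz ↦ ⟨hz.1, hz.2.1⟩, fun hz ↦ ⟨hz.1, hz.2, ?_⟩⟩
          exact (isRelOpen_target x).nonneg ((extChartAt (𝓡∂ n) x).map_source hz.1)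
        rw [this]
        exact (continuousOn_extChartAt x).isOpen_inter_preimage (isOpen_extChartAt_source x)
          Metric.isOpen_ball
      have hxN : x ∈ N := ⟨mem_extChartAt_source x, hcS⟩
      have hcomp : ContMDiffOn (𝓡∂ n) 𝓘(ℝ, ℝ) ∞
          ((fun y ↦ Real.log (a' y / a y)) ∘ extChartAt (𝓡∂ n) x) N :=
        (contMDiffOn_iff_contDiffOn.2 hψ).comp
          (contMDiffOn_extChartAt.mono fun z hz ↦ by
            rw [← extChartAt_source (𝓡∂ n)]; exact hz.1) fun z hz ↦ hz.2
      refine ((hcomp x hxN).contMDiffAt (hNopen.mem_nhds hxN)).congr_of_eventuallyEq ?_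
      filter_upwards [hNopen.mem_nhds hxN] with z hz
      refine extendFrom_eq (hY.dense_compl z) ?_
      have hcont := ((hcomp.continuousOn z hz).continuousAt (hNopen.mem_nhds hz)).continuousWithinAt
        (s := Yᶜ)
      refine hcont.tendsto.congr' ?_
      filter_upwards [self_mem_nhdsWithin, mem_nhdsWithin_of_mem_nhds (hNopen.mem_nhds hz)]
        with q hqY hq
      have e1 := (haf _ hq.2).1
      have e2 := (haf' _ hq.2).1
      rw [(extChartAt (𝓡∂ n) x).left_inv hq.1] at e1 e2
      have hq0 : extChartAt (𝓡∂ n) x q 0 ≠ 0 := fun h0 ↦ by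
        rw [h0, zero_mul] at e1
        exact (hl.pos_off q hqY).ne' e1
      rw [hf, Function.comp_apply]
      beta_reduce
      rw [e1, e2, mul_div_mul_left _ _ hq0]
    · refine (hsm x hx).congr_of_eventuallyEq ?_
      filter_upwards [hopen.mem_nhds hx] with z hz using hext z hz
  · by_cases hx : x ∈ Y
    · rw [hl.zero_on x hx, hl'.zero_on x hx, zero_mul]
    · rw [hext x hx, hf]
      beta_reduce
      rw [Real.exp_log (div_pos (hl'.pos_off x hx) (hl.pos_off x hx)),
        mul_div_cancel₀ _ (hl.pos_off x hx).ne']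

theorem IsDefiningFunction.mul_exp (hl : IsDefiningFunction n Y lam) {φ : X → ℝ}
    (hφ : ContMDiff (𝓡∂ n) 𝓘(ℝ, ℝ) ∞ φ) :
    IsDefiningFunction n Y fun x ↦ lam x * Real.exp (φ x) where
  smooth := hl.smooth.mul (Real.contDiff_exp.contMDiff.comp hφ)
  zero_on x hx := by rw [hl.zero_on x hx, zero_mul]
  pos_off x hx := mul_pos (hl.pos_off x hx) (Real.exp_pos _)
  deriv_ne_zero x hx := by
    have h1 := (hl.smooth.mdifferentiable (by simp) x).hasMFDerivAt
    have h2 := ((Real.contDiff_exp.contMDiff.comp hφ).mdifferentiable (by simp) x).hasMFDerivAt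
    have h3 := h1.mul h2
    intro h0
    apply hl.deriv_ne_zero x hx
    have h4 := h3.mfderiv.symm.trans h0
    have h5 : ∀ (A B : EuclideanSpace ℝ (Fin n) →L[ℝ] ℝ) (u t : ℝ), u = 0 → t ≠ 0 →
        u • A + t • B = 0 → B = 0 := fun A B u t hu ht h ↦ by
      rw [hu, zero_smul, zero_add] at h
      exact (smul_eq_zero.1 h).resolve_left ht
    exact h5 _ _ _ _ (hl.zero_on x hx) (Real.exp_pos _).ne' h4

end DefiningFunctions

/-! ### Forms with poles in charts -/

section Forms

variable {n : ℕ} [NeZero n] {X : Type*} [TopologicalSpace X]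
  [ChartedSpace (EuclideanHalfSpace n) X] [IsManifold (𝓡∂ n) ∞ X] {Y : Set X}
  {lam lam' : X → ℝ} {w η : TopForm n X} {M : ℕ}

theorem IsSmoothForm.smul {f : X → ℝ} (hf : ContMDiff (𝓡∂ n) 𝓘(ℝ, ℝ) ∞ f)
    (hη : IsSmoothForm η) : IsSmoothForm (mulForm f η) := fun p ↦ by
  exact ((contDiffOn_comp_symm hf p).smul (hη p)).congr fun y _ ↦ rfl

/-- The notion of a pole of order `M` does not depend on the defining function. -/
theorem HasPoleOfOrder.exists_smooth (h : HasPoleOfOrder Y M w)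
    (hY : IsUnionOfBoundaryComponents n Y) (hl : IsDefiningFunction n Y lam) :
    ∃ η : TopForm n X, IsSmoothForm η ∧ ∀ x ∉ Y, η x = (lam x) ^ M • w x := by
  obtain ⟨lam₀, hl₀, η, hη, hw⟩ := h
  obtain ⟨φ, hφ, hlφ⟩ := hl₀.exists_eq_mul_exp hY hl
  refine ⟨_, hη.smul (f := fun x ↦ Real.exp (φ x) ^ M)
    ((Real.contDiff_exp.contMDiff.comp hφ).pow M), fun x hx ↦ ?_⟩
  rw [mulForm, hw x hx, hlφ, mul_pow, smul_smul, mul_comm]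

theorem HasPoleOfOrder.mono {N : ℕ} (h : HasPoleOfOrder Y M w) (hMN : M ≤ N) :
    HasPoleOfOrder Y N w := by
  obtain ⟨lam₀, hl₀, η, hη, hw⟩ := h
  refine ⟨lam₀, hl₀, _, hη.smul (f := fun x ↦ lam₀ x ^ (N - M)) (hl₀.smooth.pow _),
    fun x hx ↦ ?_⟩
  rw [mulForm, hw x hx, smul_smul, ← pow_add, Nat.sub_add_cancel hMN]

theorem HasPoleOfOrder.mulForm (h : HasPoleOfOrder Y M w) {φ : X → ℝ}
    (hφ : ContMDiff (𝓡∂ n) 𝓘(ℝ, ℝ) ∞ φ) : HasPoleOfOrder Y M (mulForm φ w) := by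
  obtain ⟨lam₀, hl₀, η, hη, hw⟩ := h
  refine ⟨lam₀, hl₀, _, hη.smul hφ, fun x hx ↦ ?_⟩
  rw [BoundaryZeta.mulForm, BoundaryZeta.mulForm, hw x hx, smul_comm]

theorem HasCompactSupportIn.mulForm (h : HasCompactSupportIn Y w) (φ : X → ℝ) :
    HasCompactSupportIn Y (mulForm φ w) :=
  h.of_isClosed_subset isClosed_closure (closure_mono fun x hx ↦ ⟨hx.1, fun h0 ↦ hx.2 (by
    rw [BoundaryZeta.mulForm, h0]
    exact ContinuousAlternatingMap.ext fun v ↦ smul_zero (φ x))⟩)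

/-- A smooth form that vanishes off `Y` outside of the closed set `K` vanishes outside of `K` at
points of `Y` as well, since these are limits of points off `Y`. -/
theorem coeff_eq_zero (hY : IsUnionOfBoundaryComponents n Y) (hη : IsSmoothForm η) {K : Set X}
    (hK : IsClosed K) (hηK : ∀ x ∉ Y, x ∉ K → η x = 0) {p : X} {y : EuclideanSpace ℝ (Fin n)}
    (hy : y ∈ (extChartAt (𝓡∂ n) p).target) (hyK : (extChartAt (𝓡∂ n) p).symm y ∉ K) :
    coeff p η y = 0 := by
  have h1 := (isRelOpen_target p).tendsto_add_smul hy
  have h1' := h1.mono_right (nhdsWithin_mono _ inter_subset_left)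
  have h2 := ((continuousOn_extChartAt_symm (I := 𝓡∂ n) p) _ hy).tendsto.comp h1'
  have h3 := (((hη p).continuousOn _ hy).tendsto).comp h1'
  refine tendsto_nhds_unique h3 (tendsto_const_nhds.congr' ?_)
  filter_upwards [(tendsto_nhdsWithin_iff.1 h1).2, h2.eventually (hK.isOpen_compl.mem_nhds hyK)]
    with t ht htK
  rw [Function.comp_apply, coeff, hηK _ (hY.symm_notMem ht.1 ht.2) htK]
  rfl

variable [T2Space X] [SigmaCompactSpace X] {o : ManifoldOrientation n X}

theorem contDiffOn_orientationSign (o : ManifoldOrientation n X) (p : X) :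
    ContDiffOn ℝ ∞ (fun y ↦ ((orientationSign o.at_pt p y : ℝ) : ℂ))
      (extChartAt (𝓡∂ n) p).target := by
  intro y hy
  have h := (o.continuousOn_sign p y hy).tendsto
  rw [nhds_discrete, tendsto_pure] at h
  refine (contDiffWithinAt_const
    (c := ((orientationSign o.at_pt p y : ℝ) : ℂ))).congr_of_eventuallyEq ?_ rfl
  filter_upwards [h] with z hz
  rw [hz]

/-- The density of a form in the coordinates of the chart centred at `p`, zero off the chart. -/
def chartDensity (o : ManifoldOrientation n X) (η : TopForm n X) (p : X) :
    EuclideanSpace ℝ (Fin n) → ℂ :=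
  (extChartAt (𝓡∂ n) p).target.indicator (localDensity o η p)

theorem chartDensity_of_mem {p : X} {y : EuclideanSpace ℝ (Fin n)}
    (hy : y ∈ (extChartAt (𝓡∂ n) p).target) : chartDensity o η p y = localDensity o η p y :=
  indicator_of_mem hy _

theorem isTest_chartDensity (hY : IsUnionOfBoundaryComponents n Y) (hη : IsSmoothForm η) {K : Set X}
    (hK : IsCompact K) (hηK : ∀ x ∉ Y, x ∉ K → η x = 0) (o : ManifoldOrientation n X) (p : X) :
    IsTest (extChartAt (𝓡∂ n) p).target (chartDensity o η p) where
  contDiffOn := by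
    have h1 := contDiffOn_ofReal (contDiffOn_comp_symm (chartPartition n X p).contMDiff p)
    exact (((contDiffOn_orientationSign o p).mul h1).mul (hη p)).congr
      fun y hy ↦ chartDensity_of_mem hy
  exists_compact := by
    have hsub : K ∩ tsupport (chartPartition n X p) ⊆ (extChartAt (𝓡∂ n) p).source := by
      rw [extChartAt_source]
      exact inter_subset_right.trans (chartPartition_isSubordinate p)
    refine ⟨extChartAt (𝓡∂ n) p '' (K ∩ tsupport (chartPartition n X p)), ?_,
      (hK.inter_right (isClosed_tsupport _)).image_of_continuousOn
        ((continuousOn_extChartAt p).mono hsub), fun y hy ↦ ?_⟩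
    · rintro _ ⟨x, hx, rfl⟩
      exact (extChartAt (𝓡∂ n) p).map_source (hsub hx)
    · by_cases hyt : y ∈ (extChartAt (𝓡∂ n) p).target
      · rw [chartDensity_of_mem hyt, localDensity]
        by_cases hyK : (extChartAt (𝓡∂ n) p).symm y ∈ K
        · have : (extChartAt (𝓡∂ n) p).symm y ∉ tsupport (chartPartition n X p) := fun h ↦
            hy ⟨_, ⟨hyK, h⟩, (extChartAt (𝓡∂ n) p).right_inv hyt⟩
          rw [image_eq_zero_of_notMem_tsupport this]
          simp
        · rw [coeff_eq_zero hY hη hK.isClosed hηK hyt hyK, mul_zero]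
      · exact indicator_of_notMem hyt _

theorem localDensity_congr_smul {u : TopForm n X} {c : ℂ} {p : X} {y : EuclideanSpace ℝ (Fin n)}
    (h : u ((extChartAt (𝓡∂ n) p).symm y) = c • η ((extChartAt (𝓡∂ n) p).symm y)) :
    localDensity o u p y = c * localDensity o η p y := by
  simp only [localDensity, coeff, h, ContinuousAlternatingMap.smul_apply, smul_eq_mul]
  ring

/-- A form `lam ^ s w` with a pole in terms of the smooth form `lam ^ M w`. -/
theorem powForm_eq_smul {x : X} (hx : 0 < lam x) (hw : η x = (lam x) ^ M • w x) (s : ℂ) :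
    powForm lam s w x = (lam x : ℂ) ^ (s - M) • η x := by
  have h0 : (lam x : ℂ) ≠ 0 := by exact_mod_cast hx.ne'
  ext v
  rw [hw]
  change (lam x : ℂ) ^ s * w x v = (lam x : ℂ) ^ (s - M) * (lam x ^ M • w x v)
  rw [Complex.cpow_sub _ _ h0, Complex.cpow_natCast, Complex.real_smul, ← mul_assoc]
  push_cast
  rw [div_mul_cancel₀ _ (pow_ne_zero _ h0)]

theorem powForm_zero (lam : X → ℝ) (w : TopForm n X) : powForm lam 0 w = w := by
  funext x
  rw [powForm, Complex.cpow_zero, one_smul]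

variable (n) in
theorem finite_chartPartition_inter {K : Set X} (hK : IsCompact K) :
    {p : X | (Function.support (chartPartition n X p) ∩ K).Nonempty}.Finite :=
  (chartPartition n X).locallyFinite.finite_nonempty_inter_compact hK

theorem formIntegral_eq_sum {K S : Set X} (hK : IsCompact K) {u : TopForm n X}
    (hu : ∀ x ∈ S, x ∉ K → u x = 0) :
    formIntegral o S u = ∑ p ∈ (finite_chartPartition_inter n hK).toFinset,
      ∫ y in chartImage S p, localDensity o u p y := by
  refine finsum_eq_sum_of_support_subset _ fun p hp ↦ ?_
  rw [Finset.mem_coe, Set.Finite.mem_toFinset]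
  by_contra h
  refine hp (setIntegral_eq_zero_of_forall_eq_zero fun y hy ↦ ?_)
  rw [localDensity, coeff]
  by_cases hyK : (extChartAt (𝓡∂ n) p).symm y ∈ K
  · have : chartPartition n X p ((extChartAt (𝓡∂ n) p).symm y) = 0 := by
      by_contra h0
      exact h ⟨_, h0, hyK⟩
    rw [this]
    simp
  · rw [hu _ hy.2 hyK]
    exact mul_zero _

theorem measurableSet_chartImage_compl (hY : IsUnionOfBoundaryComponents n Y)
    (hl : IsDefiningFunction n Y lam) (p : X) : MeasurableSet (chartImage (n := n) Yᶜ p) := by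
  rw [← setOf_pos_chartFun hl p]
  exact (isBoundaryChart_chartFun hY hl p).measurableSet_pos

/-- The density of `lam ^ s w` in a chart. -/
theorem localDensity_powForm (hl : IsDefiningFunction n Y lam)
    (hw : ∀ x ∉ Y, η x = (lam x) ^ M • w x) (s : ℂ) {p : X} {y : EuclideanSpace ℝ (Fin n)}
    (hy : y ∈ chartImage Yᶜ p) :
    localDensity o (powForm lam s w) p y =
      (chartFun p lam y : ℂ) ^ (s - M) * chartDensity o η p y := by
  rw [chartDensity_of_mem hy.1, chartFun_of_mem hy.1]
  exact localDensity_congr_smul (powForm_eq_smul (hl.pos_off _ hy.2) (hw _ hy.2) s)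

end Forms

/-! ### The zeta function of a form -/

theorem HasTaylorExpansion.integrableOn_cpow_mul {G : ℝ → ℂ} {a : ℕ → ℂ}
    (h : HasTaylorExpansion G a) {ε : ℝ} (hε : 0 < ε) (σ : ℂ) :
    IntegrableOn (fun v : ℝ ↦ (v : ℂ) ^ σ * G v) (Ioi ε) := by
  obtain ⟨R, hR⟩ := h.eventually_zero
  have hsub : Icc ε R ⊆ Ioi 0 := fun v hv ↦ hε.trans_le hv.1
  have h1 : IntegrableOn (fun v : ℝ ↦ (v : ℂ) ^ σ * G v) (Icc ε R) := by
    refine IntegrableOn.continuousOn_mul ?_ ?_ isCompact_Icc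
    · exact fun v hv ↦ (Complex.continuousAt_ofReal_cpow_const v σ
        (Or.inr (hsub hv).ne')).continuousWithinAt
    · exact h.locallyIntegrableOn.integrableOn_compact_subset hsub isCompact_Icc
  refine IntegrableOn.of_forall_sdiff_eq_zero h1 measurableSet_Ioi fun v hv ↦ ?_
  have : R < v := by
    by_contra hle
    exact hv.2 ⟨(hv.1 : ε < v).le, not_lt.1 hle⟩
  rw [hR v this, mul_zero]

/-- The residue at a simple pole as a limit. -/
theorem HasSimplePoleWithResidue.tendsto_mul {f : ℂ → ℂ} {a r : ℂ}
    (h : HasSimplePoleWithResidue f a r) : Tendsto (fun z ↦ (z - a) * f z) (𝓝[≠] a) (𝓝 r) := by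
  obtain ⟨g, hg, hfg⟩ := h
  have h1 : Tendsto (fun z ↦ r + (z - a) * g z) (𝓝[≠] a) (𝓝 (r + (a - a) * g a)) :=
    ((continuousAt_const.add ((continuousAt_id.sub continuousAt_const).mul
      hg.continuousAt)).tendsto).mono_left nhdsWithin_le_nhds
  rw [sub_self, zero_mul, add_zero] at h1
  refine h1.congr' ?_
  filter_upwards [hfg, self_mem_nhdsWithin] with z hz hza
  have : z - a ≠ 0 := sub_ne_zero.2 hza
  rw [hz]
  field_simp

theorem ne_sub_natCast_of_re {M : ℕ} {s : ℂ} (hs : (M : ℝ) - 1 < s.re) (j : ℕ) : s ≠ (M : ℂ) - 1 - j := by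
  rintro rfl
  have : (0 : ℝ) ≤ j := j.cast_nonneg
  simp at hs
  linarith

section Zeta

variable {n : ℕ} [NeZero n] {X : Type*} [TopologicalSpace X]
  [ChartedSpace (EuclideanHalfSpace n) X] [IsManifold (𝓡∂ n) ∞ X] {Y : Set X}
  {lam : X → ℝ} {w : TopForm n X} {M : ℕ} [T2Space X] [SigmaCompactSpace X]
  {o : ManifoldOrientation n X}

/-- The push-forward of the smooth form `lam ^ M w` under `lam`, summed over the charts that meet the
support: up to an entire function `A`, which comes from the region where `lam` is bounded below,
both kinds of integrals are integrals of powers of `v` times one function `G` with a Taylor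
expansion. -/
theorem exists_expansion (o : ManifoldOrientation n X) (hY : IsUnionOfBoundaryComponents n Y)
    (hl : IsDefiningFunction n Y lam) (hp : HasPoleOfOrder Y M w) (hc : HasCompactSupportIn Y w) :
    ∃ (G : ℝ → ℂ) (a : ℕ → ℂ) (A : ℂ → ℂ) (δ : ℝ), HasTaylorExpansion G a ∧ Differentiable ℂ A ∧
      0 < δ ∧
      (∀ s : ℂ, (M : ℝ) - 1 < s.re → FormIntegrableOn o Yᶜ (powForm lam s w) ∧
        formIntegral o Yᶜ (powForm lam s w) = mellin G (s - M + 1) + A (s - M)) ∧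
      (∀ ε : ℝ, 0 < ε → FormIntegrableOn o {x | ε ≤ lam x} w) ∧
      ∀ ε : ℝ, 0 < ε → ε < δ → formIntegral o {x | ε ≤ lam x} w =
        (∫ v in Ioi ε, (v : ℂ) ^ (-(M : ℂ)) * G v) + A (-M) := by
  obtain ⟨η, hη, hw⟩ := hp.exists_smooth hY hl
  set K : Set X := closure {x : X | x ∉ Y ∧ w x ≠ 0} with hK
  have hwK : ∀ x ∉ Y, x ∉ K → w x = 0 := fun x hx hxK ↦ by
    by_contra h0
    exact hxK (subset_closure ⟨hx, h0⟩)
  have hηK : ∀ x ∉ Y, x ∉ K → η x = 0 := fun x hx hxK ↦ by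
    rw [hw x hx, hwK x hx hxK]
    exact ContinuousAlternatingMap.ext fun v ↦ smul_zero (lam x ^ M)
  have htest := fun p ↦ isTest_chartDensity hY hη hc hηK o p
  have hchart := fun p ↦ isBoundaryChart_chartFun hY hl p
  choose G a A δ hG hA hδ hpos hcut using fun p ↦ (hchart p).exists_density (htest p)
  set T := (finite_chartPartition_inter n hc).toFinset with hT
  -- the densities of the form in the charts
  have e1 : ∀ s p, EqOn (localDensity o (powForm lam s w) p)
      (fun y ↦ (chartFun p lam y : ℂ) ^ (s - M) * chartDensity o η p y) (chartImage Yᶜ p) :=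
    fun s p y hy ↦ localDensity_powForm hl hw s hy
  have hsub : ∀ ε : ℝ, 0 < ε → {x | ε ≤ lam x} ⊆ Yᶜ := fun ε hε x (hx : ε ≤ lam x) ↦
    hl.pos_iff.1 (hε.trans_le hx)
  have e2 : ∀ ε : ℝ, 0 < ε → ∀ p, EqOn (localDensity o w p)
      (fun y ↦ (chartFun p lam y : ℂ) ^ (-(M : ℂ)) * chartDensity o η p y)
      (chartImage {x | ε ≤ lam x} p) := fun ε hε p y hy ↦ by
    have := e1 0 p ⟨hy.1, hsub ε hε hy.2⟩
    rwa [powForm_zero, zero_sub] at this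
  have m1 := fun p ↦ measurableSet_chartImage_compl hY hl p
  have m2 : ∀ ε : ℝ, 0 < ε → ∀ p : X, MeasurableSet (chartImage (n := n) {x | ε ≤ lam x} p) := by
    intro ε hε p
    rw [← setOf_le_chartFun lam p hε]
    exact measurableSet_superlevel (hchart p).measurable ε
  obtain ⟨δ₀, hδ₀, hδ₀le⟩ : ∃ δ₀ : ℝ, 0 < δ₀ ∧ ∀ p ∈ T, δ₀ ≤ δ p := by
    rcases T.eq_empty_or_nonempty with h | h
    · exact ⟨1, one_pos, by simp [h]⟩
    · exact ⟨T.inf' h δ, (Finset.lt_inf'_iff h).2 fun p _ ↦ hδ p,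
        fun p hp ↦ Finset.inf'_le _ hp⟩
  refine ⟨fun v ↦ ∑ p ∈ T, G p v, fun j ↦ ∑ p ∈ T, a p j, fun σ ↦ ∑ p ∈ T, A p σ, δ₀,
    HasTaylorExpansion.sum T fun p _ ↦ hG p, Differentiable.fun_sum fun p _ ↦ hA p, hδ₀,
    fun s hs ↦ ⟨fun p ↦ ?_, ?_⟩, fun ε hε p ↦ ?_, fun ε hε hεδ ↦ ?_⟩
  · rw [integrableOn_congr_fun (e1 s p) (m1 p), ← setOf_pos_chartFun hl p]
    exact (hpos p (s - M) (by simp; linarith)).1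
  · rw [formIntegral_eq_sum hc (u := powForm lam s w) fun x hx hxK ↦ by
      rw [powForm, hwK x hx hxK]
      exact ContinuousAlternatingMap.ext fun v ↦ smul_zero ((lam x : ℂ) ^ s)]
    have hre : -1 < (s - M).re := by simp; linarith
    have hm : mellin (fun v ↦ ∑ p ∈ T, G p v) (s - M + 1) = ∑ p ∈ T, mellin (G p) (s - M + 1) := by
      simp only [mellin, Finset.smul_sum]
      refine integral_finsetSum _ fun p _ ↦ ?_
      have := (hG p).mellinConvergent_tail 0 (s := s - M + 1) (by
        rw [Complex.add_re, Complex.one_re]; push_cast; linarith)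
      rwa [taylorTail_zero] at this
    rw [hm, ← Finset.sum_add_distrib]
    refine Finset.sum_congr rfl fun p _ ↦ ?_
    rw [setIntegral_congr_fun (m1 p) (e1 s p), ← setOf_pos_chartFun hl p, (hpos p _ hre).2]
  · rw [integrableOn_congr_fun (e2 ε hε p) (m2 ε hε p), ← setOf_le_chartFun lam p hε]
    exact (hchart p).integrableOn_superlevel (htest p) _ hε
  · rw [formIntegral_eq_sum hc (u := w) fun x hx hxK ↦ hwK x (hsub ε hε hx) hxK]
    simp only [Finset.mul_sum]
    rw [integral_finsetSum _ fun p _ ↦ (hG p).integrableOn_cpow_mul hε _, ← Finset.sum_add_distrib]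
    refine Finset.sum_congr rfl fun p hp ↦ ?_
    rw [setIntegral_congr_fun (m2 ε hε p) (e2 ε hε p), ← setOf_le_chartFun lam p hε,
      hcut p ε hε (hεδ.trans_le (hδ₀le p hp))]

/-- The function `z` continues the integrals of `lam ^ s w`, where `w` has a pole of order `M`; the
integrals of `w` over `{lam ≥ ε}` have the singular coefficients `c k` at `ε ^ (-k)` for `k ≥ 1` and
`c 0` at `log (1 / ε)`, and the finite part `F`; and these are read off from the poles of `z`. -/
structure IsZeta (o : ManifoldOrientation n X) (Y : Set X) (M : ℕ) (lam : X → ℝ) (w : TopForm n X)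
    (z : ℂ → ℂ) (c : ℕ → ℂ) (F : ℂ) : Prop where
  integrable : ∀ s : ℂ, (M : ℝ) - 1 < s.re → FormIntegrableOn o Yᶜ (powForm lam s w)
  eq_formIntegral : ∀ s : ℂ, (M : ℝ) - 1 < s.re → z s = formIntegral o Yᶜ (powForm lam s w)
  analyticAt : ∀ s : ℂ, (∀ j : ℕ, s ≠ (M : ℂ) - 1 - j) → AnalyticAt ℂ z s
  pole : ∀ j : ℕ, ∃ r : ℂ, HasSimplePoleWithResidue z ((M : ℂ) - 1 - j) r
  integrable_cutoff : ∀ ε : ℝ, 0 < ε → FormIntegrableOn o {x | ε ≤ lam x} w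
  cutoff : (fun ε : ℝ ↦ formIntegral o {x | ε ≤ lam x} w -
      (∑ k ∈ Finset.Icc 1 (M - 1), c k * (((ε ^ k)⁻¹ : ℝ) : ℂ) +
        c 0 * ((Real.log (1 / ε) : ℝ) : ℂ) + F)) =O[𝓝[>] (0 : ℝ)] (fun ε : ℝ ↦ ε)
  residue : ∀ k ∈ Finset.Icc 1 (M - 1), HasSimplePoleWithResidue z (k : ℂ) (k * c k)
  residue_zero : HasSimplePoleWithResidue z 0 (c 0)
  finite_part : Tendsto (fun s : ℂ ↦ z s - c 0 / s) (𝓝[≠] 0) (𝓝 F)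
  eq_zero : ∀ k, M ≤ k → c k = 0

namespace IsZeta

variable {z : ℂ → ℂ} {c : ℕ → ℂ} {F : ℂ}

theorem meromorphicAt (h : IsZeta o Y M lam w z c F) (s : ℂ) : MeromorphicAt z s := by
  by_cases hs : ∀ j : ℕ, s ≠ (M : ℂ) - 1 - j
  · exact (h.analyticAt s hs).meromorphicAt
  · push Not at hs
    obtain ⟨j, rfl⟩ := hs
    obtain ⟨r, hr⟩ := h.pole j
    exact hr.meromorphicAt

theorem differentiableOn (h : IsZeta o Y M lam w z c F) :
    DifferentiableOn ℂ (fun s ↦ formIntegral o Yᶜ (powForm lam s w))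
      {s : ℂ | (M : ℝ) - 1 < s.re} := fun s hs ↦
  ((h.analyticAt s (ne_sub_natCast_of_re hs)).differentiableAt.differentiableWithinAt).congr
    (fun t ht ↦ (h.eq_formIntegral t ht).symm) (h.eq_formIntegral s hs).symm

/-- The order of the pole may be overestimated. -/
theorem mono (h : IsZeta o Y M lam w z c F) {N : ℕ} (hMN : M ≤ N) :
    IsZeta o Y N lam w z c F := by
  have hMN' : (M : ℝ) ≤ N := by exact_mod_cast hMN
  refine ⟨fun s hs ↦ h.integrable s (by linarith), fun s hs ↦ h.eq_formIntegral s (by linarith),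
    fun s hs ↦ h.analyticAt s fun j hj ↦ hs (j + (N - M)) ?_, fun j ↦ ?_, h.integrable_cutoff, ?_,
    fun k hk ↦ ?_, h.residue_zero, h.finite_part, fun k hk ↦ h.eq_zero k (hMN.trans hk)⟩
  · rw [hj]
    push_cast [Nat.cast_sub hMN]
    ring
  · rcases le_or_gt (N - M) j with hj | hj
    · obtain ⟨r, hr⟩ := h.pole (j - (N - M))
      refine ⟨r, ?_⟩
      convert hr using 1
      push_cast [Nat.cast_sub hMN, Nat.cast_sub hj]
      ring
    · refine ⟨0, .of_analyticAt (h.analyticAt _ (ne_sub_natCast_of_re ?_))⟩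
      have h1 : j + 1 + M ≤ N := by omega
      have h2 : (j : ℝ) + 1 + M ≤ N := by exact_mod_cast h1
      simp
      linarith
  · refine h.cutoff.congr_left fun ε ↦ ?_
    congr 3
    refine Finset.sum_subset (Finset.Icc_subset_Icc_right (by omega)) fun k hk hk' ↦ ?_
    rw [Finset.mem_Icc] at hk hk'
    rw [h.eq_zero k (by omega), zero_mul]
  · rcases lt_or_ge k M with hkM | hkM
    · rw [Finset.mem_Icc] at hk
      exact h.residue k (Finset.mem_Icc.2 ⟨hk.1, by omega⟩)
    · rw [h.eq_zero k hkM, mul_zero]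
      refine .of_analyticAt (h.analyticAt _ (ne_sub_natCast_of_re ?_))
      have : (M : ℝ) ≤ k := by exact_mod_cast hkM
      simp
      linarith

end IsZeta

/-- With `G` of Taylor coefficients `a j`, the zeta function is the continued Mellin transform of `G`
at `s - M + 1` plus an entire function, so that its residue at `M - 1 - j` is `a j`. -/
theorem exists_isZeta (o : ManifoldOrientation n X) (hY : IsUnionOfBoundaryComponents n Y)
    (hl : IsDefiningFunction n Y lam) (hp : HasPoleOfOrder Y M w) (hc : HasCompactSupportIn Y w) :
    ∃ z c F, IsZeta o Y M lam w z c F := by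
  obtain ⟨G, a, A, δ, hG, hA, hδ, hpos, hint, hcut⟩ := exists_expansion o hY hl hp hc
  have hAa : ∀ s : ℂ, AnalyticAt ℂ (fun s ↦ A (s - M)) s := fun s ↦
    (hA.analyticAt _).comp (by fun_prop)
  set z : ℂ → ℂ := fun s ↦ mellinContinuation G a (s + (1 - M)) + A (s - M) with hz
  -- the singular coefficients; the logarithm goes with the index `0`, where there is no factor `k`
  set c : ℕ → ℂ := fun k ↦ if k < M then a (M - 1 - k) / (if k = 0 then 1 else (k : ℂ)) else 0
    with hcdef
  set F : ℂ := mellin (taylorTail G a M) (1 - M) -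
    ∑ k ∈ Finset.Icc 1 (M - 1), a (M - 1 - k) / k + A (-M) with hF
  have hpole : ∀ j : ℕ, HasSimplePoleWithResidue z ((M : ℂ) - 1 - j) (a j) := fun j ↦ by
    refine HasSimplePoleWithResidue.add_analyticAt ?_ (hAa _)
    refine HasSimplePoleWithResidue.comp_add_const ?_
    have e : (M : ℂ) - 1 - j + (1 - M) = -j := by ring
    rw [e]
    exact hG.mellinContinuation_hasSimplePole j
  have han : ∀ s : ℂ, (∀ j : ℕ, s ≠ (M : ℂ) - 1 - j) → AnalyticAt ℂ z s := fun s hs ↦ by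
    refine AnalyticAt.add ?_ (hAa s)
    refine AnalyticAt.fun_comp (hG.analyticAt_mellinContinuation fun j hj ↦ hs j ?_) (by fun_prop)
    rw [← sub_eq_zero] at hj ⊢
    rw [← hj]
    ring
  have hc0 : c 0 = if M = 0 then 0 else a (M - 1) := by
    rcases Nat.eq_zero_or_pos M with h | h
    · simp [hcdef, h]
    · simp [hcdef, h, h.ne']
  have hck : ∀ k ∈ Finset.Icc 1 (M - 1), c k = a (M - 1 - k) / k := fun k hk ↦ by
    rw [Finset.mem_Icc] at hk
    have h1 : k < M := by omega
    have h2 : k ≠ 0 := by omega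
    simp [hcdef, h1, h2]
  have hres0 : HasSimplePoleWithResidue z 0 (c 0) := by
    rw [hc0]
    rcases Nat.eq_zero_or_pos M with h | h
    · rw [if_pos h]
      refine .of_analyticAt (han 0 (ne_sub_natCast_of_re ?_))
      simp [h]
    · rw [if_neg h.ne']
      have := hpole (M - 1)
      rwa [Nat.cast_sub h, Nat.cast_one, sub_self] at this
  refine ⟨z, c, F, fun s hs ↦ (hpos s hs).1, fun s hs ↦ ?_, han, fun j ↦ ⟨_, hpole j⟩, hint, ?_,
    fun k hk ↦ ?_, hres0, ?_, fun k hk ↦ by simp [hcdef, hk.not_gt]⟩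
  · rw [(hpos s hs).2, hz]
    beta_reduce
    rw [hG.mellinContinuation_eq_mellin (by simp; linarith)]
    congr 2
    ring
  · refine (hG.cutoff_isBigO M).congr' ?_ EventuallyEq.rfl
    filter_upwards [Ioo_mem_nhdsGT hδ] with ε hε
    have hsum : ∑ k ∈ Finset.Icc 1 (M - 1), c k * (((ε ^ k)⁻¹ : ℝ) : ℂ) =
        ∑ k ∈ Finset.Icc 1 (M - 1), a (M - 1 - k) / k * (((ε ^ k)⁻¹ : ℝ) : ℂ) :=
      Finset.sum_congr rfl fun k hk ↦ by rw [hck k hk]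
    rw [hcut ε hε.1 hε.2, hsum, hc0, hF]
    ring
  · have hk' := hk
    rw [Finset.mem_Icc] at hk
    have hk0 : (k : ℂ) ≠ 0 := by exact_mod_cast (by omega : k ≠ 0)
    rw [hck k hk', mul_div_cancel₀ _ hk0]
    have := hpole (M - 1 - k)
    rwa [Nat.cast_sub (by omega), Nat.cast_sub (by omega), Nat.cast_one, sub_sub_cancel] at this
  · -- near `0` the continuation is a sum of polar terms and the Mellin transform of a Taylor tail
    have hre : -(M : ℝ) < ((0 : ℂ) + (1 - M)).re := by simp
    have hlim : Tendsto (fun s : ℂ ↦ mellin (taylorTail G a M) (s + (1 - M)) +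
        ∑ k ∈ Finset.Icc 1 (M - 1), a (M - 1 - k) / (s - k) + A (s - M)) (𝓝[≠] 0) (𝓝 F) := by
      have hcont : ContinuousAt (fun s : ℂ ↦ mellin (taylorTail G a M) (s + (1 - M)) +
          ∑ k ∈ Finset.Icc 1 (M - 1), a (M - 1 - k) / (s - k) + A (s - M)) 0 := by
        refine ContinuousAt.add (ContinuousAt.add ?_ ?_) (hAa 0).continuousAt
        · exact ContinuousAt.comp' (f := fun s : ℂ ↦ s + (1 - (M : ℂ)))
            (hG.differentiableAt_tail M hre).continuousAt (by fun_prop)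
        · refine tendsto_finsetSum _ fun k hk ↦ ?_
          rw [Finset.mem_Icc] at hk
          have hk0 : (0 : ℂ) - k ≠ 0 := by
            rw [zero_sub, neg_ne_zero]
            exact_mod_cast (by omega : k ≠ 0)
          exact ContinuousAt.div continuousAt_const (by fun_prop) hk0
      have := hcont.tendsto.mono_left (nhdsWithin_le_nhds (s := {0}ᶜ))
      convert this using 2
      rw [hF, zero_add, sub_eq_add_neg, ← Finset.sum_neg_distrib]
      congr 2
      · refine Finset.sum_congr rfl fun k _ ↦ ?_
        rw [zero_sub, div_neg]
      · rw [zero_sub]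
    refine hlim.congr' ?_
    have hev : ∀ᶠ s : ℂ in 𝓝[≠] 0, -(M : ℝ) < (s + (1 - M)).re :=
      nhdsWithin_le_nhds (((by fun_prop : Continuous fun s : ℂ ↦ (s + (1 - (M : ℂ))).re).tendsto
        0).eventually (lt_mem_nhds hre))
    filter_upwards [hev] with s hs
    rw [hz]
    beta_reduce
    rw [hG.mellinContinuation_eq M hs, hc0]
    rcases Nat.eq_zero_or_pos M with h | h
    · simp [h]
    · have e : ∑ j ∈ Finset.range M, a j / (s + (1 - M) + j) =
          a (M - 1) / s + ∑ k ∈ Finset.Icc 1 (M - 1), a (M - 1 - k) / (s - k) := by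
        obtain ⟨m, rfl⟩ : ∃ m, M = m + 1 := ⟨M - 1, by omega⟩
        rw [Nat.add_sub_cancel, ← sum_range_eq_sum_Icc m fun j k ↦ a j / (s - k),
          Finset.sum_range_succ, add_comm]
        congr 1
        · push_cast
          ring_nf
        · refine Finset.sum_congr rfl fun j hj ↦ ?_
          rw [Nat.cast_sub (Finset.mem_range.1 hj).le]
          push_cast
          congr 1
          ring
      rw [e, if_neg h.ne']
      ring

end Zeta

/-! ### Change of the defining function -/

section Comparison

/-- The identity theorem for a meromorphic and a holomorphic function on the half-plane
`Re s > -1`, as it applies near the origin. -/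
theorem eventually_eq_of_eq_on_right {f B : ℂ → ℂ} {N : ℕ} (hf : ∀ s, MeromorphicAt f s)
    (hB : ∀ s : ℂ, -1 < s.re → DifferentiableAt ℂ B s)
    (h : ∀ s : ℂ, (N : ℝ) - 1 < s.re → f s = B s) : ∀ᶠ s in 𝓝[≠] (0 : ℂ), f s = B s := by
  set U : Set ℂ := {s | -1 < s.re} with hU
  have hUo : IsOpen U := isOpen_lt continuous_const Complex.continuous_re
  have hconv : Convex ℝ U := convex_halfSpace_re_gt (-1)
  have hBa : ∀ s ∈ U, AnalyticAt ℂ B s := fun s hs ↦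
    DifferentiableOn.analyticAt (fun t ht ↦ (hB t ht).differentiableWithinAt) (hUo.mem_nhds hs)
  have hm : MeromorphicOn (fun s ↦ f s - B s) U := fun s hs ↦
    (hf s).sub (hBa s hs).meromorphicAt
  have h0 : (0 : ℂ) ∈ U := by simp [hU]
  have hN : (N : ℂ) ∈ U := by
    have : (0 : ℝ) ≤ N := N.cast_nonneg
    simp only [hU, mem_ofPred_eq, Complex.natCast_re]
    linarith
  have key : meromorphicOrderAt (fun s ↦ f s - B s) 0 = ⊤ := by
    by_contra hne
    refine (hm.exists_meromorphicOrderAt_ne_top_iff_forall_mem ⟨⟨0, h0⟩, hconv.isPreconnected⟩).1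
      ⟨0, h0, hne⟩ N hN ?_
    rw [meromorphicOrderAt_eq_top_iff]
    have : ∀ᶠ s : ℂ in 𝓝 (N : ℂ), (N : ℝ) - 1 < s.re :=
      Complex.continuous_re.continuousAt.eventually (lt_mem_nhds (by simp))
    filter_upwards [nhdsWithin_le_nhds this] with s hs
    rw [h s hs, sub_self]
  filter_upwards [meromorphicOrderAt_eq_top_iff.1 key] with s hs using sub_eq_zero.1 hs

theorem ofReal_mul_exp_cpow {a : ℝ} (ha : 0 ≤ a) (t : ℝ) (s : ℂ) :
    ((a * Real.exp t : ℝ) : ℂ) ^ s = (a : ℂ) ^ s * Complex.exp (s * t) := by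
  rw [Complex.ofReal_mul, Complex.mul_cpow_ofReal_nonneg ha (Real.exp_pos t).le,
    Complex.cpow_def_of_ne_zero (x := ((Real.exp t : ℝ) : ℂ))
      (by exact_mod_cast (Real.exp_pos t).ne'),
    ← Complex.ofReal_log (Real.exp_pos t).le, Real.log_exp, mul_comm (t : ℂ)]

variable {n : ℕ} [NeZero n] {X : Type*} [TopologicalSpace X]
  [ChartedSpace (EuclideanHalfSpace n) X] [IsManifold (𝓡∂ n) ∞ X] {Y : Set X}
  {lam : X → ℝ} {w : TopForm n X} {M : ℕ} [T2Space X] [SigmaCompactSpace X]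
  {o : ManifoldOrientation n X} {φ : X → ℝ}

/-- After multiplication by `s (s - 1) ⋯ (s - M + 1)` the zeta integrals of `w` for `lam` and for
`lam * exp φ`, and that of `φ w` for `lam`, are holomorphic on `Re s > -1`; at the origin the first
two agree, and their derivatives differ by the value of the third. -/
theorem exists_regular_formIntegral (o : ManifoldOrientation n X)
    (hY : IsUnionOfBoundaryComponents n Y) (hl : IsDefiningFunction n Y lam)
    (hp : HasPoleOfOrder Y M w) (hc : HasCompactSupportIn Y w)
    (hφ : ContMDiff (𝓡∂ n) 𝓘(ℝ, ℝ) ∞ φ) (hM : M ≠ 0) :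
    ∃ B₀ Bφ Bm : ℂ → ℂ,
      (∀ s : ℂ, -1 < s.re → DifferentiableAt ℂ B₀ s ∧ DifferentiableAt ℂ Bφ s ∧
        DifferentiableAt ℂ Bm s) ∧
      (∀ s : ℂ, (M : ℝ) - 1 < s.re →
        fallingPoly M s * formIntegral o Yᶜ (powForm lam s w) = B₀ s ∧
        fallingPoly M s * formIntegral o Yᶜ (powForm (fun x ↦ lam x * Real.exp (φ x)) s w) =
          Bφ s ∧
        fallingPoly M s * formIntegral o Yᶜ (powForm lam s (mulForm φ w)) = Bm s) ∧
      Bφ 0 = B₀ 0 ∧ HasDerivAt (fun s ↦ Bφ s - B₀ s) (Bm 0) 0 := by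
  obtain ⟨η, hη, hw⟩ := hp.exists_smooth hY hl
  set K : Set X := closure {x : X | x ∉ Y ∧ w x ≠ 0} with hK
  have hwK : ∀ x ∉ Y, x ∉ K → w x = 0 := fun x hx hxK ↦ by
    by_contra h0
    exact hxK (subset_closure ⟨hx, h0⟩)
  have hηK : ∀ x ∉ Y, x ∉ K → η x = 0 := fun x hx hxK ↦ by
    rw [hw x hx, hwK x hx hxK]
    exact ContinuousAlternatingMap.ext fun v ↦ smul_zero (lam x ^ M)
  choose B₀ Bφ Bm hd hB h0 h1 using fun p ↦ (isBoundaryChart_chartFun hY hl p).exists_regular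
    (contDiffOn_comp_symm hφ p) (isTest_chartDensity hY hη hc hηK o p) hM
  set T := (finite_chartPartition_inter n hc).toFinset with hT
  -- a form `u = lam ^ (s - M) k η` integrates to the sum of the integrals over the charts
  have key : ∀ (s : ℂ) (u : TopForm n X) (k : X → ℂ),
      (∀ x ∉ Y, u x = ((lam x : ℂ) ^ (s - M) * k x) • η x) →
      formIntegral o Yᶜ u = ∑ p ∈ T, ∫ y in {y | 0 < chartFun p lam y},
        (chartFun p lam y : ℂ) ^ (s - M) *
          (k ((extChartAt (𝓡∂ n) p).symm y) * chartDensity o η p y) := by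
    intro s u k hu
    rw [formIntegral_eq_sum hc (u := u) fun x hx hxK ↦ by
      rw [hu x hx, hηK x hx hxK]
      exact ContinuousAlternatingMap.ext fun v ↦ smul_zero _]
    refine Finset.sum_congr rfl fun p _ ↦ ?_
    rw [setOf_pos_chartFun hl p]
    refine setIntegral_congr_fun (measurableSet_chartImage_compl hY hl p) fun y hy ↦ ?_
    rw [localDensity_congr_smul (hu _ hy.2), chartDensity_of_mem hy.1, chartFun_of_mem hy.1]
    ring
  refine ⟨fun s ↦ ∑ p ∈ T, B₀ p s, fun s ↦ ∑ p ∈ T, Bφ p s, fun s ↦ ∑ p ∈ T, Bm p s,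
    fun s hs ↦ ⟨.fun_sum fun p _ ↦ (hd p s hs).1, .fun_sum fun p _ ↦ (hd p s hs).2.1,
      .fun_sum fun p _ ↦ (hd p s hs).2.2⟩, fun s hs ↦ ⟨?_, ?_, ?_⟩,
    Finset.sum_congr rfl fun p _ ↦ h0 p, ?_⟩
  · rw [key s _ (fun _ ↦ 1) fun x hx ↦ by
      rw [mul_one, powForm_eq_smul (hl.pos_off x hx) (hw x hx)], Finset.mul_sum]
    refine Finset.sum_congr rfl fun p _ ↦ ?_
    rw [← (hB p s hs).1, twistedIntegral]
    simp
  · rw [key s _ (fun x ↦ Complex.exp (s * φ x)) fun x hx ↦ ?_, Finset.mul_sum]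
    · exact Finset.sum_congr rfl fun p _ ↦ (hB p s hs).2.1
    · have := powForm_eq_smul (hl.pos_off x hx) (hw x hx) s
      rw [powForm] at this ⊢
      rw [ofReal_mul_exp_cpow (hl.nonneg x), mul_comm, mul_smul, this, ← mul_smul, mul_comm]
  · rw [key s _ (fun x ↦ (φ x : ℂ)) fun x hx ↦ ?_, Finset.mul_sum]
    · refine Finset.sum_congr rfl fun p _ ↦ ?_
      rw [← (hB p s hs).2.2, twistedIntegral]
      simp
    · have := powForm_eq_smul (hl.pos_off x hx) (hw x hx) s
      rw [powForm] at this ⊢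
      rw [mul_comm, mul_smul, ← this, mulForm, smul_comm]
      exact ContinuousAlternatingMap.ext fun v ↦ (Complex.coe_smul _ _).symm
  · simp only [← Finset.sum_sub_distrib]
    exact HasDerivAt.fun_sum fun p _ ↦ h1 p

/-- The residue at `0` does not depend on the defining function, and the dependence of the finite
part is given by a residue. -/
theorem IsZeta.compare {z z' z'' : ℂ → ℂ} {c c' c'' : ℕ → ℂ} {F F' F'' : ℂ}
    (hY : IsUnionOfBoundaryComponents n Y) (hl : IsDefiningFunction n Y lam)
    (hp : HasPoleOfOrder Y M w) (hc : HasCompactSupportIn Y w)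
    (hφ : ContMDiff (𝓡∂ n) 𝓘(ℝ, ℝ) ∞ φ) (h : IsZeta o Y M lam w z c F)
    (h' : IsZeta o Y M (fun x ↦ lam x * Real.exp (φ x)) w z' c' F')
    (h'' : IsZeta o Y M lam (mulForm φ w) z'' c'' F'') :
    c' 0 = c 0 ∧ F' = F + c'' 0 := by
  -- overestimating the order makes the polynomial below vanish at the origin
  replace h := h.mono M.le_succ
  replace h' := h'.mono M.le_succ
  replace h'' := h''.mono M.le_succ
  obtain ⟨B₀, Bφ, Bm, hd, hB, hB0, hB1⟩ := exists_regular_formIntegral o hY hl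
    (hp.mono M.le_succ) hc hφ M.succ_ne_zero
  set q : ℂ → ℂ := fun s ↦ ∏ i ∈ Finset.range M, (s - ((i + 1 : ℕ) : ℂ)) with hq
  have hfq : ∀ s, fallingPoly M.succ s = q s * s := fun s ↦ by
    rw [fallingPoly, Finset.prod_range_succ', Nat.cast_zero, sub_zero]
  have hq0 : q 0 ≠ 0 := Finset.prod_ne_zero_iff.2 fun i _ ↦ by
    rw [zero_sub, neg_ne_zero]
    exact_mod_cast i.succ_ne_zero
  have hqt : Tendsto q (𝓝[≠] 0) (𝓝 (q 0)) :=
    ((by fun_prop : Continuous q).tendsto 0).mono_left nhdsWithin_le_nhds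
  have hfm : ∀ s, MeromorphicAt (fallingPoly M.succ) s := fun s ↦
    ((differentiable_fallingPoly M.succ).analyticAt s).meromorphicAt
  have e := eventually_eq_of_eq_on_right (fun s ↦ (hfm s).mul (h.meromorphicAt s))
    (fun s hs ↦ (hd s hs).1) fun s hs ↦ by
      rw [Pi.mul_apply, h.eq_formIntegral s hs, (hB s hs).1]
  have e' := eventually_eq_of_eq_on_right (fun s ↦ (hfm s).mul (h'.meromorphicAt s))
    (fun s hs ↦ (hd s hs).2.1) fun s hs ↦ by
      rw [Pi.mul_apply, h'.eq_formIntegral s hs, (hB s hs).2.1]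
  have e'' := eventually_eq_of_eq_on_right (fun s ↦ (hfm s).mul (h''.meromorphicAt s))
    (fun s hs ↦ (hd s hs).2.2) fun s hs ↦ by
      rw [Pi.mul_apply, h''.eq_formIntegral s hs, (hB s hs).2.2]
  simp only [Pi.mul_apply, hfq] at e e' e''
  have res : ∀ {f B : ℂ → ℂ} {r : ℂ}, (∀ᶠ s in 𝓝[≠] (0 : ℂ), q s * s * f s = B s) →
      DifferentiableAt ℂ B 0 → HasSimplePoleWithResidue f 0 r → B 0 = q 0 * r := by
    intro f B r hev hBd hf
    have h1 := hqt.mul hf.tendsto_mul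
    have h2 := hBd.continuousAt.tendsto.mono_left (nhdsWithin_le_nhds (s := {0}ᶜ))
    refine tendsto_nhds_unique h2 (h1.congr' ?_)
    filter_upwards [hev] with s hs
    rw [← hs, sub_zero, mul_assoc]
  have d0 := hd 0 (by simp)
  have r := res e d0.1 h.residue_zero
  have r' := res e' d0.2.1 h'.residue_zero
  have r'' := res e'' d0.2.2 h''.residue_zero
  have hcc : c' 0 = c 0 := mul_left_cancel₀ hq0 (by rw [← r', ← r, hB0])
  refine ⟨hcc, ?_⟩
  have t1 := hqt.mul (h'.finite_part.sub h.finite_part)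
  have t2 := hasDerivAt_iff_tendsto_slope.1 hB1
  have t3 := tendsto_nhds_unique t2 (t1.congr' ?_)
  · rw [r''] at t3
    have := mul_left_cancel₀ hq0 t3
    rw [this]
    ring
  · filter_upwards [e, e', self_mem_nhdsWithin] with s hs hs' hs0
    have hs0' : s ≠ 0 := hs0
    rw [slope_def_field, hB0, ← hs, ← hs', hcc]
    field_simp
    ring

end Comparison

end BoundaryZeta

end

theorem mainTheorem10 (n : ℕ) [NeZero n] (X : Type*) [TopologicalSpace X] [T2Space X]
    [SigmaCompactSpace X] [ChartedSpace (EuclideanHalfSpace n) X] [IsManifold (𝓡∂ n) ∞ X]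
    (o : BoundaryZeta.ManifoldOrientation n X)
    (Y : Set X) (hY : BoundaryZeta.IsUnionOfBoundaryComponents n Y) :
    -- the continued zeta function, the coefficients `I₋ₖ(lam, w)`, `I₀(w)`, `I_finite(lam, w)`
    ∃ (zeta : (X → ℝ) → BoundaryZeta.TopForm n X → ℂ → ℂ)
      (Ineg : ℕ → (X → ℝ) → BoundaryZeta.TopForm n X → ℂ)
      (I0 : BoundaryZeta.TopForm n X → ℂ)
      (Ifin : (X → ℝ) → BoundaryZeta.TopForm n X → ℂ),
    ∀ (M : ℕ) (lam : X → ℝ) (w : BoundaryZeta.TopForm n X),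
      BoundaryZeta.IsDefiningFunction n Y lam →
      BoundaryZeta.HasPoleOfOrder Y M w →
      BoundaryZeta.HasCompactSupportIn Y w →
      -- (i)
      ((∀ s : ℂ, (M : ℝ) - 1 < s.re →
          BoundaryZeta.FormIntegrableOn o Yᶜ (BoundaryZeta.powForm lam s w)) ∧
        DifferentiableOn ℂ
          (fun s ↦ BoundaryZeta.formIntegral o Yᶜ (BoundaryZeta.powForm lam s w))
          {s : ℂ | (M : ℝ) - 1 < s.re} ∧
        (∀ s : ℂ, MeromorphicAt (zeta lam w) s) ∧
        (∀ s : ℂ, (M : ℝ) - 1 < s.re →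
          zeta lam w s = BoundaryZeta.formIntegral o Yᶜ (BoundaryZeta.powForm lam s w)) ∧
        (∀ s : ℂ, (∀ j : ℕ, s ≠ (M : ℂ) - 1 - j) → AnalyticAt ℂ (zeta lam w) s) ∧
        (∀ j : ℕ, ∃ r : ℂ,
          BoundaryZeta.HasSimplePoleWithResidue (zeta lam w) ((M : ℂ) - 1 - j) r)) ∧
      -- (ii)
      ((∀ ε : ℝ, 0 < ε → BoundaryZeta.FormIntegrableOn o {x | ε ≤ lam x} w) ∧
        (fun ε : ℝ ↦ BoundaryZeta.formIntegral o {x | ε ≤ lam x} w -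
            (∑ k ∈ Finset.Icc 1 (M - 1), Ineg k lam w * (((ε ^ k)⁻¹ : ℝ) : ℂ) +
              I0 w * ((Real.log (1 / ε) : ℝ) : ℂ) + Ifin lam w))
          =O[𝓝[>] (0 : ℝ)] (fun ε : ℝ ↦ ε)) ∧
      -- (iii)
      ((∀ k ∈ Finset.Icc 1 (M - 1), ∃ r : ℂ,
          BoundaryZeta.HasSimplePoleWithResidue (zeta lam w) (k : ℂ) r ∧
          Ineg k lam w = 1 / (k : ℂ) * r) ∧
        BoundaryZeta.HasSimplePoleWithResidue (zeta lam w) 0 (I0 w) ∧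
        Tendsto (fun s : ℂ ↦ zeta lam w s - I0 w / s) (𝓝[≠] 0) (𝓝 (Ifin lam w))) ∧
      -- (iv)
      (∀ φ : X → ℝ, ContMDiff (𝓡∂ n) 𝓘(ℝ, ℝ) ∞ φ →
        Ifin (fun x ↦ lam x * Real.exp (φ x)) w =
          Ifin lam w + I0 (BoundaryZeta.mulForm φ w))
  := by
  classical
  -- with the least possible order the data depend on the form and the defining function only
  have hmain : ∀ (lam : X → ℝ) (w : BoundaryZeta.TopForm n X), ∃ (z : ℂ → ℂ) (c : ℕ → ℂ) (F : ℂ),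
      ∀ M : ℕ, BoundaryZeta.IsDefiningFunction n Y lam → BoundaryZeta.HasPoleOfOrder Y M w →
        BoundaryZeta.HasCompactSupportIn Y w → BoundaryZeta.IsZeta o Y M lam w z c F := by
    intro lam w
    by_cases h : BoundaryZeta.IsDefiningFunction n Y lam ∧
        (∃ M : ℕ, BoundaryZeta.HasPoleOfOrder Y M w) ∧ BoundaryZeta.HasCompactSupportIn Y w
    · obtain ⟨hl, hp, hc⟩ := h
      obtain ⟨z, c, F, hz⟩ := BoundaryZeta.exists_isZeta o hY hl (Nat.find_spec hp) hc
      exact ⟨z, c, F, fun M _ hM _ ↦ hz.mono (Nat.find_min' hp hM)⟩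
    · exact ⟨0, 0, 0, fun M hl hp hc ↦ absurd ⟨hl, ⟨M, hp⟩, hc⟩ h⟩
  choose z c F hz using hmain
  have hI0 : ∀ w : BoundaryZeta.TopForm n X, ∃ r : ℂ, ∀ (M : ℕ) (lam : X → ℝ),
      BoundaryZeta.IsDefiningFunction n Y lam → BoundaryZeta.HasPoleOfOrder Y M w →
        BoundaryZeta.HasCompactSupportIn Y w → c lam w 0 = r := by
    intro w
    by_cases h : ∃ lam₀ : X → ℝ, BoundaryZeta.IsDefiningFunction n Y lam₀
    · obtain ⟨lam₀, hl₀⟩ := h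
      refine ⟨c lam₀ w 0, fun M lam hl hp hc ↦ ?_⟩
      obtain ⟨φ, hφ, hlφ⟩ := hl₀.exists_eq_mul_exp hY hl
      obtain rfl : lam = fun x ↦ lam₀ x * Real.exp (φ x) := funext hlφ
      exact (BoundaryZeta.IsZeta.compare hY hl₀ hp hc hφ (hz _ w M hl₀ hp hc) (hz _ w M hl hp hc)
        (hz _ _ M hl₀ (hp.mulForm hφ) (hc.mulForm φ))).1
    · exact ⟨0, fun M lam hl ↦ absurd ⟨lam, hl⟩ h⟩
  choose I0 hI0 using hI0
  refine ⟨z, fun k lam w ↦ c lam w k, I0, F, fun M lam w hl hp hc ↦ ?_⟩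
  have hZ := hz lam w M hl hp hc
  have h0 := hI0 w M lam hl hp hc
  refine ⟨⟨hZ.integrable, hZ.differentiableOn, hZ.meromorphicAt, hZ.eq_formIntegral, hZ.analyticAt,
    hZ.pole⟩, ⟨hZ.integrable_cutoff, h0 ▸ hZ.cutoff⟩, ⟨fun k hk ↦ ⟨_, hZ.residue k hk, ?_⟩,
    h0 ▸ hZ.residue_zero, h0 ▸ hZ.finite_part⟩, fun φ hφ ↦ ?_⟩
  · have hk0 : (k : ℂ) ≠ 0 := Nat.cast_ne_zero.2 (Nat.one_le_iff_ne_zero.1 (Finset.mem_Icc.1 hk).1)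
    field_simp
  · have hpφ := hp.mulForm hφ
    have hcφ := hc.mulForm φ
    rw [← hI0 _ M lam hl hpφ hcφ]
    exact (BoundaryZeta.IsZeta.compare hY hl hp hc hφ hZ (hz _ w M (hl.mul_exp hφ) hp hc)
      (hz _ _ M hl hpφ hcφ)).2
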